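/- **Theorem 2 (strong selection consistency for hyper-pMOM priors).** For each sample size $n\ge 1$ let $X_n$ be a deterministic $n\times p_n$ design matrix and let the data be $y_n = X_n\beta_0+\epsilon_n$, where the entries of $\epsilon_n$ are i.i.d. $N(0,\sigma_0^2)$ with $\sigma_0^2>0$. Let $t\subseteq\{1,\dots,p_n\}$ be the set of indices of the nonzero entries of $\beta_0$ (the true model); $t$, the nonzero entries of $\beta_0$, and $\sigma_0^2$ do not depend on $n$. A model is a subset $k\subseteq\{1,\dots,p_n\}$; $|k|$ is its size, $X_k$ is the matrix of the columns of $X_n$ in $k$, and $A_k$ is the principal submatrix, with indices in $k$, of a symmetric $p_n\times p_n$ matrix $A_{p_n}$. Fix an integer $r\ge 1$ and $\alpha_1,\alpha_2>0$. Consider the hierarchical model with prior probabilities $\pi(k)=\pi_n(k)$ on the models and $$Y_n\mid\beta_k,\sigma^2,k\sim N(X_k\beta_k,\sigma^2 I_n),$$ $$\pi(\beta_k\mid\tau,\sigma^2,k)=d_k(2\pi)^{-|k|/2}(\tau\sigma^2)^{-r|k|-|k|/2}\,|A_k|^{1/2}\exp\Big\{-\frac{\beta_k^{T}A_k\beta_k}{2\tau\sigma^2}\Big\}\prod_{i\in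 k}\beta_i^{2r},$$ $$\pi(\tau)=\frac{(n/2)^{1/2}}{\Gamma(1/2)}\tau^{-3/2}e^{-n/(2\tau)},\qquad \pi(\sigma^2)=\frac{\alpha_2^{\alpha_1}}{\Gamma(\alpha_1)}(\sigma^2)^{-(\alpha_1+1)}e^{-\alpha_2/\sigma^2}\qquad(\tau,\sigma^2>0),$$ where $|A_k|$ is the determinant of $A_k$ and $d_k$ is the normalizing constant, independent of $\tau$ and $\sigma^2$. Let $$m_k(y)=\int_0^\infty\!\int_0^\infty\!\int_{\mathbb R^{k}}\pi(y\mid\beta_k,\sigma^2,k)\,\pi(\beta_k\mid\tau,\sigma^2,k)\,\pi(\tau)\,\pi(\sigma^2)\,d\beta_k\,d\sigma^2\,d\tau,\qquad \pi(k\mid y)=\frac{\pi(k)\,m_k(y)}{\sum_{l}\pi(l)\,m_l(y)}.$$ Assume that there are numbers $\epsilon_n\in(0,1)$, nonnegative integers $q_n$, and constants $\gamma,\xi\in\mathbb R$, $\omega>0$, $0<a_1<a_2<\infty$, not depending on $n$, such that: 1. for all $n\ge1$ and all models $k$ with $|k|\le q_n+|t|$, the $\min(n,|k|)$ largest eigenvalues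 of $X_k^TX_k/n$ (with multiplicity) lie in $[\epsilon_n,\epsilon_n^{-1}]$, and $\epsilon_n^{-1}=O((\log n)^{1/8})$; 2. $p_n=O(n^\gamma)$ with $\gamma<r$; 3. $\pi(k)=0$ whenever $|k|>q_n$, where $q_n=O(n^\xi)$ and $\xi<1$; 4. $\pi(t)/\pi(k)>\omega$ for every $n\ge 1$ and every $k$ with $\pi(k)>0$; 5. for every $n\ge1$ all eigenvalues of $A_{p_n}$ lie in $(a_1,a_2)$. Assume in addition that $\xi<1-\frac{4\gamma}{3r}$. Then $\pi(t\mid y_n)\to1$ in probability as $n\to\infty$. -/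

import Mathlib

open MeasureTheory ProbabilityTheory Filter Topology Asymptotics
open scoped ENNReal NNReal Matrix

noncomputable section

namespace HyperPMOM

/-- The columns of the design matrix `X` that belong to the model `k`. -/
def designSub {n p : ℕ} (X : Matrix (Fin n) (Fin p) ℝ) (k : Finset (Fin p)) :
    Matrix (Fin n) k ℝ :=
  X.submatrix id (fun i : k => (i : Fin p))

/-- The principal submatrix of `A` with rows and columns in the model `k`. -/
def principalSub {p : ℕ} (A : Matrix (Fin p) (Fin p) ℝ) (k : Finset (Fin p)) :
    Matrix k k ℝ :=
  A.submatrix (fun i : k => (i : Fin p)) (fun i : k => (i : Fin p))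

/-- The normalized Gram matrix `X_kᵀ X_k / n`. -/
def gram {n p : ℕ} (X : Matrix (Fin n) (Fin p) ℝ) (k : Finset (Fin p)) : Matrix k k ℝ :=
  (n : ℝ)⁻¹ • ((designSub X k)ᵀ * designSub X k)

theorem gram_isHermitian {n p : ℕ} (X : Matrix (Fin n) (Fin p) ℝ) (k : Finset (Fin p)) :
    (gram X k).IsHermitian := by
  unfold gram
  simp [Matrix.IsHermitian, Matrix.conjTranspose_eq_transpose_of_trivial]

/-- The `min (n, |k|)` largest eigenvalues of `X_kᵀ X_k / n`, counted with multiplicity, all lie in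
`[ε, ε⁻¹]`. For `ε > 0` this says that `X_kᵀ X_k / n` has exactly `min (n, |k|)` nonzero
eigenvalues, and that they lie in `[ε, ε⁻¹]`. (`eigenvalues₀` is sorted in decreasing order.) -/
def EigenvalueBound {n p : ℕ} (X : Matrix (Fin n) (Fin p) ℝ) (ε : ℝ) (k : Finset (Fin p)) :
    Prop :=
  ∀ j : Fin (Fintype.card k), (j : ℕ) < min n k.card →
    ε ≤ (gram_isHermitian X k).eigenvalues₀ j ∧ (gram_isHermitian X k).eigenvalues₀ j ≤ ε⁻¹

/-- The density at `y` of the normal law `N(X_k β, σ² I_n)`; the argument `s` is `σ²`. -/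
def likelihood {n p : ℕ} (X : Matrix (Fin n) (Fin p) ℝ) (k : Finset (Fin p))
    (y : Fin n → ℝ) (β : k → ℝ) (s : ℝ) : ℝ :=
  (2 * Real.pi * s) ^ (-((n : ℝ) / 2)) *
    Real.exp (-((y - designSub X k *ᵥ β) ⬝ᵥ (y - designSub X k *ᵥ β)) / (2 * s))

/-- The pMOM density of order `r` without its normalizing constant; `v` is `τ σ²`. -/
def pmomKernel {p : ℕ} (r : ℕ) (A : Matrix (Fin p) (Fin p) ℝ) (k : Finset (Fin p))
    (v : ℝ) (β : k → ℝ) : ℝ :=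
  (2 * Real.pi) ^ (-((k.card : ℝ) / 2)) *
    v ^ (-((r : ℝ) * k.card) - (k.card : ℝ) / 2) *
    Real.sqrt (principalSub A k).det *
    Real.exp (-(β ⬝ᵥ (principalSub A k *ᵥ β)) / (2 * v)) *
    ∏ i, β i ^ (2 * r)

/-- The normalizing constant `d_k` of the pMOM density. By scaling it does not depend on
`v = τ σ²`, so it is computed at `v = 1`. -/
def pmomConst {p : ℕ} (r : ℕ) (A : Matrix (Fin p) (Fin p) ℝ) (k : Finset (Fin p)) : ℝ :=
  (∫ β : k → ℝ, pmomKernel r A k 1 β)⁻¹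

/-- The pMOM prior density `π(β_k | τ, σ², k)`; `v` is `τ σ²`. -/
def pmomDensity {p : ℕ} (r : ℕ) (A : Matrix (Fin p) (Fin p) ℝ) (k : Finset (Fin p))
    (v : ℝ) (β : k → ℝ) : ℝ :=
  pmomConst r A k * pmomKernel r A k v β

/-- The density on `(0, ∞)` of the inverse-gamma law with shape `a` and scale `b`. -/
def invGammaDensity (a b x : ℝ) : ℝ :=
  b ^ a / Real.Gamma a * x ^ (-(a + 1)) * Real.exp (-b / x)

/-- The marginal density `m_k(y)` under model `k`: here `τ` is inverse-gamma `(1/2, n/2)` and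
`s = σ²` is inverse-gamma `(α₁, α₂)`. -/
def marginal {n p : ℕ} (r : ℕ) (α₁ α₂ : ℝ) (X : Matrix (Fin n) (Fin p) ℝ)
    (A : Matrix (Fin p) (Fin p) ℝ) (k : Finset (Fin p)) (y : Fin n → ℝ) : ℝ≥0∞ :=
  ∫⁻ τ in Set.Ioi (0 : ℝ), ∫⁻ s in Set.Ioi (0 : ℝ), ∫⁻ β : k → ℝ,
    ENNReal.ofReal (likelihood X k y β s * pmomDensity r A k (τ * s) β *
      invGammaDensity (1 / 2) ((n : ℝ) / 2) τ * invGammaDensity α₁ α₂ s)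

/-- The posterior probability `π(k | y)`, with prior `prior` on the space of models. -/
def posterior {n p : ℕ} (r : ℕ) (α₁ α₂ : ℝ) (X : Matrix (Fin n) (Fin p) ℝ)
    (A : Matrix (Fin p) (Fin p) ℝ) (prior : PMF (Finset (Fin p)))
    (k : Finset (Fin p)) (y : Fin n → ℝ) : ℝ :=
  (prior k * marginal r α₁ α₂ X A k y /
    ∑ l : Finset (Fin p), prior l * marginal r α₁ α₂ X A l y).toReal

/-- The model given by a set `t` of indices, as a set of columns of a design with `p` columns. -/
def modelOf (p : ℕ) (t : Finset ℕ) : Finset (Fin p) :=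
  Finset.univ.filter (fun j : Fin p => (j : ℕ) ∈ t)

/-- The responses `X β₀ + e`. -/
def response {n p : ℕ} (X : Matrix (Fin n) (Fin p) ℝ) (β₀ : ℕ → ℝ) (e : Fin n → ℝ) :
    Fin n → ℝ :=
  X *ᵥ (fun j : Fin p => β₀ j) + e

end HyperPMOM

end

namespace HyperPMOM

/-! The prior odds are bounded below, so it suffices that the sum over k ≠ t of the ratios m_k / m_t
tends to 0 in probability (`dist_posterior_le`). Let R_k be the residual sum of squares of k, v =
σ₀² and N = n/2 + α₁.

Integrating out β, τ and σ² bounds m_k by a factor common to all models times (const · |k|^(r+1/2)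
ε^(-(2r+1)) / n^(r+1))^|k| · S_k^(-N), where S_k = R_k/2 + α₂ - r|k| (`marginal_le`,
`marginal_le_rss`). Of the penalty n^(-(r+1)) per variable, n^(-(r+1/2)) is due to the prior of τ,
whose scale is n, and n^(-1/2) to the Gaussian integral over β. For the true model, restricting τ to
[n, 2n] and β to a small box around the least squares estimate gives a matching lower bound, with a
quantity H close to R_t/2 in place of S_t (`le_marginal`, `le_marginal_rss`). A ratio is therefore
at most a deterministic weight times (H/S_k)^N ≤ exp(N (H - S_k) / S_k).

Call an error vector typical if its squared norm lies between 0.9 n v and 4 n v and its projections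
onto the column spaces of all k ∪ t with |k| ≤ q have squared norm at most v n^ζ, where max(ξ, 0) <
ζ < 1. Chernoff and union bounds show that typical errors have probability tending to 1. For them N
/ S_k ≤ 7/(6v), and two cases remain (`exists_ratio_bound`).

If k omits a true variable, then R_k - R_t is at least a constant times nε, and the ratio carries
exp(-c n ε²). This beats the polynomial factor n^((r+1)|t|), and the remaining weights sum over all
models to at most exp(pθ), where θ is the growth factor per variable.

If k strictly contains t, then R_t - R_k is the squared norm of the projection of the errors onto a
space of dimension at most |k \ t|, and the ratio is at most θ^|k \ t| exp((7/12) χ²). A chi-squared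
variable has exponential moments only below 1/2, so this bound need not have finite mean; its power
3/4 does, since (3/4)(7/12) = 7/16 < 1/2. A small sum of powers 3/4 forces a small sum
(`sum_le_of_sum_rpow_le`), so Markov's inequality reduces the claim to p θ^(3/4) → 0. Up to
constants and powers of 1/ε, θ is n^(ξ(r+1/2) - (r+1)), and ξ < 1 - 4γ/(3r) makes the exponent of p
θ^(3/4) negative (`exists_exponent`). -/

/-! ### Inverse-gamma integrals and the Gamma function -/

theorem integrableOn_rpow_mul_exp_neg_div {a b : ℝ} (ha : 0 < a) (hb : 0 < b) :
    IntegrableOn (fun x : ℝ => x ^ (-(a + 1)) * Real.exp (-b / x)) (Set.Ioi 0) := by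
  have h1 : IntegrableOn (fun x : ℝ => x ^ (a - 1) * Real.exp (-(b * x))) (Set.Ioi 0) := by
    have := integrableOn_rpow_mul_exp_neg_mul_rpow (s := a - 1) (p := 1) (b := b)
      (by linarith) one_pos hb
    simpa using this
  -- The substitution x ↦ 1/x turns the Gamma integrand into the inverse-gamma one.
  rw [← integrableOn_Ioi_comp_rpow_iff' _ (p := -1) (by norm_num)] at h1
  refine h1.congr_fun (fun x hx => ?_) measurableSet_Ioi
  have hx : 0 < x := hx
  simp only [smul_eq_mul]
  rw [← Real.rpow_mul hx.le, ← mul_assoc, ← Real.rpow_add hx, Real.rpow_neg_one]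
  congr 2 <;> ring

theorem integral_rpow_mul_exp_neg_div {a b : ℝ} (ha : 0 < a) (hb : 0 < b) :
    ∫ x in Set.Ioi (0 : ℝ), x ^ (-(a + 1)) * Real.exp (-b / x) = Real.Gamma a * b ^ (-a) := by
  have h := integral_comp_rpow_Ioi (fun x : ℝ => x ^ (a - 1) * Real.exp (-(b * x))) (p := -1)
    (by norm_num)
  rw [Real.integral_rpow_mul_exp_neg_mul_Ioi ha hb] at h
  have hR : Real.Gamma a * b ^ (-a) = (1 / b) ^ a * Real.Gamma a := by
    rw [one_div, Real.inv_rpow hb.le, Real.rpow_neg hb.le, mul_comm]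
  rw [hR, ← h]
  refine setIntegral_congr_fun measurableSet_Ioi (fun x hx => ?_)
  have hx : 0 < x := hx
  simp only [smul_eq_mul, abs_neg, abs_one, one_mul]
  rw [← Real.rpow_mul hx.le, ← mul_assoc, ← Real.rpow_add hx, Real.rpow_neg_one]
  congr 2 <;> ring

/-- The mass of the unnormalized inverse-gamma density. -/
theorem lintegral_rpow_mul_exp_neg_div {a b : ℝ} (ha : 0 < a) (hb : 0 < b) :
    ∫⁻ x in Set.Ioi (0 : ℝ), ENNReal.ofReal (x ^ (-(a + 1)) * Real.exp (-b / x)) =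
      ENNReal.ofReal (Real.Gamma a * b ^ (-a)) := by
  rw [← integral_rpow_mul_exp_neg_div ha hb,
    ofReal_integral_eq_lintegral_ofReal (integrableOn_rpow_mul_exp_neg_div ha hb)]
  filter_upwards [ae_restrict_mem measurableSet_Ioi] with x hx
  have hx : 0 < x := hx
  positivity

/-- Raise x/a ≤ exp(x/a) to the power a. The sharp constant (a/e)^a is not needed; at a = 0 the
bound reads exp(-x) ≤ 0^0 = 1. -/
theorem rpow_mul_exp_neg_le {a x : ℝ} (ha : 0 ≤ a) (hx : 0 ≤ x) :
    x ^ a * Real.exp (-x) ≤ a ^ a := by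
  rcases ha.eq_or_lt with rfl | ha
  · simpa using hx
  have h1 : x / a ≤ Real.exp (x / a) := by linarith [Real.add_one_le_exp (x / a)]
  have h2 : (x / a) ^ a ≤ Real.exp x := by
    calc (x / a) ^ a ≤ (Real.exp (x / a)) ^ a := Real.rpow_le_rpow (by positivity) h1 ha.le
      _ = Real.exp x := by rw [← Real.exp_mul]; congr 1; field_simp
  rw [Real.div_rpow hx ha.le, div_le_iff₀ (by positivity)] at h2
  rw [Real.exp_neg, ← div_eq_mul_inv, div_le_iff₀ (Real.exp_pos _)]
  linarith

/-- A negative power of `τ` is tamed by half of the exponential factor `exp (-n / (2 τ))`. -/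
theorem rpow_neg_mul_exp_neg_div_le {a c τ : ℝ} (ha : 0 ≤ a) (hc : 0 < c) (hτ : 0 < τ) :
    τ ^ (-a) * Real.exp (-(2 * c) / τ) ≤ (a / c) ^ a * Real.exp (-c / τ) := by
  have h := rpow_mul_exp_neg_le ha (x := c / τ) (by positivity)
  have e1 : Real.exp (-(2 * c) / τ) = Real.exp (-(c / τ)) * Real.exp (-c / τ) := by
    rw [← Real.exp_add]; congr 1; ring
  rw [e1, ← mul_assoc]
  refine mul_le_mul_of_nonneg_right ?_ (Real.exp_pos _).le
  rw [Real.div_rpow hc.le hτ.le] at h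
  rw [Real.div_rpow ha hc.le, Real.rpow_neg hτ.le, le_div_iff₀ (by positivity)]
  calc _ = c ^ a / τ ^ a * Real.exp (-(c / τ)) := by ring
    _ ≤ _ := h

/-- Log-convexity of Γ at x + 1, which lies between x and x + b. For 0 < b < 1 the inequality is
reversed; in the application b is (r + 1/2)|k|, which is 0 or at least 3/2. -/
theorem rpow_mul_Gamma_le {x b : ℝ} (hx : 0 < x) (hb : b = 0 ∨ 1 < b) :
    x ^ b * Real.Gamma x ≤ Real.Gamma (x + b) := by
  rcases hb with rfl | hb
  · simp
  have hb0 : 0 < b := by linarith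
  have h := Real.Gamma_mul_add_mul_le_rpow_Gamma_mul_rpow_Gamma (s := x) (t := x + b)
    (a := 1 - 1 / b) (b := 1 / b) hx (by linarith)
    (by rw [sub_pos, div_lt_one hb0]; exact hb) (by positivity) (by ring)
  have e : (1 - 1 / b) * x + 1 / b * (x + b) = x + 1 := by field_simp; ring
  rw [e, Real.Gamma_add_one hx.ne'] at h
  have hG := Real.Gamma_pos_of_pos hx
  have hG2 := Real.Gamma_pos_of_pos (by linarith : 0 < x + b)
  have h2 := Real.rpow_le_rpow (by positivity) h hb0.le
  rw [Real.mul_rpow hx.le hG.le, Real.mul_rpow (by positivity) (by positivity),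
    ← Real.rpow_mul hG.le, ← Real.rpow_mul hG2.le] at h2
  have e2 : (1 - 1 / b) * b = b - 1 := by field_simp
  have e3 : 1 / b * b = 1 := by field_simp
  rw [e2, e3, Real.rpow_one, Real.rpow_sub_one hG.ne'] at h2
  have h3 : 0 < Real.Gamma x ^ b := by positivity
  have : x ^ b * Real.Gamma x ^ b ≤ Real.Gamma x ^ b * (Real.Gamma (x + b) / Real.Gamma x) := by
    calc _ ≤ _ := h2
      _ = _ := by ring
  rw [mul_comm] at this
  have := le_of_mul_le_mul_left this h3
  rwa [le_div_iff₀ hG] at this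

/-! ### Gaussian moments of even order -/

theorem pow_two_mul_le (r : ℕ) (x b : ℝ) :
    x ^ (2 * r) ≤ 4 ^ r * (b ^ (2 * r) + (x - b) ^ (2 * r)) := by
  have h : x ^ 2 ≤ 4 * max (b ^ 2) ((x - b) ^ 2) := by
    rcases le_total (b ^ 2) ((x - b) ^ 2) with h | h
    · rw [max_eq_right h]; nlinarith [sq_nonneg (x - 2 * b), sq_nonneg x]
    · rw [max_eq_left h]; nlinarith [sq_nonneg (x - 2 * b), sq_nonneg x]
  rw [pow_mul, pow_mul, pow_mul]
  calc (x ^ 2) ^ r ≤ (4 * max (b ^ 2) ((x - b) ^ 2)) ^ r := by gcongr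
    _ = 4 ^ r * (max (b ^ 2) ((x - b) ^ 2)) ^ r := by rw [mul_pow]
    _ ≤ _ := by
      gcongr
      rcases le_total (b ^ 2) ((x - b) ^ 2) with h | h
      · rw [max_eq_right h]; nlinarith [pow_nonneg (sq_nonneg b) r]
      · rw [max_eq_left h]; nlinarith [pow_nonneg (sq_nonneg (x - b)) r]

/-- Half of the Gaussian decay absorbs the polynomial, through y^r / r! ≤ exp y; the other half is
kept so that the bound is integrable. -/
theorem exp_neg_sq_mul_pow_le (r : ℕ) {a : ℝ} (ha : 0 < a) (b x : ℝ) :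
    Real.exp (-a * (x - b) ^ 2) * x ^ (2 * r) ≤
      4 ^ r * (b ^ (2 * r) + r.factorial * (2 / a) ^ r) * Real.exp (-(a / 2) * (x - b) ^ 2) := by
  set E := Real.exp (-(a / 2) * (x - b) ^ 2) with hE
  have hE0 : 0 < E := Real.exp_pos _
  have e1 : Real.exp (-a * (x - b) ^ 2) = E * E := by rw [hE, ← Real.exp_add]; congr 1; ring
  have hE1 : E ≤ 1 := Real.exp_le_one_iff.2 (by nlinarith [sq_nonneg (x - b)])
  have h2 : E * (x - b) ^ (2 * r) ≤ r.factorial * (2 / a) ^ r := by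
    have := Real.pow_div_factorial_le_exp (x := a / 2 * (x - b) ^ 2) (by positivity) r
    rw [div_le_iff₀ (by positivity), mul_pow] at this
    have e2 : E = (Real.exp (a / 2 * (x - b) ^ 2))⁻¹ := by rw [hE, ← Real.exp_neg]; congr 1; ring
    rw [e2, pow_mul, inv_mul_le_iff₀ (Real.exp_pos _)]
    have h3 : (2 / a) ^ r * (a / 2) ^ r = 1 := by
      rw [← mul_pow]; field_simp; simp
    calc ((x - b) ^ 2) ^ r = (2 / a) ^ r * ((a / 2) ^ r * ((x - b) ^ 2) ^ r) := by
          rw [← mul_assoc, h3, one_mul]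
      _ ≤ (2 / a) ^ r * (Real.exp (a / 2 * (x - b) ^ 2) * r.factorial) := by gcongr
      _ = _ := by ring
  have h4 : E * b ^ (2 * r) ≤ b ^ (2 * r) := by
    rw [pow_mul]; exact mul_le_of_le_one_left (by positivity) hE1
  rw [e1]
  calc E * E * x ^ (2 * r) ≤ E * E * (4 ^ r * (b ^ (2 * r) + (x - b) ^ (2 * r))) := by
        gcongr; exact pow_two_mul_le r x b
    _ = 4 ^ r * (E * b ^ (2 * r) + E * (x - b) ^ (2 * r)) * E := by ring
    _ ≤ _ := by gcongr

theorem integrable_exp_neg_mul_sub_sq {a : ℝ} (ha : 0 < a) (b : ℝ) :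
    Integrable (fun x : ℝ => Real.exp (-a * (x - b) ^ 2)) :=
  (integrable_exp_neg_mul_sq ha).comp_sub_right b

theorem integrable_exp_neg_sq_mul_pow (r : ℕ) {a : ℝ} (ha : 0 < a) (b : ℝ) :
    Integrable (fun x : ℝ => Real.exp (-a * (x - b) ^ 2) * x ^ (2 * r)) := by
  refine ((integrable_exp_neg_mul_sub_sq (half_pos ha) b).const_mul
    (4 ^ r * (b ^ (2 * r) + r.factorial * (2 / a) ^ r))).mono' ?_ (ae_of_all _ fun x => ?_)
  · exact (by fun_prop : Continuous _).aestronglyMeasurable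
  · rw [Real.norm_of_nonneg (by rw [pow_mul]; positivity)]
    exact exp_neg_sq_mul_pow_le r ha b x

theorem integral_exp_neg_sq_mul_pow_le (r : ℕ) {a : ℝ} (ha : 0 < a) (b : ℝ) :
    ∫ x : ℝ, Real.exp (-a * (x - b) ^ 2) * x ^ (2 * r) ≤
      4 ^ r * (b ^ (2 * r) + r.factorial * (2 / a) ^ r) * √(2 * Real.pi / a) := by
  calc _ ≤ ∫ x : ℝ, 4 ^ r * (b ^ (2 * r) + r.factorial * (2 / a) ^ r) *
        Real.exp (-(a / 2) * (x - b) ^ 2) :=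
      integral_mono (integrable_exp_neg_sq_mul_pow r ha b)
        ((integrable_exp_neg_mul_sub_sq (half_pos ha) b).const_mul _)
        (fun x => exp_neg_sq_mul_pow_le r ha b x)
    _ = _ := by
      rw [integral_const_mul, integral_sub_right_eq_self (fun x => Real.exp (-(a / 2) * x ^ 2)) b,
        integral_gaussian]
      congr 2; field_simp

/-- Moments of a product of Gaussian densities with a common precision. -/
theorem lintegral_exp_neg_sq_mul_prod_pow_le {ι : Type*} [Fintype ι] (r : ℕ) {a B : ℝ}
    (ha : 0 < a) (b : ι → ℝ) (hb : ∀ i, b i ^ (2 * r) ≤ B) :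
    ∫⁻ β : ι → ℝ, ENNReal.ofReal
        (Real.exp (-a * ((β - b) ⬝ᵥ (β - b))) * ∏ i, β i ^ (2 * r)) ≤
      ENNReal.ofReal
        ((4 ^ r * (B + r.factorial * (2 / a) ^ r) * √(2 * Real.pi / a)) ^ Fintype.card ι) := by
  have e : ∀ β : ι → ℝ, Real.exp (-a * ((β - b) ⬝ᵥ (β - b))) * ∏ i, β i ^ (2 * r) =
      ∏ i, (Real.exp (-a * (β i - b i) ^ 2) * β i ^ (2 * r)) := by
    intro β
    rw [Finset.prod_mul_distrib, ← Real.exp_sum, dotProduct, Finset.mul_sum]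
    simp [sq]
  simp_rw [e]
  rw [← ofReal_integral_eq_lintegral_ofReal]
  · refine ENNReal.ofReal_le_ofReal ?_
    rw [integral_fintype_prod_volume_eq_prod
      (fun i x => Real.exp (-a * (x - b i) ^ 2) * x ^ (2 * r)), ← Finset.card_univ,
      ← Finset.prod_const]
    refine Finset.prod_le_prod (fun i _ => integral_nonneg fun x => ?_) (fun i _ => ?_)
    · rw [Pi.zero_apply, pow_mul]; positivity
    · refine (integral_exp_neg_sq_mul_pow_le r ha (b i)).trans ?_
      gcongr
      exact hb i
  · exact Integrable.fintype_prod (f := fun i x => Real.exp (-a * (x - b i) ^ 2) * x ^ (2 * r))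
      (fun i => integrable_exp_neg_sq_mul_pow r ha (b i))
  · refine ae_of_all _ fun β => Finset.prod_nonneg fun i _ => ?_
    rw [pow_mul]; positivity

/-! ### Quadratic forms -/

theorem quadForm_eq_sum {ι : Type*} [Fintype ι] [DecidableEq ι] {A : Matrix ι ι ℝ}
    (hA : A.IsHermitian) (x : ι → ℝ) :
    x ⬝ᵥ (A *ᵥ x) =
      ∑ i, hA.eigenvalues i * (inner ℝ (hA.eigenvectorBasis i) (WithLp.toLp 2 x)) ^ 2 := by
  set v := hA.eigenvectorBasis
  have h1 : x ⬝ᵥ (A *ᵥ x) = inner ℝ (WithLp.toLp 2 x) (WithLp.toLp 2 (A *ᵥ x)) := by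
    simp [EuclideanSpace.inner_eq_star_dotProduct, dotProduct_comm]
  rw [h1, ← v.sum_inner_mul_inner]
  refine Finset.sum_congr rfl fun i _ => ?_
  have h2 : inner ℝ (v i) (WithLp.toLp 2 (A *ᵥ x)) =
      hA.eigenvalues i * inner ℝ (v i) (WithLp.toLp 2 x) := by
    have e : A *ᵥ (v i).ofLp = hA.eigenvalues i • (v i).ofLp := hA.mulVec_eigenvectorBasis i
    have hAt : Aᵀ = A := by simpa [Matrix.IsHermitian] using hA
    simp only [EuclideanSpace.inner_eq_star_dotProduct, star_trivial]
    rw [dotProduct_comm, Matrix.dotProduct_mulVec, ← Matrix.mulVec_transpose, hAt, e,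
      smul_dotProduct, smul_eq_mul, dotProduct_comm]
  rw [h2, real_inner_comm]; ring

theorem dotProduct_self_eq_sum {ι : Type*} [Fintype ι] [DecidableEq ι] {A : Matrix ι ι ℝ}
    (hA : A.IsHermitian) (x : ι → ℝ) :
    x ⬝ᵥ x = ∑ i, (inner ℝ (hA.eigenvectorBasis i) (WithLp.toLp 2 x)) ^ 2 := by
  have h1 : x ⬝ᵥ x = inner ℝ (WithLp.toLp 2 x) (WithLp.toLp 2 x) := by
    rw [EuclideanSpace.inner_eq_star_dotProduct]; simp
  rw [h1, ← hA.eigenvectorBasis.sum_inner_mul_inner]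
  exact Finset.sum_congr rfl fun i _ => by rw [real_inner_comm]; ring

theorem le_quadForm {ι : Type*} [Fintype ι] [DecidableEq ι] {A : Matrix ι ι ℝ}
    (hA : A.IsHermitian) {a : ℝ} (h : ∀ i, a ≤ hA.eigenvalues i) (x : ι → ℝ) :
    a * (x ⬝ᵥ x) ≤ x ⬝ᵥ (A *ᵥ x) := by
  rw [quadForm_eq_sum hA, dotProduct_self_eq_sum hA, Finset.mul_sum]
  exact Finset.sum_le_sum fun i _ => mul_le_mul_of_nonneg_right (h i) (sq_nonneg _)

theorem quadForm_le {ι : Type*} [Fintype ι] [DecidableEq ι] {A : Matrix ι ι ℝ}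
    (hA : A.IsHermitian) {a : ℝ} (h : ∀ i, hA.eigenvalues i ≤ a) (x : ι → ℝ) :
    x ⬝ᵥ (A *ᵥ x) ≤ a * (x ⬝ᵥ x) := by
  rw [quadForm_eq_sum hA, dotProduct_self_eq_sum hA, Finset.mul_sum]
  exact Finset.sum_le_sum fun i _ => mul_le_mul_of_nonneg_right (h i) (sq_nonneg _)

/-- The vector with coordinates in `k`, extended by zero. -/
noncomputable def extendZero {p : ℕ} (k : Finset (Fin p)) (β : k → ℝ) : Fin p → ℝ :=
  fun j => if h : j ∈ k then β ⟨j, h⟩ else 0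

theorem sum_extendZero_mul {p : ℕ} (k : Finset (Fin p)) (β : k → ℝ) (f : Fin p → ℝ) :
    ∑ j, f j * extendZero k β j = ∑ i : k, f i * β i := by
  rw [← Finset.sum_subset (Finset.subset_univ k), ← Finset.sum_coe_sort k]
  · exact Finset.sum_congr rfl fun i _ => by simp [extendZero]
  · intro j _ hj; simp [extendZero, hj]

theorem dotProduct_extendZero {p : ℕ} (k : Finset (Fin p)) (β : k → ℝ) (f : Fin p → ℝ) :
    f ⬝ᵥ extendZero k β = ∑ i : k, f i * β i := sum_extendZero_mul k β f

@[simp] theorem extendZero_coe {p : ℕ} (k : Finset (Fin p)) (β : k → ℝ) (i : k) :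
    extendZero k β i = β i := by simp [extendZero]

theorem extendZero_dotProduct_self {p : ℕ} (k : Finset (Fin p)) (β : k → ℝ) :
    extendZero k β ⬝ᵥ extendZero k β = β ⬝ᵥ β := by
  rw [dotProduct_extendZero]; simp [dotProduct]

theorem mulVec_extendZero {n p : ℕ} (X : Matrix (Fin n) (Fin p) ℝ) (k : Finset (Fin p))
    (β : k → ℝ) : X *ᵥ extendZero k β = designSub X k *ᵥ β := by
  ext i
  simp only [Matrix.mulVec, dotProduct_extendZero]
  simp [designSub, dotProduct]

theorem quadForm_principalSub {p : ℕ} (A : Matrix (Fin p) (Fin p) ℝ) (k : Finset (Fin p))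
    (β : k → ℝ) :
    β ⬝ᵥ (principalSub A k *ᵥ β) = extendZero k β ⬝ᵥ (A *ᵥ extendZero k β) := by
  rw [dotProduct_comm (extendZero k β), dotProduct_extendZero, dotProduct]
  refine Finset.sum_congr rfl fun i _ => ?_
  rw [mul_comm, Matrix.mulVec, Matrix.mulVec, dotProduct_extendZero]
  simp [principalSub, dotProduct]

/-- Two-sided bounds for the quadratic form of a symmetric matrix. -/
def QuadBound {p : ℕ} (A : Matrix (Fin p) (Fin p) ℝ) (a₁ a₂ : ℝ) : Prop :=
  A.IsHermitian ∧ ∀ x, a₁ * (x ⬝ᵥ x) ≤ x ⬝ᵥ (A *ᵥ x) ∧ x ⬝ᵥ (A *ᵥ x) ≤ a₂ * (x ⬝ᵥ x)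

theorem QuadBound.principalSub {p : ℕ} {A : Matrix (Fin p) (Fin p) ℝ} {a₁ a₂ : ℝ}
    (h : QuadBound A a₁ a₂) (k : Finset (Fin p)) (β : k → ℝ) :
    a₁ * (β ⬝ᵥ β) ≤ β ⬝ᵥ (principalSub A k *ᵥ β) ∧
      β ⬝ᵥ (HyperPMOM.principalSub A k *ᵥ β) ≤ a₂ * (β ⬝ᵥ β) := by
  rw [quadForm_principalSub, ← extendZero_dotProduct_self]
  exact h.2 _

theorem QuadBound.det_pos {p : ℕ} {A : Matrix (Fin p) (Fin p) ℝ} {a₁ a₂ : ℝ} (ha : 0 < a₁)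
    (h : QuadBound A a₁ a₂) (k : Finset (Fin p)) : 0 < (HyperPMOM.principalSub A k).det := by
  have hH : (HyperPMOM.principalSub A k).IsHermitian := h.1.submatrix _
  refine (Matrix.PosDef.of_dotProduct_mulVec_pos hH fun x hx => ?_).det_pos
  have := (h.principalSub k x).1
  have h2 : 0 < x ⬝ᵥ x := by
    rw [← star_trivial x]; simpa using Matrix.dotProduct_star_self_pos_iff.2 hx
  simp only [star_trivial]
  nlinarith

/-! ### Design matrices -/

/-- The columns of `X` in `k` are uniformly well conditioned. -/
def DesignBound {n p : ℕ} (X : Matrix (Fin n) (Fin p) ℝ) (ε : ℝ) (k : Finset (Fin p)) : Prop :=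
  ∀ b : k → ℝ, n * ε * (b ⬝ᵥ b) ≤ (designSub X k *ᵥ b) ⬝ᵥ (designSub X k *ᵥ b) ∧
    (designSub X k *ᵥ b) ⬝ᵥ (designSub X k *ᵥ b) ≤ n * ε⁻¹ * (b ⬝ᵥ b)

/-- When |k| ≤ n, the min(n, |k|) largest eigenvalues are all the eigenvalues, so the Gram matrix is
bounded below as well as above. -/
theorem EigenvalueBound.designBound {n p : ℕ} {X : Matrix (Fin n) (Fin p) ℝ} {ε : ℝ}
    {k : Finset (Fin p)} (hn : 0 < n) (h : EigenvalueBound X ε k) (hk : k.card ≤ n) :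
    DesignBound X ε k := by
  intro b
  have hH := gram_isHermitian X k
  have key : ∀ i, ε ≤ hH.eigenvalues i ∧ hH.eigenvalues i ≤ ε⁻¹ := by
    intro i
    refine h _ ?_
    rw [min_eq_right hk]
    exact (Fin.is_lt _).trans_eq (Fintype.card_coe k)
  have e : b ⬝ᵥ (gram X k *ᵥ b) =
      (n : ℝ)⁻¹ * ((designSub X k *ᵥ b) ⬝ᵥ (designSub X k *ᵥ b)) := by
    rw [gram, Matrix.smul_mulVec, dotProduct_smul, smul_eq_mul, ← Matrix.mulVec_mulVec,
      Matrix.dotProduct_mulVec, Matrix.vecMul_transpose]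
  have h1 := le_quadForm hH (fun i => (key i).1) b
  have h2 := quadForm_le hH (fun i => (key i).2) b
  rw [e] at h1 h2
  have hn' : (0 : ℝ) < n := by exact_mod_cast hn
  rw [inv_mul_le_iff₀ hn'] at h2
  rw [le_inv_mul_iff₀ hn'] at h1
  constructor <;> linarith

/-! ### The pMOM density -/

/-- The mass of the unnormalized pMOM kernel at unit scale. -/
noncomputable def pmomMass {p : ℕ} (r : ℕ) (A : Matrix (Fin p) (Fin p) ℝ) (k : Finset (Fin p)) : ℝ :=
  ∫ β : k → ℝ, Real.exp (-(β ⬝ᵥ (principalSub A k *ᵥ β)) / 2) * ∏ i, β i ^ (2 * r)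

/-- The factors (2π)^(-|k|/2) and |A_k|^(1/2) occur in the kernel and in its normalizing integral
and cancel. Of the determinant only its positivity is ever used. -/
theorem pmomDensity_eq {p : ℕ} {r : ℕ} {A : Matrix (Fin p) (Fin p) ℝ} {k : Finset (Fin p)}
    (hdet : 0 < (principalSub A k).det) (v : ℝ) (β : k → ℝ) :
    pmomDensity r A k v β = (pmomMass r A k)⁻¹ * v ^ (-((r + 1 / 2 : ℝ) * k.card)) *
      Real.exp (-(β ⬝ᵥ (principalSub A k *ᵥ β)) / (2 * v)) * ∏ i, β i ^ (2 * r) := by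
  have e : ∫ β : k → ℝ, pmomKernel r A k 1 β =
      (2 * Real.pi) ^ (-((k.card : ℝ) / 2)) * √(principalSub A k).det * pmomMass r A k := by
    rw [pmomMass, ← integral_const_mul]
    refine integral_congr_ae (ae_of_all _ fun β => ?_)
    simp only [pmomKernel, Real.one_rpow, mul_one]
    ring
  have h1 : (0 : ℝ) < (2 * Real.pi) ^ (-((k.card : ℝ) / 2)) := by positivity
  have h2 : 0 < √(principalSub A k).det := Real.sqrt_pos.2 hdet
  rw [pmomDensity, pmomConst, e, pmomKernel, mul_inv, mul_inv]
  have e3 : -((r : ℝ) * k.card) - (k.card : ℝ) / 2 = -((r + 1 / 2 : ℝ) * k.card) := by ring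
  rw [e3]
  field_simp

theorem integrable_exp_neg_sq_mul_prod_pow {ι : Type*} [Fintype ι] (r : ℕ) {a : ℝ} (ha : 0 < a) :
    Integrable (fun β : ι → ℝ => Real.exp (-(a * (β ⬝ᵥ β)) / 2) * ∏ i, β i ^ (2 * r)) := by
  have h := Integrable.fintype_prod (ι := ι) (f := fun _ x => Real.exp (-(a / 2) * (x - 0) ^ 2) * x ^ (2 * r))
      (μ := fun _ => volume) (fun i => integrable_exp_neg_sq_mul_pow r (half_pos ha) 0)
  refine h.congr (ae_of_all _ fun β => ?_)
  simp only [sub_zero]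
  rw [Finset.prod_mul_distrib, ← Real.exp_sum, ← Finset.mul_sum, dotProduct]
  congr 2
  simp_rw [sq]; ring

theorem integral_exp_neg_sq_mul_prod_pow {ι : Type*} [Fintype ι] (r : ℕ) (a : ℝ) :
    ∫ β : ι → ℝ, Real.exp (-(a * (β ⬝ᵥ β)) / 2) * ∏ i, β i ^ (2 * r) =
      (∫ x : ℝ, Real.exp (-(a / 2) * x ^ 2) * x ^ (2 * r)) ^ Fintype.card ι := by
  rw [← integral_fintype_prod_volume_eq_pow]
  refine integral_congr_ae (ae_of_all _ fun β => ?_)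
  simp only
  rw [Finset.prod_mul_distrib, ← Real.exp_sum, ← Finset.mul_sum, dotProduct]
  congr 2
  simp_rw [sq]; ring

theorem integral_exp_neg_sq_mul_pow_pos (r : ℕ) {a : ℝ} (ha : 0 < a) :
    0 < ∫ x : ℝ, Real.exp (-(a / 2) * x ^ 2) * x ^ (2 * r) := by
  have hintegrable : Integrable (fun x : ℝ => Real.exp (-(a / 2) * x ^ 2) * x ^ (2 * r)) := by
    simpa using integrable_exp_neg_sq_mul_pow r (half_pos ha) 0
  rw [integral_pos_iff_support_of_nonneg (fun x => by rw [Pi.zero_apply, pow_mul]; positivity) hintegrable]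
  have : Set.Ioi (0 : ℝ) ⊆ Function.support
      (fun x : ℝ => Real.exp (-(a / 2) * x ^ 2) * x ^ (2 * r)) := by
    intro x hx
    have hx : 0 < x := hx
    rw [Function.mem_support]; positivity
  exact lt_of_lt_of_le (by simp) (measure_mono this)

/-- The Gaussian weight lies between two product weights, whose masses are powers of one-dimensional
integrals. Hence d_k costs only a constant factor per variable. -/
theorem pmomMass_bounds {p : ℕ} (r : ℕ) {A : Matrix (Fin p) (Fin p) ℝ} {a₁ a₂ : ℝ}
    (ha₁ : 0 < a₁) (ha₂ : 0 < a₂) (h : QuadBound A a₁ a₂) (k : Finset (Fin p)) :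
    (∫ x : ℝ, Real.exp (-(a₂ / 2) * x ^ 2) * x ^ (2 * r)) ^ k.card ≤ pmomMass r A k ∧
      pmomMass r A k ≤ (∫ x : ℝ, Real.exp (-(a₁ / 2) * x ^ 2) * x ^ (2 * r)) ^ k.card := by
  have hprod : ∀ β : k → ℝ, 0 ≤ ∏ i, β i ^ (2 * r) := fun β =>
    Finset.prod_nonneg fun i _ => by rw [pow_mul]; positivity
  have hup : ∀ β : k → ℝ, Real.exp (-(β ⬝ᵥ (principalSub A k *ᵥ β)) / 2) * ∏ i, β i ^ (2 * r) ≤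
      Real.exp (-(a₁ * (β ⬝ᵥ β)) / 2) * ∏ i, β i ^ (2 * r) := fun β => by
    refine mul_le_mul_of_nonneg_right (Real.exp_le_exp.2 ?_) (hprod β)
    linarith [(h.principalSub k β).1]
  have hlo : ∀ β : k → ℝ, Real.exp (-(a₂ * (β ⬝ᵥ β)) / 2) * ∏ i, β i ^ (2 * r) ≤
      Real.exp (-(β ⬝ᵥ (principalSub A k *ᵥ β)) / 2) * ∏ i, β i ^ (2 * r) := fun β => by
    refine mul_le_mul_of_nonneg_right (Real.exp_le_exp.2 ?_) (hprod β)
    linarith [(h.principalSub k β).2]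
  have hintegrable : Integrable (fun β : k → ℝ =>
      Real.exp (-(β ⬝ᵥ (principalSub A k *ᵥ β)) / 2) * ∏ i, β i ^ (2 * r)) := by
    refine (integrable_exp_neg_sq_mul_prod_pow r ha₁).mono' ?_ (ae_of_all _ fun β => ?_)
    · refine Continuous.aestronglyMeasurable ?_
      unfold dotProduct Matrix.mulVec dotProduct
      fun_prop
    · rw [Real.norm_of_nonneg (mul_nonneg (Real.exp_pos _).le (hprod β))]
      exact hup β
  have e := fun a => integral_exp_neg_sq_mul_prod_pow (ι := k) r a
  simp only [Fintype.card_coe] at e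
  rw [← e, ← e]
  exact ⟨integral_mono (integrable_exp_neg_sq_mul_prod_pow r ha₂) hintegrable hlo,
    integral_mono hintegrable (integrable_exp_neg_sq_mul_prod_pow r ha₁) hup⟩

/-! ### Upper bound for the marginal density -/

/-- At precision c/(2s) the moment grows like (M^r + s^r) √s, so division by s^(r+1/2) leaves a
multiple of 1 + s^(-r) ≤ exp(r/s). In the integral over s = σ² this exponential merely lowers the
inverse-gamma scale by r for each variable. -/
theorem scaled_moment_le {r : ℕ} {c M s : ℝ} (hr : 1 ≤ r) (hc : 1 ≤ c) (hM : 1 ≤ M) (hs : 0 < s) :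
    s ^ (-(r + 1 / 2 : ℝ)) * (4 ^ r * (M ^ r + r.factorial * (2 / (c / (2 * s))) ^ r) *
        √(2 * Real.pi / (c / (2 * s)))) ≤
      16 ^ r * r.factorial * M ^ r * √(4 * Real.pi / c) * Real.exp (r / s) := by
  have hc0 : 0 < c := by linarith
  have e1 : √(2 * Real.pi / (c / (2 * s))) = √s * √(4 * Real.pi / c) := by
    rw [← Real.sqrt_mul hs.le]; congr 1; field_simp; norm_num
  have e2 : s ^ (-(r + 1 / 2 : ℝ)) = (s ^ r)⁻¹ * (√s)⁻¹ := by
    rw [Real.rpow_neg hs.le, Real.rpow_add hs, Real.rpow_natCast, ← Real.sqrt_eq_rpow, mul_inv]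
  have h3 : (2 / (c / (2 * s))) ^ r ≤ 4 ^ r * s ^ r := by
    rw [← mul_pow]
    have : 2 / (c / (2 * s)) ≤ 4 * s := by
      rw [div_div_eq_mul_div, div_le_iff₀ hc0]; nlinarith
    gcongr
  have hss : 0 < √s := Real.sqrt_pos.2 hs
  have hf : (1 : ℝ) ≤ r.factorial := by exact_mod_cast r.factorial_pos
  have h4r : (1 : ℝ) ≤ 4 ^ r := one_le_pow₀ (by norm_num)
  have hMr : 1 ≤ M ^ r := one_le_pow₀ hM
  have h5 : (s ^ r)⁻¹ + 1 ≤ Real.exp (r / s) := by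
    have h6 : (1 / s + 1) ^ r ≤ Real.exp (r / s) := by
      calc (1 / s + 1) ^ r ≤ (Real.exp (1 / s)) ^ r := by
            gcongr; exact Real.add_one_le_exp _
        _ = _ := by rw [← Real.exp_nat_mul]; congr 1; ring
    refine le_trans ?_ h6
    have := pow_add_pow_le (x := 1 / s) (y := 1) (by positivity) zero_le_one (n := r) (by omega)
    simpa [one_div, inv_pow] using this
  have h7 : M ^ r + r.factorial * (4 ^ r * s ^ r) ≤
      4 ^ r * r.factorial * M ^ r * (1 + s ^ r) := by
    have hsr : 0 < s ^ r := by positivity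
    have i1 : M ^ r ≤ 4 ^ r * r.factorial * M ^ r := by
      have : 1 ≤ 4 ^ r * (r.factorial : ℝ) := one_le_mul_of_one_le_of_one_le h4r hf
      nlinarith
    have i2 : r.factorial * (4 ^ r * s ^ r) ≤ 4 ^ r * r.factorial * M ^ r * s ^ r := by
      have : 0 ≤ (r.factorial : ℝ) * (4 ^ r * s ^ r) := by positivity
      nlinarith
    linarith
  rw [e1, e2]
  calc _ = (s ^ r)⁻¹ * (4 ^ r * (M ^ r + r.factorial * (2 / (c / (2 * s))) ^ r)) *
        √(4 * Real.pi / c) := by field_simp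
    _ ≤ (s ^ r)⁻¹ * (4 ^ r * (M ^ r + r.factorial * (4 ^ r * s ^ r))) * √(4 * Real.pi / c) := by
        gcongr
    _ ≤ (s ^ r)⁻¹ * (4 ^ r * (4 ^ r * r.factorial * M ^ r * (1 + s ^ r))) *
          √(4 * Real.pi / c) := by gcongr
    _ = 16 ^ r * r.factorial * M ^ r * √(4 * Real.pi / c) * ((s ^ r)⁻¹ + 1) := by
        have : (16 : ℝ) ^ r = 4 ^ r * 4 ^ r := by rw [← mul_pow]; norm_num
        rw [this]; field_simp
    _ ≤ _ := by gcongr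

/-- The factor that one more variable contributes to the upper bound for a marginal density,
up to powers of `n` and of the conditioning of the design. -/
noncomputable def upperConst (r : ℕ) (a₂ : ℝ) : ℝ :=
  (∫ x : ℝ, Real.exp (-(a₂ / 2) * x ^ 2) * x ^ (2 * r))⁻¹ *
    (4 * (r + 1 / 2 : ℝ)) ^ (r + 1 / 2 : ℝ) * (16 ^ r * r.factorial * √(4 * Real.pi))

theorem upperConst_pos (r : ℕ) {a₂ : ℝ} (ha₂ : 0 < a₂) : 0 < upperConst r a₂ := by
  have := integral_exp_neg_sq_mul_pow_pos r ha₂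
  unfold upperConst
  positivity

/-- Half of exp(-n/(2τ)) pays for τ^(-a), at the price (4a/n)^a; the other half keeps the integral
over τ finite. With a = (r + 1/2)|k| that price is the penalty that the hyperprior puts on model
size. -/
theorem tau_factor_le {a n τ : ℝ} (ha : 0 ≤ a) (hn : 0 < n) (hτ : 0 < τ) :
    τ ^ (-a) * invGammaDensity (1 / 2) (n / 2) τ ≤
      (4 * a / n) ^ a * ((n / 2) ^ (1 / 2 : ℝ) / Real.Gamma (1 / 2)) *
        (τ ^ (-(1 / 2 + 1 : ℝ)) * Real.exp (-(n / 4) / τ)) := by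
  have h := rpow_neg_mul_exp_neg_div_le ha (c := n / 4) (by positivity) hτ
  have hG : 0 < Real.Gamma (1 / 2) := Real.Gamma_pos_of_pos (by norm_num)
  unfold invGammaDensity
  have e1 : a / (n / 4) = 4 * a / n := by field_simp
  have e2 : -(2 * (n / 4)) / τ = -(n / 2) / τ := by ring
  rw [e1, e2] at h
  calc _ = (n / 2) ^ (1 / 2 : ℝ) / Real.Gamma (1 / 2) * τ ^ (-(1 / 2 + 1 : ℝ)) *
        (τ ^ (-a) * Real.exp (-(n / 2) / τ)) := by ring
    _ ≤ (n / 2) ^ (1 / 2 : ℝ) / Real.Gamma (1 / 2) * τ ^ (-(1 / 2 + 1 : ℝ)) *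
        ((4 * a / n) ^ a * Real.exp (-(n / 4) / τ)) := by gcongr
    _ = _ := by ring

/-- Drop the exponential of the prior and bound the likelihood by a spherical Gaussian centred at
the least squares estimate b. The integral over β becomes a product of moments, after which the
bound on the integrand separates into a function of τ and a function of s, both of inverse-gamma
form. -/
theorem marginal_le {n p r : ℕ} {α₁ α₂ : ℝ} (hn : 1 ≤ n) (hr : 1 ≤ r) (hα₁ : 0 < α₁)
    (hα₂ : 0 < α₂) {X : Matrix (Fin n) (Fin p) ℝ} {A : Matrix (Fin p) (Fin p) ℝ}
    {a₁ a₂ : ℝ} (ha₁ : 0 < a₁) (ha₂ : 0 < a₂) (hA : QuadBound A a₁ a₂)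
    {k : Finset (Fin p)} {y : Fin n → ℝ} {ε R M : ℝ} (b : k → ℝ)
    (hε : 1 ≤ n * ε) (hM : 1 ≤ M) (hb : ∀ i, b i ^ 2 ≤ M)
    (hX : ∀ β : k → ℝ, n * ε * (β ⬝ᵥ β) ≤ (designSub X k *ᵥ β) ⬝ᵥ (designSub X k *ᵥ β))
    (hLS : ∀ β : k → ℝ, (y - designSub X k *ᵥ β) ⬝ᵥ (y - designSub X k *ᵥ β) =
      R + (designSub X k *ᵥ (β - b)) ⬝ᵥ (designSub X k *ᵥ (β - b)))
    (hR : 0 < R / 2 + α₂ - r * k.card) :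
    marginal r α₁ α₂ X A k y ≤ ENNReal.ofReal
      ((2 * Real.pi) ^ (-((n : ℝ) / 2)) * (α₂ ^ α₁ / Real.Gamma α₁) *
        Real.Gamma (n / 2 + α₁) * √2 *
        (upperConst r a₂ * (k.card : ℝ) ^ (r + 1 / 2 : ℝ) * (n : ℝ) ^ (-(r + 1 / 2 : ℝ)) *
          M ^ r * (√(n * ε))⁻¹) ^ k.card *
        (R / 2 + α₂ - r * k.card) ^ (-(n / 2 + α₁))) := by
  classical
  have hn0 : (0 : ℝ) < n := by exact_mod_cast hn
  have hnε : 0 < n * ε := by linarith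
  set K := k.card with hK
  set a : ℝ := (r + 1 / 2 : ℝ) * K with ha
  have ha0 : 0 ≤ a := by positivity
  set J := pmomMass r A k with hJ
  set g := ∫ x : ℝ, Real.exp (-(a₂ / 2) * x ^ 2) * x ^ (2 * r) with hg
  have hgpos : 0 < g := integral_exp_neg_sq_mul_pow_pos r ha₂
  have hJg : g ^ K ≤ J := (pmomMass_bounds r ha₁ ha₂ hA k).1
  have hJpos : 0 < J := lt_of_lt_of_le (by positivity) hJg
  have hdet := hA.det_pos ha₁ k
  set N : ℝ := n / 2 + α₁ with hN
  have hN0 : 0 < N := by positivity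
  have hGα : 0 < Real.Gamma α₁ := Real.Gamma_pos_of_pos hα₁
  have hGh : 0 < Real.Gamma (1 / 2) := Real.Gamma_pos_of_pos (by norm_num)
  set S := R / 2 + α₂ - r * K with hS
  -- a bound for the integral over `β`
  have hinner : ∀ τ > 0, ∀ s > 0, ∫⁻ β : k → ℝ,
      ENNReal.ofReal (likelihood X k y β s * pmomDensity r A k (τ * s) β *
      invGammaDensity (1 / 2) ((n : ℝ) / 2) τ * invGammaDensity α₁ α₂ s) ≤
      ENNReal.ofReal ((2 * Real.pi * s) ^ (-((n : ℝ) / 2)) * Real.exp (-R / (2 * s)) * J⁻¹ *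
        (τ * s) ^ (-a) * invGammaDensity (1 / 2) ((n : ℝ) / 2) τ * invGammaDensity α₁ α₂ s *
        (4 ^ r * (M ^ r + r.factorial * (2 / (n * ε / (2 * s))) ^ r) *
          √(2 * Real.pi / (n * ε / (2 * s)))) ^ K) := by
    intro τ hτ s hs
    have hig1 : 0 ≤ invGammaDensity (1 / 2) ((n : ℝ) / 2) τ := by
      unfold invGammaDensity; positivity
    have hig2 : 0 ≤ invGammaDensity α₁ α₂ s := by
      unfold invGammaDensity; positivity
    set c := (2 * Real.pi * s) ^ (-((n : ℝ) / 2)) * Real.exp (-R / (2 * s)) * J⁻¹ *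
        (τ * s) ^ (-a) * invGammaDensity (1 / 2) ((n : ℝ) / 2) τ * invGammaDensity α₁ α₂ s with hc
    have hc0 : 0 ≤ c := by positivity
    have hL := lintegral_exp_neg_sq_mul_prod_pow_le (ι := k) r (a := n * ε / (2 * s))
      (B := M ^ r) (by positivity) b (fun i => by rw [pow_mul]; gcongr; exact hb i)
    rw [Fintype.card_coe] at hL
    rw [ENNReal.ofReal_mul hc0]
    refine le_trans ?_ (mul_le_mul_right hL _)
    rw [← lintegral_const_mul' _ _ ENNReal.ofReal_ne_top]
    refine lintegral_mono fun β => ?_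
    rw [← ENNReal.ofReal_mul hc0]
    refine ENNReal.ofReal_le_ofReal ?_
    rw [pmomDensity_eq hdet, likelihood, hLS]
    have hprod : 0 ≤ ∏ i, β i ^ (2 * r) :=
      Finset.prod_nonneg fun i _ => by rw [pow_mul]; positivity
    have hE1 : Real.exp (-(β ⬝ᵥ principalSub A k *ᵥ β) / (2 * (τ * s))) ≤ 1 := by
      refine Real.exp_le_one_iff.2 (div_nonpos_of_nonpos_of_nonneg ?_ (by positivity))
      have h1 := (hA.principalSub k β).1
      have h2 : 0 ≤ β ⬝ᵥ β := Finset.sum_nonneg fun i _ => mul_self_nonneg _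
      nlinarith [mul_nonneg ha₁.le h2]
    have hE2 : Real.exp (-(R + (designSub X k *ᵥ (β - b)) ⬝ᵥ (designSub X k *ᵥ (β - b))) / (2 * s))
        ≤ Real.exp (-R / (2 * s)) * Real.exp (-(n * ε / (2 * s)) * ((β - b) ⬝ᵥ (β - b))) := by
      rw [← Real.exp_add]
      refine Real.exp_le_exp.2 ?_
      have h1 := hX (β - b)
      rw [show -R / (2 * s) + -(n * ε / (2 * s)) * ((β - b) ⬝ᵥ (β - b)) =
        -(R + n * ε * ((β - b) ⬝ᵥ (β - b))) / (2 * s) by field_simp; ring]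
      gcongr
    calc _ ≤ (2 * Real.pi * s) ^ (-((n : ℝ) / 2)) *
          (Real.exp (-R / (2 * s)) * Real.exp (-(n * ε / (2 * s)) * ((β - b) ⬝ᵥ (β - b)))) *
          (J⁻¹ * (τ * s) ^ (-a) * 1 * ∏ i, β i ^ (2 * r)) *
          invGammaDensity (1 / 2) ((n : ℝ) / 2) τ * invGammaDensity α₁ α₂ s := by
          gcongr
      _ = _ := by rw [hc]; ring
  set C : ℝ := (2 * Real.pi) ^ (-((n : ℝ) / 2)) * (α₂ ^ α₁ / Real.Gamma α₁) * J⁻¹ *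
    ((4 * a / n) ^ a * ((n / 2 : ℝ) ^ (1 / 2 : ℝ) / Real.Gamma (1 / 2))) *
    (16 ^ r * r.factorial * M ^ r * √(4 * Real.pi / (n * ε))) ^ K with hC
  have hC0 : 0 ≤ C := by positivity
  -- Separation of variables: the powers of τ go through `tau_factor_le`, those of s through
  -- `scaled_moment_le`, whose factor exp(K r / s) turns R/2 + α₂ into S.
  have hpt : ∀ τ > 0, ∀ s > 0,
      (2 * Real.pi * s) ^ (-((n : ℝ) / 2)) * Real.exp (-R / (2 * s)) * J⁻¹ *
        (τ * s) ^ (-a) * invGammaDensity (1 / 2) ((n : ℝ) / 2) τ * invGammaDensity α₁ α₂ s *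
        (4 ^ r * (M ^ r + r.factorial * (2 / (n * ε / (2 * s))) ^ r) *
          √(2 * Real.pi / (n * ε / (2 * s)))) ^ K ≤
      (C * (τ ^ (-(1 / 2 + 1 : ℝ)) * Real.exp (-(n / 4 : ℝ) / τ))) *
        (s ^ (-(N + 1)) * Real.exp (-S / s)) := by
    intro τ hτ s hs
    have h1 := tau_factor_le ha0 hn0 hτ
    have h2 := pow_le_pow_left₀ (by positivity)
      (scaled_moment_le (r := r) (c := n * ε) (M := M) (s := s) hr hε hM hs) K
    rw [mul_pow, ← Real.rpow_mul_natCast hs.le, neg_mul, ← ha, mul_pow _ (Real.exp _),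
      ← Real.exp_nat_mul] at h2
    have e1 : (2 * Real.pi * s) ^ (-((n : ℝ) / 2)) =
        (2 * Real.pi) ^ (-((n : ℝ) / 2)) * s ^ (-((n : ℝ) / 2)) :=
      Real.mul_rpow (by positivity) hs.le
    have e2 : (τ * s) ^ (-a) = τ ^ (-a) * s ^ (-a) := Real.mul_rpow hτ.le hs.le
    have e3 : s ^ (-(N + 1)) = s ^ (-((n : ℝ) / 2)) * s ^ (-(α₁ + 1)) := by
      rw [← Real.rpow_add hs]; congr 1; rw [hN]; ring
    have e4 : Real.exp (-S / s) =
        Real.exp (-R / (2 * s)) * Real.exp (-α₂ / s) * Real.exp (K * (r / s)) := by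
      rw [← Real.exp_add, ← Real.exp_add]; congr 1; rw [hS]; field_simp; ring
    have hig1 : 0 ≤ invGammaDensity (1 / 2) ((n : ℝ) / 2) τ := by
      unfold invGammaDensity; positivity
    have hig2 : invGammaDensity α₁ α₂ s =
      α₂ ^ α₁ / Real.Gamma α₁ * s ^ (-(α₁ + 1)) * Real.exp (-α₂ / s) := rfl
    rw [e1, e2, e3, e4, hig2]
    calc _ = (2 * Real.pi) ^ (-((n : ℝ) / 2)) * s ^ (-((n : ℝ) / 2)) * Real.exp (-R / (2 * s)) *
          J⁻¹ * (α₂ ^ α₁ / Real.Gamma α₁ * s ^ (-(α₁ + 1)) * Real.exp (-α₂ / s)) *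
          (τ ^ (-a) * invGammaDensity (1 / 2) ((n : ℝ) / 2) τ) *
          (s ^ (-a) * (4 ^ r * (M ^ r + r.factorial * (2 / (n * ε / (2 * s))) ^ r) *
          √(2 * Real.pi / (n * ε / (2 * s)))) ^ K) := by ring
      _ ≤ (2 * Real.pi) ^ (-((n : ℝ) / 2)) * s ^ (-((n : ℝ) / 2)) * Real.exp (-R / (2 * s)) *
          J⁻¹ * (α₂ ^ α₁ / Real.Gamma α₁ * s ^ (-(α₁ + 1)) * Real.exp (-α₂ / s)) *
          ((4 * a / n) ^ a * ((n / 2 : ℝ) ^ (1 / 2 : ℝ) / Real.Gamma (1 / 2)) *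
        (τ ^ (-(1 / 2 + 1 : ℝ)) * Real.exp (-(n / 4 : ℝ) / τ))) *
          ((16 ^ r * r.factorial * M ^ r * √(4 * Real.pi / (n * ε))) ^ K *
            Real.exp (K * (r / s))) := by gcongr
      _ = _ := by rw [hC]; ring
  have hmain : marginal r α₁ α₂ X A k y ≤
      ENNReal.ofReal (C * (Real.Gamma (1 / 2) * (n / 4 : ℝ) ^ (-(1 / 2 : ℝ))) *
        (Real.Gamma N * S ^ (-N))) := by
    unfold marginal
    calc _ ≤ ∫⁻ τ in Set.Ioi (0 : ℝ),
          ENNReal.ofReal (C * (τ ^ (-(1 / 2 + 1 : ℝ)) * Real.exp (-(n / 4 : ℝ) / τ))) *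
          ENNReal.ofReal (Real.Gamma N * S ^ (-N)) := by
          refine setLIntegral_mono' measurableSet_Ioi fun τ (hτ : 0 < τ) => ?_
          rw [← lintegral_rpow_mul_exp_neg_div hN0 hR,
            ← lintegral_const_mul' _ _ ENNReal.ofReal_ne_top]
          refine setLIntegral_mono' measurableSet_Ioi fun s (hs : 0 < s) => ?_
          refine (hinner τ hτ s hs).trans ?_
          rw [← ENNReal.ofReal_mul (by positivity)]
          exact ENNReal.ofReal_le_ofReal (hpt τ hτ s hs)
      _ = _ := by
          rw [lintegral_mul_const' _ _ ENNReal.ofReal_ne_top,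
            ENNReal.ofReal_mul (q := Real.Gamma N * S ^ (-N)) (by positivity),
            ENNReal.ofReal_mul hC0,
            ← lintegral_rpow_mul_exp_neg_div (a := 1 / 2) (b := n / 4) (by norm_num) (by positivity),
            ← lintegral_const_mul' _ _ ENNReal.ofReal_ne_top]
          congr 1
          refine lintegral_congr fun τ => ?_
          rw [ENNReal.ofReal_mul hC0]
  refine hmain.trans (ENNReal.ofReal_le_ofReal ?_)
  -- The factor √2 remains because the prior of τ is normalized with scale n/2, but only n/4 is left
  -- in the exponent.
  have hsq : ((n / 2 : ℝ) ^ (1 / 2 : ℝ)) * (n / 4 : ℝ) ^ (-(1 / 2 : ℝ)) = √2 := by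
    rw [Real.rpow_neg (by positivity), ← div_eq_mul_inv, ← Real.div_rpow (by positivity)
      (by positivity), Real.sqrt_eq_rpow]
    congr 1; field_simp; norm_num
  have e5 : (4 * a / n) ^ a = ((4 * (r + 1 / 2 : ℝ)) ^ (r + 1 / 2 : ℝ) *
      (K : ℝ) ^ (r + 1 / 2 : ℝ) * (n : ℝ) ^ (-(r + 1 / 2 : ℝ))) ^ K := by
    rw [ha, Real.rpow_mul (by positivity), Real.rpow_natCast, Real.rpow_neg hn0.le,
      ← Real.mul_rpow (by positivity) (by positivity), ← Real.inv_rpow hn0.le,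
      ← Real.mul_rpow (by positivity) (by positivity)]
    congr 2; ring
  have e6 : √(4 * Real.pi / (n * ε)) = √(4 * Real.pi) * (√(n * ε))⁻¹ := by
    rw [Real.sqrt_div (by positivity), div_eq_mul_inv]
  have hJ' : J⁻¹ ≤ (g⁻¹) ^ K := by rw [inv_pow]; gcongr
  calc _ = (2 * Real.pi) ^ (-((n : ℝ) / 2)) * (α₂ ^ α₁ / Real.Gamma α₁) * Real.Gamma N * √2 *
        (J⁻¹ * (4 * a / n) ^ a *
        (16 ^ r * r.factorial * M ^ r * √(4 * Real.pi / (n * ε))) ^ K) * S ^ (-N) := by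
        rw [hC, ← hsq]; field_simp
    _ ≤ (2 * Real.pi) ^ (-((n : ℝ) / 2)) * (α₂ ^ α₁ / Real.Gamma α₁) * Real.Gamma N * √2 *
        ((g⁻¹) ^ K * (4 * a / n) ^ a *
        (16 ^ r * r.factorial * M ^ r * √(4 * Real.pi / (n * ε))) ^ K) * S ^ (-N) := by
        have := Real.Gamma_pos_of_pos hN0
        gcongr
    _ = _ := by
        rw [e5, e6, ← mul_pow, ← mul_pow, upperConst, ← hg]
        congr 3
        ring

/-! ### Lower bound for the marginal density -/

/-- Since the prior of τ has scale n/2, its density on [n, 2n] is of order 1/n, so this interval has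
mass bounded away from 0. -/
theorem le_invGammaDensity_half {n τ : ℝ} (hn : 0 < n) (h1 : n ≤ τ) (h2 : τ ≤ 2 * n) :
    Real.exp (-(1 / 2)) / (4 * Real.Gamma (1 / 2)) / n ≤ invGammaDensity (1 / 2) (n / 2) τ := by
  have hG : 0 < Real.Gamma (1 / 2) := Real.Gamma_pos_of_pos (by norm_num)
  have hτ : 0 < τ := by linarith
  unfold invGammaDensity
  have e1 : (n / 2) ^ (1 / 2 : ℝ) * (2 * n) ^ (-(1 / 2 + 1 : ℝ)) = 1 / (4 * n) := by
    rw [neg_add, Real.rpow_add (by positivity), Real.rpow_neg_one, Real.rpow_neg (by positivity),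
      ← mul_assoc, ← div_eq_mul_inv (_ ^ _), ← Real.div_rpow (by positivity) (by positivity)]
    have : n / 2 / (2 * n) = (1 / 2) ^ (2 : ℝ) := by
      rw [Real.rpow_two]; field_simp
    rw [this, ← Real.rpow_mul (by norm_num)]
    norm_num; ring
  have h3 : (2 * n) ^ (-(1 / 2 + 1 : ℝ)) ≤ τ ^ (-(1 / 2 + 1 : ℝ)) :=
    Real.rpow_le_rpow_of_nonpos hτ h2 (by norm_num)
  have h4 : Real.exp (-(1 / 2)) ≤ Real.exp (-(n / 2) / τ) := by
    refine Real.exp_le_exp.2 ?_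
    rw [neg_div, neg_le_neg_iff, div_le_iff₀ hτ]; linarith
  calc _ = (n / 2) ^ (1 / 2 : ℝ) * (2 * n) ^ (-(1 / 2 + 1 : ℝ)) / Real.Gamma (1 / 2) *
        Real.exp (-(1 / 2)) := by rw [e1]; field_simp
    _ = (n / 2) ^ (1 / 2 : ℝ) / Real.Gamma (1 / 2) * (2 * n) ^ (-(1 / 2 + 1 : ℝ)) *
        Real.exp (-(1 / 2)) := by ring
    _ ≤ _ := by gcongr

set_option maxHeartbeats 1000000 in
-- The box of half-width √(ε/n) around b is so small that the residual sum of squares exceeds R by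
-- at most |k| on it, and there the product of the β_i^(2r) is at least c₀^|k|. Only τ and β are
-- restricted: integrating over all s yields Γ(N + a) H^(-(N+a)), and Γ(N + a) ≥ N^a Γ(N) recovers
-- the factor Γ(N) of the upper bound.
theorem le_marginal {n p r : ℕ} {α₁ α₂ : ℝ} (hn : 1 ≤ n) (hr : 1 ≤ r) (hα₁ : 0 < α₁)
    (hα₂ : 0 < α₂) {X : Matrix (Fin n) (Fin p) ℝ} {A : Matrix (Fin p) (Fin p) ℝ}
    {a₁ a₂ : ℝ} (ha₁ : 0 < a₁) (ha₂ : 0 < a₂) (hA : QuadBound A a₁ a₂)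
    {k : Finset (Fin p)} {y : Fin n → ℝ} {ε R c₀ c₁ : ℝ} (b : k → ℝ)
    (hε : 0 < ε) (hR : 0 ≤ R) (hc₀ : 0 < c₀) (hc₁ : 0 ≤ c₁)
    (hbox : ∀ β : k → ℝ, (∀ i, |β i - b i| ≤ √(ε / n)) →
      (∀ i, c₀ ≤ β i ^ (2 * r)) ∧ β ⬝ᵥ β ≤ c₁)
    (hX : ∀ β : k → ℝ, (designSub X k *ᵥ β) ⬝ᵥ (designSub X k *ᵥ β) ≤ n * ε⁻¹ * (β ⬝ᵥ β))
    (hLS : ∀ β : k → ℝ, (y - designSub X k *ᵥ β) ⬝ᵥ (y - designSub X k *ᵥ β) =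
      R + (designSub X k *ᵥ (β - b)) ⬝ᵥ (designSub X k *ᵥ (β - b)))
    {H : ℝ} (hH : H = (R + k.card + a₂ * c₁) / 2 + α₂) :
    ENNReal.ofReal
      ((2 * Real.pi) ^ (-((n : ℝ) / 2)) * (α₂ ^ α₁ / Real.Gamma α₁) *
        Real.Gamma (n / 2 + α₁) * (Real.exp (-(1 / 2)) / (4 * Real.Gamma (1 / 2))) *
        ((∫ x : ℝ, Real.exp (-(a₁ / 2) * x ^ 2) * x ^ (2 * r))⁻¹ * c₀ *
          (2 * n) ^ (-(r + 1 / 2 : ℝ)) * (2 * √(ε / n)) *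
          ((n / 2 + α₁) / H) ^ (r + 1 / 2 : ℝ)) ^ k.card *
        H ^ (-(n / 2 + α₁))) ≤ marginal r α₁ α₂ X A k y := by
  classical
  have hn0 : (0 : ℝ) < n := by exact_mod_cast hn
  have hn1 : (1 : ℝ) ≤ n := by exact_mod_cast hn
  set K := k.card with hK
  set a : ℝ := (r + 1 / 2 : ℝ) * K with ha
  have ha0 : 0 ≤ a := by positivity
  set J := pmomMass r A k with hJ
  set g := ∫ x : ℝ, Real.exp (-(a₁ / 2) * x ^ 2) * x ^ (2 * r) with hg
  have hgpos : 0 < g := integral_exp_neg_sq_mul_pow_pos r ha₁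
  have hJg : J ≤ g ^ K := (pmomMass_bounds r ha₁ ha₂ hA k).2
  have hJpos : 0 < J := lt_of_lt_of_le (pow_pos (integral_exp_neg_sq_mul_pow_pos r ha₂) _)
    (pmomMass_bounds r ha₁ ha₂ hA k).1
  have hdet := hA.det_pos ha₁ k
  set N : ℝ := n / 2 + α₁ with hN
  have hN0 : 0 < N := by positivity
  have hGα : 0 < Real.Gamma α₁ := Real.Gamma_pos_of_pos hα₁
  have hGh : 0 < Real.Gamma (1 / 2) := Real.Gamma_pos_of_pos (by norm_num)
  have hGN : 0 < Real.Gamma N := Real.Gamma_pos_of_pos hN0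
  have hH0 : 0 < H := by rw [hH]; positivity
  set κ := Real.exp (-(1 / 2)) / (4 * Real.Gamma (1 / 2)) with hκ
  have hκ0 : 0 < κ := by positivity
  set δ := √(ε / n) with hδ
  have hδ0 : 0 < δ := Real.sqrt_pos.2 (by positivity)
  have hδ2 : δ * δ = ε / n := Real.mul_self_sqrt (by positivity)
  set C : ℝ := (2 * Real.pi) ^ (-((n : ℝ) / 2)) * (α₂ ^ α₁ / Real.Gamma α₁) * J⁻¹ *
    (2 * n) ^ (-a) * c₀ ^ K * (κ / n) * (2 * δ) ^ K with hC
  have hC0 : 0 < C := by positivity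
  have hinner : ∀ τ ∈ Set.Icc (n : ℝ) (2 * n), ∀ s > 0,
      ENNReal.ofReal (C * (s ^ (-(N + a + 1)) * Real.exp (-H / s))) ≤
      ∫⁻ β : k → ℝ,
      ENNReal.ofReal (likelihood X k y β s * pmomDensity r A k (τ * s) β *
      invGammaDensity (1 / 2) ((n : ℝ) / 2) τ * invGammaDensity α₁ α₂ s) := by
    intro τ hτ s hs
    have hτ0 : 0 < τ := lt_of_lt_of_le hn0 hτ.1
    set B : Set (k → ℝ) := Set.pi Set.univ fun i => Set.Icc (b i - δ) (b i + δ) with hB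
    have hBm : MeasurableSet B := MeasurableSet.univ_pi fun i => measurableSet_Icc
    have hvol : volume B = ENNReal.ofReal ((2 * δ) ^ K) := by
      rw [hB, volume_pi_pi]
      simp only [Real.volume_Icc]
      rw [Finset.prod_congr rfl (fun i _ => by rw [show b i + δ - (b i - δ) = 2 * δ by ring]),
        Finset.prod_const, Finset.card_univ, Fintype.card_coe, ← ENNReal.ofReal_pow (by positivity)]
    have hig2 : invGammaDensity α₁ α₂ s =
      α₂ ^ α₁ / Real.Gamma α₁ * s ^ (-(α₁ + 1)) * Real.exp (-α₂ / s) := rfl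
    have hig2' : 0 ≤ invGammaDensity α₁ α₂ s := by rw [hig2]; positivity
    set c := (2 * Real.pi * s) ^ (-((n : ℝ) / 2)) * Real.exp (-(R + K) / (2 * s)) *
      (J⁻¹ * ((2 * n) * s) ^ (-a) * Real.exp (-(a₂ * c₁) / (2 * s)) * c₀ ^ K) * (κ / n) *
      invGammaDensity α₁ α₂ s with hc
    have hc0 : 0 ≤ c := by positivity
    have hcC : C * (s ^ (-(N + a + 1)) * Real.exp (-H / s)) = c * (2 * δ) ^ K := by
      have e1 : (2 * Real.pi * s) ^ (-((n : ℝ) / 2)) =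
          (2 * Real.pi) ^ (-((n : ℝ) / 2)) * s ^ (-((n : ℝ) / 2)) :=
        Real.mul_rpow (by positivity) hs.le
      have e2 : (2 * n * s) ^ (-a) = (2 * n) ^ (-a) * s ^ (-a) :=
        Real.mul_rpow (by positivity) hs.le
      have e3 : s ^ (-(N + a + 1)) = s ^ (-((n : ℝ) / 2)) * s ^ (-a) * s ^ (-(α₁ + 1)) := by
        rw [← Real.rpow_add hs, ← Real.rpow_add hs]; congr 1; rw [hN]; ring
      have e4 : Real.exp (-H / s) = Real.exp (-(R + K) / (2 * s)) *
          Real.exp (-(a₂ * c₁) / (2 * s)) * Real.exp (-α₂ / s) := by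
        rw [← Real.exp_add, ← Real.exp_add]; congr 1; rw [hH]; field_simp; ring
      rw [hC, hc, e1, e2, e3, e4, hig2]; ring
    rw [hcC, ENNReal.ofReal_mul hc0, ← hvol, ← setLIntegral_const]
    refine le_trans (setLIntegral_mono' hBm fun β hβ => ?_) (setLIntegral_le_lintegral B _)
    refine ENNReal.ofReal_le_ofReal ?_
    have hβ' : ∀ i, |β i - b i| ≤ δ := fun i => by
      have := hβ i (Set.mem_univ i)
      rw [abs_le]; constructor <;> linarith [this.1, this.2]
    obtain ⟨h1, h2⟩ := hbox β hβ'
    rw [pmomDensity_eq hdet, likelihood, hLS]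
    have hprod : c₀ ^ K ≤ ∏ i, β i ^ (2 * r) := by
      rw [hK, ← Fintype.card_coe k, ← Finset.card_univ, ← Finset.prod_const]
      exact Finset.prod_le_prod (fun i _ => hc₀.le) (fun i _ => h1 i)
    have hquad : (designSub X k *ᵥ (β - b)) ⬝ᵥ (designSub X k *ᵥ (β - b)) ≤ K := by
      refine (hX (β - b)).trans ?_
      have : (β - b) ⬝ᵥ (β - b) ≤ K * (ε / n) := by
        rw [hK, ← Fintype.card_coe k, ← Finset.card_univ, ← nsmul_eq_mul, ← Finset.sum_const]
        refine Finset.sum_le_sum fun i _ => ?_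
        rw [← hδ2, Pi.sub_apply, ← abs_mul_abs_self]
        exact mul_self_le_mul_self (abs_nonneg _) (hβ' i)
      calc n * ε⁻¹ * ((β - b) ⬝ᵥ (β - b)) ≤ n * ε⁻¹ * (K * (ε / n)) := by gcongr
        _ = K := by field_simp
    have hE1 : Real.exp (-(a₂ * c₁) / (2 * s)) ≤
        Real.exp (-(β ⬝ᵥ principalSub A k *ᵥ β) / (2 * (τ * s))) := by
      refine Real.exp_le_exp.2 ?_
      rw [neg_div, neg_div, neg_le_neg_iff]
      have h3 : β ⬝ᵥ principalSub A k *ᵥ β ≤ a₂ * c₁ :=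
        ((hA.principalSub k β).2).trans (by gcongr)
      -- Here τ ≥ n ≥ 1, so replacing τ s by s only strengthens the exponential decay.
      have h5 : 2 * s ≤ 2 * (τ * s) := by nlinarith [hτ.1]
      exact div_le_div₀ (by positivity) h3 (by positivity) h5
    have hE2 : Real.exp (-(R + K) / (2 * s)) ≤
        Real.exp (-(R + (designSub X k *ᵥ (β - b)) ⬝ᵥ (designSub X k *ᵥ (β - b))) / (2 * s)) := by
      refine Real.exp_le_exp.2 ?_
      gcongr
    have hpow : (2 * n * s) ^ (-a) ≤ (τ * s) ^ (-a) :=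
      Real.rpow_le_rpow_of_nonpos (by positivity)
        (mul_le_mul_of_nonneg_right hτ.2 hs.le) (by linarith)
    have hig := le_invGammaDensity_half hn0 hτ.1 hτ.2
    have hprod0 : 0 ≤ ∏ i, β i ^ (2 * r) := le_trans (by positivity) hprod
    rw [← ha, ← hJ, hc]
    gcongr
  have hmain : ENNReal.ofReal (C * (Real.Gamma (N + a) * H ^ (-(N + a))) * n) ≤
      marginal r α₁ α₂ X A k y := by
    have hsub : Set.Icc (n : ℝ) (2 * n) ⊆ Set.Ioi 0 := fun τ hτ => lt_of_lt_of_le hn0 hτ.1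
    have hGa := Real.Gamma_pos_of_pos (by positivity : 0 < N + a)
    have e1 : ENNReal.ofReal (n : ℝ) = volume (Set.Icc (n : ℝ) (2 * n)) := by
      rw [Real.volume_Icc]; congr 1; ring
    rw [ENNReal.ofReal_mul (by positivity), e1, ← setLIntegral_const]
    refine le_trans ?_ (lintegral_mono_set hsub)
    refine setLIntegral_mono' measurableSet_Icc fun τ hτ => ?_
    rw [ENNReal.ofReal_mul hC0.le, ← lintegral_rpow_mul_exp_neg_div (by positivity) hH0,
      ← lintegral_const_mul' _ _ ENNReal.ofReal_ne_top]
    refine setLIntegral_mono' measurableSet_Ioi fun s hs => ?_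
    rw [← ENNReal.ofReal_mul hC0.le]
    exact hinner τ hτ s hs
  refine (ENNReal.ofReal_le_ofReal ?_).trans hmain
  have hb : a = 0 ∨ 1 < a := by
    rcases Nat.eq_zero_or_pos K with h | h
    · left; rw [ha, h]; simp
    · right
      have h1 : (1 : ℝ) ≤ K := by exact_mod_cast h
      have h2 : (1 : ℝ) ≤ r := by exact_mod_cast hr
      rw [ha]; nlinarith
  have hGam := rpow_mul_Gamma_le hN0 hb
  have e7 : N ^ a * H ^ (-(N + a)) = (((N) / H) ^ (r + 1 / 2 : ℝ)) ^ K * H ^ (-N) := by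
    rw [← Real.rpow_mul_natCast (by positivity), ← ha, neg_add, Real.rpow_add hH0,
      Real.rpow_neg hH0.le a, Real.div_rpow hN0.le hH0.le]
    ring
  have e8 : (2 * n : ℝ) ^ (-a) = ((2 * n : ℝ) ^ (-(r + 1 / 2 : ℝ))) ^ K := by
    rw [← Real.rpow_mul_natCast (by positivity), ha, neg_mul]
  have hJ' : (g⁻¹) ^ K ≤ J⁻¹ := by rw [inv_pow]; gcongr
  calc _ = (2 * Real.pi) ^ (-((n : ℝ) / 2)) * (α₂ ^ α₁ / Real.Gamma α₁) * (g⁻¹) ^ K *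
    (2 * n) ^ (-a) * c₀ ^ K * κ * (2 * δ) ^ K * (Real.Gamma N * (N ^ a * H ^ (-(N + a)))) := by
        rw [e7, e8, mul_pow, mul_pow, mul_pow, mul_pow]; ring
    _ ≤ (2 * Real.pi) ^ (-((n : ℝ) / 2)) * (α₂ ^ α₁ / Real.Gamma α₁) * J⁻¹ *
    (2 * n) ^ (-a) * c₀ ^ K * κ * (2 * δ) ^ K * (Real.Gamma N * (N ^ a * H ^ (-(N + a)))) := by
        gcongr
    _ = (2 * Real.pi) ^ (-((n : ℝ) / 2)) * (α₂ ^ α₁ / Real.Gamma α₁) * J⁻¹ *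
    (2 * n) ^ (-a) * c₀ ^ K * κ * (2 * δ) ^ K * ((N ^ a * Real.Gamma N) * H ^ (-(N + a))) := by
        ring
    _ ≤ (2 * Real.pi) ^ (-((n : ℝ) / 2)) * (α₂ ^ α₁ / Real.Gamma α₁) * J⁻¹ *
    (2 * n) ^ (-a) * c₀ ^ K * κ * (2 * δ) ^ K * (Real.Gamma (N + a) * H ^ (-(N + a))) := by
        gcongr
    _ = _ := by rw [hC]; field_simp

/-! ### Least squares -/

/-- The span of the columns of `X` with index in `k`. -/
noncomputable def colSpace {n p : ℕ} (X : Matrix (Fin n) (Fin p) ℝ) (k : Finset (Fin p)) :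
    Submodule ℝ (EuclideanSpace ℝ (Fin n)) :=
  Submodule.span ℝ ((fun j => WithLp.toLp 2 (fun i => X i j)) '' (k : Set (Fin p)))

/-- The residual sum of squares of the model `k`. -/
noncomputable def rss {n p : ℕ} (X : Matrix (Fin n) (Fin p) ℝ) (k : Finset (Fin p))
    (y : EuclideanSpace ℝ (Fin n)) : ℝ :=
  ‖y - (colSpace X k).starProjection y‖ ^ 2

section LeastSquares

variable {n p : ℕ} {X : Matrix (Fin n) (Fin p) ℝ}

theorem dotProduct_self_eq_norm_sq {ι : Type*} [Fintype ι] (x : ι → ℝ) :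
    x ⬝ᵥ x = ‖WithLp.toLp 2 x‖ ^ 2 := by
  rw [← real_inner_self_eq_norm_sq, EuclideanSpace.inner_eq_star_dotProduct]; simp

theorem toLp_mulVec_eq_sum (x : Fin p → ℝ) :
    WithLp.toLp 2 (X *ᵥ x) = ∑ j, x j • WithLp.toLp 2 (fun i => X i j) := by
  ext i
  simp [Matrix.mulVec, dotProduct, mul_comm]

theorem toLp_mulVec_mem_colSpace {k : Finset (Fin p)} {x : Fin p → ℝ} (hx : ∀ j ∉ k, x j = 0) :
    WithLp.toLp 2 (X *ᵥ x) ∈ colSpace X k := by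
  rw [toLp_mulVec_eq_sum]
  refine Submodule.sum_mem _ fun j _ => ?_
  by_cases hj : j ∈ k
  · exact Submodule.smul_mem _ _ (Submodule.subset_span ⟨j, hj, rfl⟩)
  · rw [hx j hj, zero_smul]; exact Submodule.zero_mem _

theorem extendZero_of_notMem {k : Finset (Fin p)} (b : k → ℝ) {j : Fin p} (hj : j ∉ k) :
    extendZero k b j = 0 := by simp [extendZero, hj]

theorem toLp_designSub_mem_colSpace (k : Finset (Fin p)) (b : k → ℝ) :
    WithLp.toLp 2 (designSub X k *ᵥ b) ∈ colSpace X k := by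
  rw [← mulVec_extendZero]
  exact toLp_mulVec_mem_colSpace fun j hj => extendZero_of_notMem b hj

theorem extendZero_restrict {k : Finset (Fin p)} {x : Fin p → ℝ} (hx : ∀ j ∉ k, x j = 0) :
    extendZero k (fun i : k => x i) = x := by
  ext j
  by_cases hj : j ∈ k
  · simp [extendZero, hj]
  · rw [extendZero_of_notMem _ hj, hx j hj]

theorem designSub_mulVec_restrict {k : Finset (Fin p)} {x : Fin p → ℝ} (hx : ∀ j ∉ k, x j = 0) :
    designSub X k *ᵥ (fun i : k => x i) = X *ᵥ x := by
  rw [← mulVec_extendZero, extendZero_restrict hx]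

theorem exists_of_mem_colSpace {k : Finset (Fin p)} {v : EuclideanSpace ℝ (Fin n)}
    (hv : v ∈ colSpace X k) : ∃ b : k → ℝ, WithLp.toLp 2 (designSub X k *ᵥ b) = v := by
  unfold colSpace at hv
  rw [Submodule.mem_span_image_finset_iff_exists_fun] at hv
  obtain ⟨c, rfl⟩ := hv
  refine ⟨c, ?_⟩
  ext i
  simp [Matrix.mulVec, dotProduct, designSub, mul_comm]

theorem colSpace_mono {k l : Finset (Fin p)} (h : k ⊆ l) : colSpace X k ≤ colSpace X l :=
  Submodule.span_mono (Set.image_mono (by exact_mod_cast h))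

theorem finrank_colSpace_le (k : Finset (Fin p)) : Module.finrank ℝ (colSpace X k) ≤ k.card := by
  classical
  unfold colSpace
  rw [← Finset.coe_image]
  exact (finrank_span_finset_le_card _).trans Finset.card_image_le

theorem norm_sq_eq_rss_add (k : Finset (Fin p)) (y : EuclideanSpace ℝ (Fin n)) :
    ‖y‖ ^ 2 = rss X k y + ‖(colSpace X k).starProjection y‖ ^ 2 := by
  rw [Submodule.norm_sq_eq_add_norm_sq_starProjection y (colSpace X k), rss,
    Submodule.starProjection_orthogonal_val, add_comm]

theorem rss_nonneg (k : Finset (Fin p)) (y : EuclideanSpace ℝ (Fin n)) : 0 ≤ rss X k y :=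
  sq_nonneg _

theorem rss_le_norm_sq (k : Finset (Fin p)) (y : EuclideanSpace ℝ (Fin n)) :
    rss X k y ≤ ‖y‖ ^ 2 := by
  rw [norm_sq_eq_rss_add k]; linarith [sq_nonneg ‖(colSpace X k).starProjection y‖]

/-- The least squares estimate. -/
theorem exists_leastSquares (k : Finset (Fin p)) (y : Fin n → ℝ) :
    ∃ b : k → ℝ, WithLp.toLp 2 (designSub X k *ᵥ b) =
        (colSpace X k).starProjection (WithLp.toLp 2 y) ∧
      ∀ β : k → ℝ, (y - designSub X k *ᵥ β) ⬝ᵥ (y - designSub X k *ᵥ β) =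
        rss X k (WithLp.toLp 2 y) +
          (designSub X k *ᵥ (β - b)) ⬝ᵥ (designSub X k *ᵥ (β - b)) := by
  obtain ⟨b, hb⟩ := exists_of_mem_colSpace
    ((colSpace X k).starProjection_apply_mem (WithLp.toLp 2 y))
  refine ⟨b, hb, fun β => ?_⟩
  rw [dotProduct_self_eq_norm_sq, dotProduct_self_eq_norm_sq, rss, ← hb]
  have e : WithLp.toLp 2 (y - designSub X k *ᵥ β) =
      (WithLp.toLp 2 y - WithLp.toLp 2 (designSub X k *ᵥ b)) -
        WithLp.toLp 2 (designSub X k *ᵥ (β - b)) := by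
    rw [Matrix.mulVec_sub, ← WithLp.toLp_sub, ← WithLp.toLp_sub, sub_sub_sub_cancel_right]
  have ho : inner ℝ (WithLp.toLp 2 y - WithLp.toLp 2 (designSub X k *ᵥ b))
      (WithLp.toLp 2 (designSub X k *ᵥ (β - b))) = 0 := by
    rw [hb]
    exact (colSpace X k).starProjection_inner_eq_zero _ _ (toLp_designSub_mem_colSpace k _)
  rw [e, @norm_sub_sq_real, ho]; ring

theorem norm_starProjection_le_of_le {E : Type*} [NormedAddCommGroup E] [InnerProductSpace ℝ E]
    {U V : Submodule ℝ E} [U.HasOrthogonalProjection] [V.HasOrthogonalProjection] (h : U ≤ V)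
    (x : E) : ‖U.starProjection x‖ ≤ ‖V.starProjection x‖ := by
  have : U.starProjection x = U.starProjection (V.starProjection x) := by
    rw [← ContinuousLinearMap.comp_apply, Submodule.starProjection_comp_starProjection_of_le h]
  rw [this]
  exact U.norm_starProjection_apply_le _

theorem rss_anti {k l : Finset (Fin p)} (h : k ⊆ l) (y : EuclideanSpace ℝ (Fin n)) :
    rss X l y ≤ rss X k y := by
  have h1 := norm_sq_eq_rss_add (X := X) k y
  have h2 := norm_sq_eq_rss_add (X := X) l y
  have h3 := norm_starProjection_le_of_le (colSpace_mono (X := X) h) y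
  have h4 := pow_le_pow_left₀ (norm_nonneg _) h3 2
  linarith

theorem rss_add_of_mem {k : Finset (Fin p)} {μ : EuclideanSpace ℝ (Fin n)}
    (hμ : μ ∈ colSpace X k) (e : EuclideanSpace ℝ (Fin n)) : rss X k (μ + e) = rss X k e := by
  rw [rss, rss, map_add, (colSpace X k).starProjection_eq_self_iff.2 hμ]
  congr 2; abel

theorem rss_eq_sub {k : Finset (Fin p)} {μ : EuclideanSpace ℝ (Fin n)}
    (hμ : μ ∈ colSpace X k) (e : EuclideanSpace ℝ (Fin n)) :
    rss X k (μ + e) = ‖e‖ ^ 2 - ‖(colSpace X k).starProjection e‖ ^ 2 := by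
  rw [rss_add_of_mem hμ, norm_sq_eq_rss_add (X := X) k e]; ring

/-- The part of the column space of a larger model that is orthogonal to the smaller one. -/
noncomputable def extraSpace (X : Matrix (Fin n) (Fin p) ℝ) (t k : Finset (Fin p)) :
    Submodule ℝ (EuclideanSpace ℝ (Fin n)) :=
  colSpace X k ⊓ (colSpace X t)ᗮ

/-- A vector of col(k) orthogonal to col(t) equals the projection, onto the orthogonal complement of
col(t), of its component in col(k \ t). The space is thus contained in a linear image of col(k \ t).
-/
theorem finrank_extraSpace_le [DecidableEq (Fin p)] {t k : Finset (Fin p)} (h : t ⊆ k) :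
    Module.finrank ℝ (extraSpace X t k) ≤ (k \ t).card := by
  have hle : extraSpace X t k ≤
      (colSpace X (k \ t)).map ((colSpace X t)ᗮ.starProjection : _ →ₗ[ℝ] _) := by
    rintro w ⟨hw1, hw2⟩
    have e : colSpace X k = colSpace X t ⊔ colSpace X (k \ t) := by
      unfold colSpace
      rw [← Submodule.span_union, ← Set.image_union, ← Finset.coe_union,
        Finset.union_sdiff_of_subset h]
    rw [e] at hw1
    obtain ⟨s, hs, u, hu, rfl⟩ := Submodule.mem_sup.1 hw1
    refine ⟨u, hu, ?_⟩
    have h1 : (colSpace X t)ᗮ.starProjection (s + u) = s + u :=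
      (Submodule.starProjection_eq_self_iff).2 hw2
    have h2 : (colSpace X t)ᗮ.starProjection s = 0 := by
      rw [Submodule.starProjection_orthogonal_val, (Submodule.starProjection_eq_self_iff).2 hs,
        sub_self]
    rw [map_add, h2, zero_add] at h1
    exact h1
  exact (Submodule.finrank_mono hle).trans
    ((Submodule.finrank_map_le _ _).trans (finrank_colSpace_le _))

/-- The difference of two nested projections is the projection onto the relative orthogonal
complement; then Pythagoras. For models containing t, this makes the drop in the residual sum of
squares a chi-squared quantity. -/
theorem norm_starProjection_sub_eq {t k : Finset (Fin p)} (h : t ⊆ k)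
    (e : EuclideanSpace ℝ (Fin n)) :
    ‖(colSpace X k).starProjection e‖ ^ 2 - ‖(colSpace X t).starProjection e‖ ^ 2 =
      ‖(extraSpace X t k).starProjection e‖ ^ 2 := by
  set Pk := (colSpace X k).starProjection e with hPk
  set Pt := (colSpace X t).starProjection e with hPt
  have hle := colSpace_mono (X := X) h
  have hPt' : Pt ∈ colSpace X t := Submodule.starProjection_apply_mem _ _
  have hPk' : Pk ∈ colSpace X k := Submodule.starProjection_apply_mem _ _
  have horth : ∀ v ∈ colSpace X t, inner ℝ (Pk - Pt) v = 0 := by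
    intro v hv
    have h1 := (colSpace X t).starProjection_inner_eq_zero e v hv
    have h2 := (colSpace X k).starProjection_inner_eq_zero e v (hle hv)
    rw [inner_sub_left] at h1 h2 ⊢
    linarith
  have hW : (extraSpace X t k).starProjection e = Pk - Pt := by
    refine Submodule.eq_starProjection_of_mem_of_inner_eq_zero
      ⟨Submodule.sub_mem _ hPk' (hle hPt'), ?_⟩ ?_
    · exact (Submodule.mem_orthogonal' _ _).2 horth
    · intro w hw
      have h1 := (colSpace X k).starProjection_inner_eq_zero e w hw.1
      have h2 := (Submodule.mem_orthogonal _ _).1 hw.2 Pt hPt'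
      rw [show e - (Pk - Pt) = (e - Pk) + Pt by abel, inner_add_left, h1, h2, add_zero]
  rw [hW]
  have : Pk = (Pk - Pt) + Pt := by abel
  conv_lhs => rw [this]
  rw [@norm_add_sq_real, horth Pt hPt']; ring

/-- A model that omits a variable of the true model has a large residual sum of squares. -/
theorem rss_sub_rss_le [DecidableEq (Fin p)] {t k : Finset (Fin p)} {x : Fin p → ℝ}
    (hx : ∀ j ∉ t, x j = 0) {ε h D : ℝ} {e : EuclideanSpace ℝ (Fin n)}
    (hX : ∀ b : ↥(k ∪ t) → ℝ, n * ε * (b ⬝ᵥ b) ≤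
      (designSub X (k ∪ t) *ᵥ b) ⬝ᵥ (designSub X (k ∪ t) *ᵥ b))
    (hε : 0 ≤ n * ε)
    {j : Fin p} (hjt : j ∈ t) (hjk : j ∉ k) (hD : D ^ 2 ≤ n * ε * x j ^ 2) (hhD : h ≤ D)
    (hD0 : 0 ≤ D)
    (hh : ‖(colSpace X (k ∪ t)).starProjection e‖ ≤ h) :
    rss X t (WithLp.toLp 2 (X *ᵥ x) + e) - rss X k (WithLp.toLp 2 (X *ᵥ x) + e) ≤
      h ^ 2 - (D - h) ^ 2 := by
  set μ := WithLp.toLp 2 (X *ᵥ x) with hμ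
  set l := k ∪ t with hl
  have hμt : μ ∈ colSpace X t := toLp_mulVec_mem_colSpace hx
  have hμl : μ ∈ colSpace X l := colSpace_mono Finset.subset_union_right hμt
  have hh0 : 0 ≤ h := (norm_nonneg _).trans hh
  have h1 : rss X t (μ + e) - rss X l (μ + e) ≤ h ^ 2 := by
    rw [rss_eq_sub hμt, rss_eq_sub hμl]
    have := pow_le_pow_left₀ (norm_nonneg _) hh 2
    linarith [sq_nonneg ‖(colSpace X t).starProjection e‖]
  set Pk := (colSpace X k).starProjection with hPk
  set Pl := (colSpace X l).starProjection with hPl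
  have hkl : colSpace X k ≤ colSpace X l := colSpace_mono Finset.subset_union_left
  have hid : ∀ v, Pk v = Pk (Pl v) := fun v => by
    rw [← ContinuousLinearMap.comp_apply, Submodule.starProjection_comp_starProjection_of_le hkl]
  -- The misfit μ - P_k μ is X_l c for some c supported on l = k ∪ t. Its coordinate at j is x_j,
  -- because the fit by k cannot touch j ∉ k; the conditioning of X_l then bounds its norm below.
  have hlow : D ≤ ‖μ - Pk μ‖ := by
    have hmem : Pk μ ∈ colSpace X k := Submodule.starProjection_apply_mem _ _
    obtain ⟨b, hb⟩ := exists_of_mem_colSpace hmem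
    set c : Fin p → ℝ := x - extendZero k b with hc
    have hcl : ∀ i ∉ l, c i = 0 := fun i hi => by
      rw [hl, Finset.mem_union, not_or] at hi
      rw [hc, Pi.sub_apply, hx i hi.2, extendZero_of_notMem b hi.1, sub_zero]
    have hcj : c j = x j := by rw [hc, Pi.sub_apply, extendZero_of_notMem b hjk, sub_zero]
    have e1 : μ - Pk μ = WithLp.toLp 2 (designSub X l *ᵥ (fun i : l => c i)) := by
      rw [designSub_mulVec_restrict hcl, ← hb, ← mulVec_extendZero, hμ, ← WithLp.toLp_sub,
        ← Matrix.mulVec_sub]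
    have h2 := hX (fun i : l => c i)
    rw [dotProduct_self_eq_norm_sq (designSub X l *ᵥ _), ← e1] at h2
    have hjl : j ∈ l := Finset.mem_union_right _ hjt
    have h3 : x j ^ 2 ≤ (fun i : l => c i) ⬝ᵥ (fun i : l => c i) := by
      rw [← hcj, sq]
      exact Finset.single_le_sum (f := fun i : l => c i * c i)
        (fun i _ => mul_self_nonneg _) (Finset.mem_univ (⟨j, hjl⟩ : l))
    have h4 : D ^ 2 ≤ ‖μ - Pk μ‖ ^ 2 :=
      hD.trans ((mul_le_mul_of_nonneg_left h3 hε).trans h2)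
    exact (sq_le_sq₀ hD0 (norm_nonneg _)).1 h4
  -- The difference is the squared distance of P_l y from col(k). By the triangle inequality the
  -- errors, projected onto col(l), reduce that distance by at most h.
  have h5 : (D - h) ^ 2 ≤ rss X k (μ + e) - rss X l (μ + e) := by
    have hy := norm_sq_eq_rss_add (X := X) k (μ + e)
    have hy' := norm_sq_eq_rss_add (X := X) l (μ + e)
    have hz := norm_sq_eq_rss_add (X := X) k (Pl (μ + e))
    have e2 : rss X k (μ + e) - rss X l (μ + e) = rss X k (Pl (μ + e)) := by
      rw [← hPk, ← hid] at hz
      rw [← hPk] at hy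
      rw [← hPl] at hy'
      linarith
    rw [e2, rss, ← hPk]
    have e3 : Pl (μ + e) = μ + Pl e := by
      rw [map_add, (colSpace X l).starProjection_eq_self_iff.2 hμl]
    have e4 : Pl (μ + e) - Pk (Pl (μ + e)) = (μ - Pk μ) + (Pl e - Pk (Pl e)) := by
      rw [e3, map_add]; abel
    have h6 : ‖Pl e - Pk (Pl e)‖ ≤ h := by
      have := rss_le_norm_sq (X := X) k (Pl e)
      rw [rss] at this
      exact ((sq_le_sq₀ (norm_nonneg _) (norm_nonneg _)).1 this).trans hh
    have h7 : ‖μ - Pk μ‖ ≤ ‖Pl (μ + e) - Pk (Pl (μ + e))‖ + ‖Pl e - Pk (Pl e)‖ := by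
      rw [e4]
      have := norm_sub_le ((μ - Pk μ) + (Pl e - Pk (Pl e))) (Pl e - Pk (Pl e))
      rwa [add_sub_cancel_right] at this
    exact pow_le_pow_left₀ (by linarith) (by linarith) 2
  linarith

end LeastSquares

/-! ### Gaussian vectors -/

section Gaussian

variable {Ω ι : Type*} [MeasurableSpace Ω] [Fintype ι] {P : Measure Ω} [IsProbabilityMeasure P]
  {v : ℝ≥0} {E : ι → Ω → ℝ}

theorem lintegral_ofReal_exp_eq_of_mgf {Y : Ω → ℝ} {t m : ℝ} (h : mgf Y P t = m) (hm : 0 < m) :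
    ∫⁻ ω, ENNReal.ofReal (Real.exp (t * Y ω)) ∂P = ENNReal.ofReal m := by
  -- `mgf` is 0 where the exponential is not integrable, so a positive value certifies
  -- integrability.
  have hintegrable : Integrable (fun ω => Real.exp (t * Y ω)) P := mgf_pos_iff.1 (h ▸ hm)
  rw [← h, mgf, ofReal_integral_eq_lintegral_ofReal hintegrable (ae_of_all _ fun ω => (Real.exp_pos _).le)]

theorem lintegral_exp_linear (hlaw : ∀ i, HasLaw (E i) (gaussianReal 0 v) P)
    (hind : iIndepFun E P) (a : ι → ℝ) :
    ∫⁻ ω, ENNReal.ofReal (Real.exp (∑ i, a i * E i ω)) ∂P =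
      ENNReal.ofReal (Real.exp (v * (∑ i, a i ^ 2) / 2)) := by
  have h1 : iIndepFun (fun i ω => a i * E i ω) P :=
    hind.comp (fun i x => a i * x) (fun i => measurable_const_mul (a i))
  have h2 := h1.mgf_sum₀ (t := 1) (fun i => (hlaw i).aemeasurable.const_mul (a i)) Finset.univ
  have h3 : ∀ i, mgf (fun ω => a i * E i ω) P 1 = Real.exp (v * a i ^ 2 / 2) := fun i => by
    have := mgf_gaussianReal (gaussianReal_const_mul (hlaw i) (a i)).map_eq 1
    rw [this]; congr 1; simp; ring
  simp_rw [h3] at h2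
  rw [← Real.exp_sum] at h2
  have h4 := lintegral_ofReal_exp_eq_of_mgf h2 (Real.exp_pos _)
  simp only [Finset.sum_apply, one_mul] at h4
  rw [h4, ← Finset.sum_div, ← Finset.mul_sum]

theorem mgf_sq_gaussianReal (hv : v ≠ 0) {θ : ℝ} (hθ : 2 * θ * v < 1) :
    mgf (fun x => x ^ 2) (gaussianReal 0 v) θ = (√(1 - 2 * θ * v))⁻¹ := by
  have hv' : (0 : ℝ) < v := by positivity
  rw [mgf, integral_gaussianReal_eq_integral_smul hv]
  have e : ∀ x : ℝ, gaussianPDFReal 0 v x • Real.exp (θ * x ^ 2) =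
      (√(2 * Real.pi * v))⁻¹ * Real.exp (-(1 / (2 * v) - θ) * x ^ 2) := fun x => by
    rw [gaussianPDFReal, smul_eq_mul, mul_assoc, ← Real.exp_add]
    congr 2; field_simp; ring
  simp_rw [e]
  rw [integral_const_mul, integral_gaussian, ← Real.sqrt_inv, ← Real.sqrt_mul (by positivity),
    ← Real.sqrt_inv]
  congr 1
  have : 1 - 2 * θ * v ≠ 0 := by linarith
  field_simp

theorem lintegral_exp_sum_sq (hv : v ≠ 0) (hlaw : ∀ i, HasLaw (E i) (gaussianReal 0 v) P)
    (hind : iIndepFun E P) {θ : ℝ} (hθ : 2 * θ * v < 1) :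
    ∫⁻ ω, ENNReal.ofReal (Real.exp (θ * ∑ i, E i ω ^ 2)) ∂P =
      ENNReal.ofReal ((√(1 - 2 * θ * v))⁻¹ ^ Fintype.card ι) := by
  have h1 : iIndepFun (fun i ω => E i ω ^ 2) P :=
    hind.comp (fun i x => x ^ 2) (fun i => measurable_id.pow_const 2)
  have h2 := h1.mgf_sum₀ (t := θ) (fun i => (hlaw i).aemeasurable.pow_const 2) Finset.univ
  have h3 : ∀ i, mgf (fun ω => E i ω ^ 2) P θ = (√(1 - 2 * θ * v))⁻¹ := fun i => by
    rw [← mgf_sq_gaussianReal hv hθ, ← (hlaw i).map_eq, mgf, mgf,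
      integral_map (hlaw i).aemeasurable
        (by fun_prop : Continuous fun x : ℝ => Real.exp (θ * x ^ 2)).aestronglyMeasurable]
  simp_rw [h3] at h2
  rw [Finset.prod_const, Finset.card_univ] at h2
  have h5 : 0 < 1 - 2 * θ * v := by linarith
  have h4 := lintegral_ofReal_exp_eq_of_mgf h2 (by positivity)
  simpa only [Finset.sum_apply] using h4

theorem norm_sq_starProjection_eq_sum {V : Type*} [NormedAddCommGroup V] [InnerProductSpace ℝ V]
    [FiniteDimensional ℝ V] (W : Submodule ℝ V) (x : V) :
    ‖W.starProjection x‖ ^ 2 =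
      ∑ j, (inner ℝ (stdOrthonormalBasis ℝ W j : V) x) ^ 2 := by
  set u := stdOrthonormalBasis ℝ W
  have h := u.sum_sq_norm_inner_right (W.orthogonalProjectionOnto x)
  rw [Submodule.starProjection_apply, ← Submodule.coe_norm, ← h]
  refine Finset.sum_congr rfl fun j _ => ?_
  rw [Submodule.inner_orthogonalProjectionOnto_eq_of_mem_left]
  rw [Real.norm_eq_abs, sq_abs]

/-- The squared norm of the projection of an isotropic Gaussian vector has a chi-squared law. -/
theorem lintegral_exp_norm_sq_starProjection (hv : v ≠ 0)
    (hlaw : ∀ i, HasLaw (E i) (gaussianReal 0 v) P)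
    (hind : iIndepFun E P) (W : Submodule ℝ (EuclideanSpace ℝ ι)) {c : ℝ} (hc0 : 0 ≤ c)
    (hc : c < 1) :
    ∫⁻ ω, ENNReal.ofReal (Real.exp
        (c / (2 * v) * ‖W.starProjection (WithLp.toLp 2 fun i => E i ω)‖ ^ 2)) ∂P =
      ENNReal.ofReal ((√(1 - c))⁻¹ ^ Module.finrank ℝ W) := by
  have hv' : (0 : ℝ) < v := by positivity
  set d := Module.finrank ℝ W with hd
  set u := stdOrthonormalBasis ℝ W with hu
  -- An auxiliary standard Gaussian z in dimension d linearizes the square: exp(|a|²/2) is the mean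
  -- of exp(a · z). After exchanging the integrals, only linear forms in the errors appear inside,
  -- followed by a sum of independent squares of the z_j; rotation invariance is not needed.
  set π : Measure (Fin d → ℝ) := Measure.pi fun _ => gaussianReal 0 1 with hπ
  have hzlaw : ∀ j : Fin d, HasLaw (fun z : Fin d → ℝ => z j) (gaussianReal 0 1) π := fun j =>
    (measurePreserving_eval (fun _ : Fin d => gaussianReal 0 1) j).hasLaw
  have hzind : iIndepFun (fun (j : Fin d) (z : Fin d → ℝ) => z j) π :=
    iIndepFun_pi (X := fun _ x => x) (fun i => aemeasurable_id)
  set q := √(c / v) with hq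
  have hq2 : q ^ 2 = c / v := Real.sq_sqrt (by positivity)
  set ev : Ω → EuclideanSpace ℝ ι := fun ω => WithLp.toLp 2 fun i => E i ω with hev
  have h1 : ∀ ω, ENNReal.ofReal (Real.exp (c / (2 * v) * ‖W.starProjection (ev ω)‖ ^ 2)) =
      ∫⁻ z, ENNReal.ofReal (Real.exp (∑ j, (q * inner ℝ (u j : EuclideanSpace ℝ ι) (ev ω)) * z j)) ∂π := by
    intro ω
    rw [lintegral_exp_linear hzlaw hzind, norm_sq_starProjection_eq_sum]
    congr 2
    simp_rw [mul_pow]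
    rw [← Finset.mul_sum, hq2]
    simp only [NNReal.coe_one]
    ring
  have hmeas : AEMeasurable (Function.uncurry fun (ω : Ω) (z : Fin d → ℝ) =>
      ENNReal.ofReal (Real.exp (∑ j, (q * inner ℝ (u j : EuclideanSpace ℝ ι) (ev ω)) * z j)))
      (P.prod π) := by
    have hE : ∀ i, AEMeasurable (E i) P := fun i => (hlaw i).aemeasurable
    have hev' : AEMeasurable (fun x : Ω × (Fin d → ℝ) => ev x.1) (P.prod π) := by
      have : AEMeasurable ev P :=
        (PiLp.continuous_toLp 2 _).measurable.comp_aemeasurable (aemeasurable_pi_lambda _ hE)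
      exact this.comp_fst
    refine (Real.measurable_exp.comp_aemeasurable
      (Finset.aemeasurable_fun_sum _ fun j _ => ?_)).ennreal_ofReal
    exact (((measurable_const.inner measurable_id).comp_aemeasurable hev').const_mul q).mul
      ((measurable_pi_apply j).comp measurable_snd).aemeasurable
  rw [lintegral_congr h1, lintegral_lintegral_swap hmeas]
  have h2 : ∀ z : Fin d → ℝ, ∫⁻ ω, ENNReal.ofReal
      (Real.exp (∑ j, (q * inner ℝ (u j : EuclideanSpace ℝ ι) (ev ω)) * z j)) ∂P =
      ENNReal.ofReal (Real.exp (c / 2 * ∑ j, z j ^ 2)) := by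
    intro z
    set w : EuclideanSpace ℝ ι := ∑ j, z j • (u j : EuclideanSpace ℝ ι) with hw
    have hwn : ∑ i, w i ^ 2 = ∑ j, z j ^ 2 := by
      have e1 : w = ((∑ j, z j • u j : W) : EuclideanSpace ℝ ι) := by
        rw [hw]; push_cast; rfl
      have e2 : ∑ i, w i ^ 2 = ‖w‖ ^ 2 := by
        rw [EuclideanSpace.norm_sq_eq]; simp
      rw [e2, e1, ← Submodule.coe_norm, ← u.sum_sq_norm_inner_right]
      refine Finset.sum_congr rfl fun j _ => ?_
      rw [u.orthonormal.inner_right_fintype, Real.norm_eq_abs, sq_abs]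
    have e3 : ∀ ω, ∑ j, (q * inner ℝ (u j : EuclideanSpace ℝ ι) (ev ω)) * z j =
        ∑ i, (q * w i) * E i ω := by
      intro ω
      have e4 : inner ℝ w (ev ω) = ∑ i, w i * E i ω := by
        simp [PiLp.inner_apply, hev, mul_comm]
      have e5 : inner ℝ w (ev ω) = ∑ j, z j * inner ℝ (u j : EuclideanSpace ℝ ι) (ev ω) := by
        rw [hw, sum_inner]; simp_rw [inner_smul_left]; simp
      calc _ = q * ∑ j, z j * inner ℝ (u j : EuclideanSpace ℝ ι) (ev ω) := by
            rw [Finset.mul_sum]; exact Finset.sum_congr rfl fun j _ => by ring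
        _ = _ := by
            rw [← e5, e4, Finset.mul_sum]; exact Finset.sum_congr rfl fun j _ => by ring
    simp_rw [e3]
    rw [lintegral_exp_linear hlaw hind]
    congr 2
    simp_rw [mul_pow]
    rw [← Finset.mul_sum, hwn, hq2]
    field_simp
  simp_rw [h2]
  rw [lintegral_exp_sum_sq one_ne_zero hzlaw hzind (by simp; linarith), Fintype.card_fin]
  congr 4
  simp; ring

/-- Chernoff's bound with parameter c = 1/2, half of the range in which the exponential moment is
finite. -/
theorem measure_le_norm_sq_starProjection (hv : v ≠ 0)
    (hlaw : ∀ i, HasLaw (E i) (gaussianReal 0 v) P)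
    (hind : iIndepFun E P) (W : Submodule ℝ (EuclideanSpace ℝ ι)) (h : ℝ) :
    P {ω | v * h ≤ ‖W.starProjection (WithLp.toLp 2 fun i => E i ω)‖ ^ 2} ≤
      ENNReal.ofReal (Real.exp (-h / 4) * √2 ^ Module.finrank ℝ W) := by
  have hv' : (0 : ℝ) < v := by positivity
  have hm := lintegral_exp_norm_sq_starProjection hv hlaw hind W (c := 1 / 2) (by norm_num)
    (by norm_num)
  have e1 : (√(1 - 1 / 2 : ℝ))⁻¹ = √2 := by rw [← Real.sqrt_inv]; norm_num
  rw [e1] at hm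
  have hE : ∀ i, AEMeasurable (E i) P := fun i => (hlaw i).aemeasurable
  have hev : AEMeasurable (fun ω => WithLp.toLp 2 fun i => E i ω) P :=
    (PiLp.continuous_toLp 2 _).measurable.comp_aemeasurable (aemeasurable_pi_lambda _ hE)
  have hmeas : AEMeasurable (fun ω => ENNReal.ofReal (Real.exp
        (1 / 2 / (2 * v) * ‖W.starProjection (WithLp.toLp 2 fun i => E i ω)‖ ^ 2))) P := by
    have hcont : Continuous fun x : EuclideanSpace ℝ ι => ENNReal.ofReal (Real.exp
        (1 / 2 / (2 * v) * ‖W.starProjection x‖ ^ 2)) := ENNReal.continuous_ofReal.comp (by fun_prop)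
    exact hcont.measurable.comp_aemeasurable hev
  have hmk := mul_meas_ge_le_lintegral₀ hmeas (ENNReal.ofReal (Real.exp (h / 4)))
  rw [hm] at hmk
  have hsub : {ω | v * h ≤ ‖W.starProjection (WithLp.toLp 2 fun i => E i ω)‖ ^ 2} ⊆
      {ω | ENNReal.ofReal (Real.exp (h / 4)) ≤ ENNReal.ofReal (Real.exp
        (1 / 2 / (2 * v) * ‖W.starProjection (WithLp.toLp 2 fun i => E i ω)‖ ^ 2))} := by
    intro ω hω
    refine ENNReal.ofReal_le_ofReal (Real.exp_le_exp.2 ?_)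
    have hω : v * h ≤ _ := hω
    calc h / 4 = 1 / 2 / (2 * v) * (v * h) := by field_simp; norm_num
      _ ≤ _ := by gcongr
  have h5 : ENNReal.ofReal (Real.exp (h / 4)) *
      P {ω | v * h ≤ ‖W.starProjection (WithLp.toLp 2 fun i => E i ω)‖ ^ 2} ≤
      ENNReal.ofReal (√2 ^ Module.finrank ℝ W) := le_trans (by gcongr) hmk
  rw [neg_div, Real.exp_neg, ENNReal.ofReal_mul (by positivity),
    ENNReal.ofReal_inv_of_pos (Real.exp_pos _), mul_comm _ (ENNReal.ofReal _),
    ← div_eq_mul_inv]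
  rw [ENNReal.le_div_iff_mul_le (Or.inl (by simp [Real.exp_pos])) (Or.inl ENNReal.ofReal_ne_top),
    mul_comm]
  exact h5

/-- Chernoff's bound for the lower tail, with the negative parameter -1/(20v). Any choice that makes
the base of the power smaller than 1 would do. -/
theorem measure_norm_sq_le (hv : v ≠ 0) (hlaw : ∀ i, HasLaw (E i) (gaussianReal 0 v) P)
    (hind : iIndepFun E P) :
    P {ω | ∑ i, E i ω ^ 2 ≤ 9 / 10 * Fintype.card ι * v} ≤
      ENNReal.ofReal ((Real.exp (9 / 200) / √(11 / 10)) ^ Fintype.card ι) := by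
  have hv' : (0 : ℝ) < v := by positivity
  set θ : ℝ := -(1 / (20 * v)) with hθ
  have h2θ : 2 * θ * v = -(1 / 10) := by rw [hθ]; field_simp; norm_num
  have hm := lintegral_exp_sum_sq hv hlaw hind (θ := θ) (by rw [h2θ]; norm_num)
  rw [h2θ, show (1 : ℝ) - -(1 / 10) = 11 / 10 by norm_num] at hm
  have hE : ∀ i, AEMeasurable (E i) P := fun i => (hlaw i).aemeasurable
  have hmeas : AEMeasurable (fun ω => ENNReal.ofReal (Real.exp (θ * ∑ i, E i ω ^ 2))) P :=
    (Real.measurable_exp.comp_aemeasurable ((Finset.aemeasurable_fun_sum _ fun i _ =>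
      (hE i).pow_const 2).const_mul θ)).ennreal_ofReal
  set N : ℝ := (Fintype.card ι : ℝ) with hN
  have hmk := mul_meas_ge_le_lintegral₀ hmeas (ENNReal.ofReal (Real.exp (-(9 / 200 * N))))
  rw [hm] at hmk
  have hsub : {ω | ∑ i, E i ω ^ 2 ≤ 9 / 10 * N * v} ⊆
      {ω | ENNReal.ofReal (Real.exp (-(9 / 200 * N))) ≤
        ENNReal.ofReal (Real.exp (θ * ∑ i, E i ω ^ 2))} := by
    intro ω hω
    refine ENNReal.ofReal_le_ofReal (Real.exp_le_exp.2 ?_)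
    have hω : _ ≤ 9 / 10 * N * v := hω
    rw [hθ, neg_mul, neg_le_neg_iff]
    calc 1 / (20 * v) * ∑ i, E i ω ^ 2 ≤ 1 / (20 * v) * (9 / 10 * N * v) := by gcongr
      _ = _ := by field_simp; ring
  have h5 := le_trans (mul_le_mul_right (measure_mono (μ := P) hsub) _) hmk
  have e : (Real.exp (9 / 200) / √(11 / 10)) ^ Fintype.card ι =
      (√(11 / 10))⁻¹ ^ Fintype.card ι * Real.exp (9 / 200 * N) := by
    rw [div_pow, ← Real.exp_nat_mul, inv_pow, div_eq_mul_inv, mul_comm (9 / 200) N, hN]; ring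
  rw [e]
  rw [mul_comm, ← ENNReal.le_div_iff_mul_le (Or.inl (by simp [Real.exp_pos]))
    (Or.inl ENNReal.ofReal_ne_top), ← ENNReal.ofReal_div_of_pos (Real.exp_pos _),
    Real.exp_neg, div_inv_eq_mul] at h5
  exact h5

end Gaussian

/-! ### Marginal densities in terms of residual sums of squares -/

section Marginals

variable {n p r : ℕ} {α₁ α₂ a₁ a₂ ε : ℝ} {X : Matrix (Fin n) (Fin p) ℝ}
  {A : Matrix (Fin p) (Fin p) ℝ}

theorem sq_le_of_leastSquares {k : Finset (Fin p)} (hX : DesignBound X ε k) (hnε : 0 < n * ε)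
    {b : k → ℝ} {v : EuclideanSpace ℝ (Fin n)} (hb : WithLp.toLp 2 (designSub X k *ᵥ b) = v)
    (i : k) : b i ^ 2 ≤ ‖v‖ ^ 2 / (n * ε) := by
  have h1 := (hX b).1
  rw [dotProduct_self_eq_norm_sq (designSub X k *ᵥ b), hb] at h1
  have h2 : b i ^ 2 ≤ b ⬝ᵥ b := by
    rw [sq]
    exact Finset.single_le_sum (f := fun i => b i * b i) (fun i _ => mul_self_nonneg _)
      (Finset.mem_univ i)
  rw [le_div_iff₀ hnε]
  nlinarith

/-- The factor common to the bounds for all marginal densities. -/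
noncomputable def commonFactor (n : ℕ) (α₁ α₂ : ℝ) : ℝ :=
  (2 * Real.pi) ^ (-((n : ℝ) / 2)) * (α₂ ^ α₁ / Real.Gamma α₁) * Real.Gamma (n / 2 + α₁)

theorem commonFactor_pos (n : ℕ) (hα₁ : 0 < α₁) (hα₂ : 0 < α₂) : 0 < commonFactor n α₁ α₂ := by
  have h1 : 0 < Real.Gamma α₁ := Real.Gamma_pos_of_pos hα₁
  have h2 : 0 < Real.Gamma (n / 2 + α₁) := Real.Gamma_pos_of_pos (by positivity)
  unfold commonFactor
  positivity

/-- With x = n, the first factor is the contribution of the prior of τ and the second that of the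
Gaussian integral; together they are the penalty per variable. -/
theorem rpow_neg_half_mul_sqrt {x : ℝ} (hx : 0 < x) (r : ℕ) :
    x ^ (-(r + 1 / 2 : ℝ)) * (√x)⁻¹ = (x ^ (r + 1))⁻¹ := by
  rw [Real.rpow_neg hx.le, ← mul_inv, Real.sqrt_eq_rpow, ← Real.rpow_add hx, ← Real.rpow_natCast]
  congr 2; push_cast; ring

/-- The least squares coefficients satisfy b_i² ≤ (1 + M) ε^(-2), so each moment of order 2r costs
ε^(-2r), and the factor (√ε)⁻¹ of the Gaussian integral is rounded up to ε⁻¹. -/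
theorem marginal_le_rss (hn : 1 ≤ n) (hr : 1 ≤ r) (hα₁ : 0 < α₁) (hα₂ : 0 < α₂) (ha₁ : 0 < a₁)
    (ha₂ : 0 < a₂) (hA : QuadBound A a₁ a₂) {k : Finset (Fin p)} {y : Fin n → ℝ}
    (hε0 : 0 < ε) (hε1 : ε < 1) (hε : 1 ≤ n * ε) (hX : DesignBound X ε k) {M : ℝ} (hM : 0 ≤ M)
    (hy : ‖WithLp.toLp 2 y‖ ^ 2 ≤ n * ε⁻¹ * M)
    (hS : 0 < rss X k (WithLp.toLp 2 y) / 2 + α₂ - r * k.card) :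
    marginal r α₁ α₂ X A k y ≤ ENNReal.ofReal (commonFactor n α₁ α₂ * √2 *
      (upperConst r a₂ * (1 + M) ^ r * (k.card : ℝ) ^ (r + 1 / 2 : ℝ) * (ε⁻¹) ^ (2 * r + 1) /
        n ^ (r + 1)) ^ k.card *
      (rss X k (WithLp.toLp 2 y) / 2 + α₂ - r * k.card) ^ (-(n / 2 + α₁))) := by
  have hn0 : (0 : ℝ) < n := by exact_mod_cast hn
  obtain ⟨b, hb, hLS⟩ := exists_leastSquares (X := X) k y
  have hε' : 1 ≤ ε⁻¹ := (one_le_inv₀ hε0).2 hε1.le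
  have hb2 : ∀ i, b i ^ 2 ≤ (1 + M) * (ε⁻¹) ^ 2 := fun i => by
    refine (sq_le_of_leastSquares hX (by positivity) hb i).trans ?_
    have h1 : ‖(colSpace X k).starProjection (WithLp.toLp 2 y)‖ ^ 2 ≤ n * ε⁻¹ * M :=
      (pow_le_pow_left₀ (norm_nonneg _) (Submodule.norm_starProjection_apply_le _ _) 2).trans hy
    rw [div_le_iff₀ (by positivity)]
    calc _ ≤ _ := h1
      _ ≤ n * ε⁻¹ * (1 + M) := by gcongr; linarith
      _ = _ := by field_simp
  have hM1 : 1 ≤ (1 + M) * (ε⁻¹) ^ 2 :=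
    one_le_mul_of_one_le_of_one_le (by linarith) (one_le_pow₀ hε')
  refine (marginal_le hn hr hα₁ hα₂ ha₁ ha₂ hA b hε hM1 hb2 (fun β => (hX β).1) hLS hS).trans
    (ENNReal.ofReal_le_ofReal ?_)
  have hup := upperConst_pos r ha₂
  have hcf := commonFactor_pos n hα₁ hα₂
  rw [← commonFactor]
  gcongr ?_ * ?_ ^ k.card * ?_
  have hsq : (√ε)⁻¹ ≤ ε⁻¹ := by
    gcongr
    exact Real.le_sqrt_of_sq_le (by nlinarith)
  calc _ = upperConst r a₂ * (1 + M) ^ r * (k.card : ℝ) ^ (r + 1 / 2 : ℝ) * ((ε⁻¹) ^ (2 * r) *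
        (√ε)⁻¹) * ((n : ℝ) ^ (-(r + 1 / 2 : ℝ)) * (√n)⁻¹) := by
        rw [Real.sqrt_mul hn0.le, mul_pow, mul_inv, ← pow_mul]; ring
    _ ≤ upperConst r a₂ * (1 + M) ^ r * (k.card : ℝ) ^ (r + 1 / 2 : ℝ) * ((ε⁻¹) ^ (2 * r) *
        ε⁻¹) * ((n : ℝ) ^ (-(r + 1 / 2 : ℝ)) * (√n)⁻¹) := by gcongr
    _ = _ := by rw [rpow_neg_half_mul_sqrt hn0, pow_succ (ε⁻¹)]; ring

/-- A constant in the lower bound for the marginal density of the true model. -/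
noncomputable def lowerConst (r : ℕ) (a₁ bm h : ℝ) : ℝ :=
  (∫ x : ℝ, Real.exp (-(a₁ / 2) * x ^ 2) * x ^ (2 * r))⁻¹ * (bm / 2) ^ (2 * r) *
    2 ^ (-(r + 1 / 2 : ℝ)) * 2 * (1 / (2 * h)) ^ (r + 1 / 2 : ℝ)

theorem lowerConst_pos (r : ℕ) {bm h : ℝ} (ha₁ : 0 < a₁) (hbm : 0 < bm) (hh : 0 < h) :
    0 < lowerConst r a₁ bm h := by
  have := integral_exp_neg_sq_mul_pow_pos r ha₁
  unfold lowerConst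
  positivity

/-- The estimate is within √(g/(nε)) of the truth, so the whole box lies within bm/2 of it. In the
box each coordinate is at least bm/2 and at most 3/2 of the true one in absolute value; the latter
squared gives the factor 9/4. -/
theorem le_marginal_rss (hn : 1 ≤ n) (hr : 1 ≤ r) (hα₁ : 0 < α₁) (hα₂ : 0 < α₂) (ha₁ : 0 < a₁)
    (ha₂ : 0 < a₂) (hA : QuadBound A a₁ a₂) {t : Finset (Fin p)} {x : Fin p → ℝ}
    {e : Fin n → ℝ} (hε0 : 0 < ε) (hX : DesignBound X ε t)
    (hx0 : ∀ j ∉ t, x j = 0) {bm B : ℝ} (hbm : 0 < bm) (hxb : ∀ j ∈ t, bm ≤ |x j|)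
    (hB : x ⬝ᵥ x ≤ B) {g : ℝ} (hg : ‖(colSpace X t).starProjection (WithLp.toLp 2 e)‖ ^ 2 ≤ g)
    (hbox : √(g / (n * ε)) + √(ε / n) ≤ bm / 2) {H h : ℝ}
    (hH : H = (rss X t (WithLp.toLp 2 (X *ᵥ x + e)) + t.card + a₂ * (9 / 4 * B)) / 2 + α₂)
    (hHh : H ≤ h * n) :
    ENNReal.ofReal (commonFactor n α₁ α₂ * (Real.exp (-(1 / 2)) / (4 * Real.Gamma (1 / 2))) *
      (lowerConst r a₁ bm h * √ε / n ^ (r + 1)) ^ t.card * H ^ (-(n / 2 + α₁))) ≤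
      marginal r α₁ α₂ X A t (X *ᵥ x + e) := by
  have hn0 : (0 : ℝ) < n := by exact_mod_cast hn
  obtain ⟨b, hb, hLS⟩ := exists_leastSquares (X := X) t (X *ᵥ x + e)
  have hB0 : 0 ≤ B := le_trans (Finset.sum_nonneg fun i _ => mul_self_nonneg _) hB
  have hclose : ∀ i : t, |b i - x i| ≤ √(g / (n * ε)) := by
    intro i
    have hmem : WithLp.toLp 2 (X *ᵥ x) ∈ colSpace X t := toLp_mulVec_mem_colSpace hx0
    have hb' : WithLp.toLp 2 (designSub X t *ᵥ (b - fun i : t => x i)) =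
        (colSpace X t).starProjection (WithLp.toLp 2 e) := by
      rw [Matrix.mulVec_sub, WithLp.toLp_sub, hb, designSub_mulVec_restrict hx0, WithLp.toLp_add,
        map_add, (colSpace X t).starProjection_eq_self_iff.2 hmem, add_sub_cancel_left]
    have h1 := sq_le_of_leastSquares hX (by positivity) hb' i
    refine Real.abs_le_sqrt (h1.trans ?_)
    gcongr
  have hcg := integral_exp_neg_sq_mul_pow_pos r ha₁
  have hbox' : ∀ β : t → ℝ, (∀ i, |β i - b i| ≤ √(ε / n)) →
      (∀ i, (bm / 2) ^ (2 * r) ≤ β i ^ (2 * r)) ∧ β ⬝ᵥ β ≤ 9 / 4 * B := by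
    intro β hβ
    have hd : ∀ i : t, |β i - x i| ≤ bm / 2 := fun i => by
      calc |β i - x i| ≤ |β i - b i| + |b i - x i| := abs_sub_le _ _ _
        _ ≤ _ := by linarith [hβ i, hclose i]
    constructor
    · intro i
      have h1 : bm / 2 ≤ |β i| := by
        have := abs_sub_abs_le_abs_sub (x i) (β i)
        rw [abs_sub_comm] at this
        linarith [hd i, hxb i i.2]
      rw [pow_mul, pow_mul, ← sq_abs (β i)]
      gcongr
    · have h2 : ∀ i : t, β i * β i ≤ 9 / 4 * (x i * x i) := fun i => by
        have h3 : |β i| ≤ 3 / 2 * |x i| := by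
          have := abs_sub_abs_le_abs_sub (β i) (x i)
          linarith [hd i, hxb i i.2]
        have := mul_self_le_mul_self (abs_nonneg _) h3
        rw [abs_mul_abs_self] at this
        nlinarith [abs_mul_abs_self (x i)]
      calc β ⬝ᵥ β ≤ ∑ i : t, 9 / 4 * (x i * x i) := Finset.sum_le_sum fun i _ => h2 i
        _ = 9 / 4 * ∑ i : t, x i * x i := by rw [Finset.mul_sum]
        _ ≤ 9 / 4 * B := by
          gcongr
          refine le_trans ?_ hB
          rw [Finset.sum_coe_sort t (fun i => x i * x i)]
          exact Finset.sum_le_sum_of_subset_of_nonneg (Finset.subset_univ _)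
            fun i _ _ => mul_self_nonneg _
  have hrss := rss_nonneg (X := X) t (WithLp.toLp 2 (X *ᵥ x + e))
  have hH0 : 0 < H := by rw [hH]; positivity
  have hh0 : 0 < h := by
    by_contra hcon
    nlinarith
  refine le_trans (ENNReal.ofReal_le_ofReal ?_)
    (le_marginal hn hr hα₁ hα₂ ha₁ ha₂ hA b hε0 hrss
    (by positivity : 0 < (bm / 2) ^ (2 * r)) (by positivity : 0 ≤ 9 / 4 * B) hbox'
    (fun β => (hX β).2) hLS hH)
  have hcf := commonFactor_pos n hα₁ hα₂
  have hlow := lowerConst_pos r ha₁ hbm hh0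
  have hG : 0 < Real.Gamma (1 / 2) := Real.Gamma_pos_of_pos (by norm_num)
  rw [← commonFactor]
  gcongr ?_ * ?_ ^ t.card * ?_
  have hNH : 1 / (2 * h) ≤ (n / 2 + α₁) / H := by
    rw [div_le_div_iff₀ (by positivity) hH0]
    nlinarith
  calc _ = (∫ x : ℝ, Real.exp (-(a₁ / 2) * x ^ 2) * x ^ (2 * r))⁻¹ * (bm / 2) ^ (2 * r) *
        (2 * n : ℝ) ^ (-(r + 1 / 2 : ℝ)) * (2 * √(ε / n)) *
        (1 / (2 * h)) ^ (r + 1 / 2 : ℝ) := by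
        rw [lowerConst, Real.mul_rpow (by norm_num) hn0.le, Real.sqrt_div hε0.le,
          div_eq_mul_inv _ ((n : ℝ) ^ (r + 1)), ← rpow_neg_half_mul_sqrt hn0]
        ring
    _ ≤ _ := by gcongr

end Marginals

/-! ### Ratios of marginal densities -/

theorem eventually_mul_le_nhdsGT (C : ℝ) {c : ℝ} (hc : 0 < c) : ∀ᶠ δ in 𝓝[>] (0 : ℝ), C * δ ≤ c := by
  have h : Tendsto (fun δ : ℝ => C * δ) (𝓝[>] 0) (𝓝 (C * 0)) :=
    (tendsto_id.const_mul C).mono_left nhdsWithin_le_nhds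
  rw [mul_zero] at h
  exact h.eventually_le_const hc

theorem div_rpow_le_exp {H S N : ℝ} (hH : 0 ≤ H) (hS : 0 < S) (hN : 0 ≤ N) :
    (H / S) ^ N ≤ Real.exp (N / S * (H - S)) := by
  have h1 : H / S ≤ Real.exp ((H - S) / S) := by
    have := Real.add_one_le_exp ((H - S) / S)
    rwa [sub_div, div_self hS.ne', sub_add_cancel, ← div_self hS.ne', ← sub_div] at this
  calc (H / S) ^ N ≤ (Real.exp ((H - S) / S)) ^ N := Real.rpow_le_rpow (by positivity) h1 hN
    _ = _ := by rw [← Real.exp_mul]; congr 1; field_simp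

/-- The part of the bound for a ratio of marginal densities that does not depend on the data. -/
noncomputable def ratioWeight (r : ℕ) (C D : ℝ) (T : ℕ) (n : ℕ) (ε : ℝ) (K : ℕ) : ℝ :=
  C * (n ^ (r + 1) * ε⁻¹) ^ T *
    (D * (K : ℝ) ^ (r + 1 / 2 : ℝ) * (ε⁻¹) ^ (2 * r + 1) / n ^ (r + 1)) ^ K

/-- Division of the upper bound for a model by the lower bound for the true one. The factor √ε of
the lower bound is replaced by the smaller ε, so that only integer powers of ε⁻¹ remain. -/
theorem upper_le_ratioWeight_mul_lower {r n T K : ℕ} {ε V κ lc Du C₆ H S N F : ℝ}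
    (hn0 : (0 : ℝ) < n) (hε0 : 0 < ε) (hε1 : ε < 1) (hV : 0 ≤ V) (hκ : 0 < κ) (hlc : 0 < lc)
    (hDu : 0 ≤ Du) (hH0 : 0 < H) (hS : 0 < S) (hF : 0 ≤ F)
    (hHS : (H / S) ^ N ≤ Real.exp (C₆ * (1 + K)) * F) :
    V * √2 * (Du * (K : ℝ) ^ (r + 1 / 2 : ℝ) * (ε⁻¹) ^ (2 * r + 1) / n ^ (r + 1)) ^ K *
      S ^ (-N) ≤
    ratioWeight r (√2 / κ * Real.exp C₆ * (lc⁻¹) ^ T) (Du * Real.exp C₆) T n ε K * F *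
      (V * κ * (lc * √ε / n ^ (r + 1)) ^ T * H ^ (-N)) := by
  have hsq : ε ≤ √ε := Real.le_sqrt_of_sq_le (by nlinarith)
  have e1 : S ^ (-N) = (H / S) ^ N * H ^ (-N) := by
    rw [Real.div_rpow hH0.le hS.le, Real.rpow_neg hS.le, Real.rpow_neg hH0.le]
    have : H ^ N ≠ 0 := (Real.rpow_pos_of_pos hH0 N).ne'
    field_simp
  have e2 : Real.exp (C₆ * (1 + K)) = Real.exp C₆ * Real.exp C₆ ^ K := by
    rw [← Real.exp_nat_mul, ← Real.exp_add]; congr 1; ring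
  have e5 : 1 ≤ (ε⁻¹ * √ε) ^ T := by
    refine one_le_pow₀ ?_
    rw [inv_mul_eq_div, le_div_iff₀ hε0]; linarith
  have hprod : (lc⁻¹) ^ T * (n ^ (r + 1) * ε⁻¹) ^ T * (lc * √ε / n ^ (r + 1)) ^ T =
      (ε⁻¹ * √ε) ^ T := by
    rw [← mul_pow, ← mul_pow]; congr 1; field_simp
  have e4 : Du * Real.exp C₆ * (K : ℝ) ^ (r + 1 / 2 : ℝ) * (ε⁻¹) ^ (2 * r + 1) /
      n ^ (r + 1) = Real.exp C₆ *
        (Du * (K : ℝ) ^ (r + 1 / 2 : ℝ) * (ε⁻¹) ^ (2 * r + 1) / n ^ (r + 1)) := by ring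
  rw [ratioWeight, e4, e1, mul_pow (Real.exp C₆)]
  have hb0 : 0 ≤ Du * (K : ℝ) ^ (r + 1 / 2 : ℝ) * (ε⁻¹) ^ (2 * r + 1) / n ^ (r + 1) := by
    positivity
  generalize Du * (K : ℝ) ^ (r + 1 / 2 : ℝ) * (ε⁻¹) ^ (2 * r + 1) / n ^ (r + 1) = b at hb0 ⊢
  have hHN : 0 < H ^ (-N) := Real.rpow_pos_of_pos hH0 _
  have hstep : 0 ≤ V * √2 * b ^ K * ((Real.exp C₆ * Real.exp C₆ ^ K * F) * H ^ (-N)) := by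
    positivity
  calc V * √2 * b ^ K * ((H / S) ^ N * H ^ (-N))
      ≤ V * √2 * b ^ K * ((Real.exp C₆ * Real.exp C₆ ^ K * F) * H ^ (-N)) := by
        rw [← e2]; gcongr
    _ ≤ V * √2 * b ^ K * ((Real.exp C₆ * Real.exp C₆ ^ K * F) * H ^ (-N)) *
        (ε⁻¹ * √ε) ^ T := le_mul_of_one_le_right hstep e5
    _ = √2 * Real.exp C₆ * (Real.exp C₆ ^ K * b ^ K) * F * V * H ^ (-N) *
        ((lc⁻¹) ^ T * (n ^ (r + 1) * ε⁻¹) ^ T * (lc * √ε / n ^ (r + 1)) ^ T) * (κ / κ) := by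
        rw [hprod, div_self hκ.ne']; ring
    _ = _ := by ring

theorem norm_add_sq_le {E : Type*} [SeminormedAddCommGroup E] (u v : E) :
    ‖u + v‖ ^ 2 ≤ 2 * ‖u‖ ^ 2 + 2 * ‖v‖ ^ 2 := by
  have h := pow_le_pow_left₀ (norm_nonneg _) (norm_add_le u v) 2
  linarith [sq_nonneg (‖u‖ - ‖v‖)]

theorem ratioWeight_nonneg {r T n K : ℕ} {C D ε : ℝ} (hC : 0 ≤ C) (hD : 0 ≤ D) (hε : 0 ≤ ε) :
    0 ≤ ratioWeight r C D T n ε K := by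
  unfold ratioWeight; positivity

set_option maxHeartbeats 1000000 in
/-- Bounds for the ratio of the marginal density of a model to that of the true model, valid
whenever the error vector is typical. -/
theorem exists_ratio_bound {r : ℕ} (hr : 1 ≤ r) {α₁ α₂ a₁ a₂ v bm B : ℝ} (hα₁ : 0 < α₁)
    (hα₂ : 0 < α₂) (ha₁ : 0 < a₁) (ha₂ : 0 < a₂) (hv : 0 < v) (hbm : 0 < bm) (hB0 : 0 ≤ B)
    (T : ℕ) :
    ∃ C D c δ : ℝ, 0 < C ∧ 0 < D ∧ 0 < c ∧ 0 < δ ∧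
      ∀ {n p q : ℕ} {X : Matrix (Fin n) (Fin p) ℝ} {A : Matrix (Fin p) (Fin p) ℝ} {ε h : ℝ}
        {t : Finset (Fin p)} {x : Fin p → ℝ} {e : Fin n → ℝ},
        1 ≤ n → QuadBound A a₁ a₂ → 0 < ε → ε < 1 → t.card = T → T ≤ q →
        (∀ k : Finset (Fin p), k.card ≤ q + T → DesignBound X ε k) →
        (∀ j ∉ t, x j = 0) → (∀ j ∈ t, bm ≤ |x j|) → x ⬝ᵥ x ≤ B →
        0 ≤ h → h + q + 1 ≤ δ * (n * ε) →
        ‖WithLp.toLp 2 e‖ ^ 2 ≤ 4 * n * v → 9 / 10 * n * v ≤ ‖WithLp.toLp 2 e‖ ^ 2 →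
        (∀ k : Finset (Fin p), k.card ≤ q →
          ‖(colSpace X (k ∪ t)).starProjection (WithLp.toLp 2 e)‖ ^ 2 ≤ v * h) →
        0 < marginal r α₁ α₂ X A t (X *ᵥ x + e) ∧ marginal r α₁ α₂ X A t (X *ᵥ x + e) < ∞ ∧
        ∀ k : Finset (Fin p), k.card ≤ q →
          (t ⊆ k → marginal r α₁ α₂ X A k (X *ᵥ x + e) ≤
            ENNReal.ofReal (ratioWeight r C D T n ε k.card * Real.exp (7 / (12 * v) *
              ‖(extraSpace X t k).starProjection (WithLp.toLp 2 e)‖ ^ 2)) *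
              marginal r α₁ α₂ X A t (X *ᵥ x + e)) ∧
          (¬ t ⊆ k → marginal r α₁ α₂ X A k (X *ᵥ x + e) ≤
            ENNReal.ofReal (ratioWeight r C D T n ε k.card * Real.exp (-(c * (n * ε ^ 2)))) *
              marginal r α₁ α₂ X A t (X *ᵥ x + e)) := by
  -- The roles of the constants: ‖y‖² ≤ n M/ε, H ≤ hc n, H - S_k ≤ (R_t - R_k)/2 + C₅ (1 + |k|), S_k
  -- ≤ n C₇/ε, and C₆ is C₅ times the bound 7/(6v) for N/S_k.
  set M : ℝ := 2 * B + 8 * v with hM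
  set hc : ℝ := (4 * v + T + a₂ * (9 / 4 * B)) / 2 + α₂ with hhc
  set C₅ : ℝ := (T + a₂ * (9 / 4 * B)) / 2 + r with hC₅
  set C₆ : ℝ := 7 / 6 / v * C₅ with hC₆
  set C₇ : ℝ := M / 2 + α₂ with hC₇
  set κ : ℝ := Real.exp (-(1 / 2)) / (4 * Real.Gamma (1 / 2)) with hκ
  have hG : 0 < Real.Gamma (1 / 2) := Real.Gamma_pos_of_pos (by norm_num)
  have hκ0 : 0 < κ := by positivity
  have hM0 : 0 < M := by positivity
  have hhc0 : 0 < hc := by positivity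
  have hC₅0 : 0 < C₅ := by positivity
  have hC₆0 : 0 < C₆ := by positivity
  have hC₇0 : 0 < C₇ := by positivity
  set lc := lowerConst r a₁ bm hc with hlc
  have hlc0 : 0 < lc := lowerConst_pos r ha₁ hbm hhc0
  set Du := upperConst r a₂ * (1 + M) ^ r with hDu
  have hDu0 : 0 < Du := by have := upperConst_pos r ha₂; positivity
  clear_value M hc C₅ C₆ C₇ κ lc Du
  -- The smallness of δ makes, in this order: nε ≥ 1; the box narrow; the least squares error of the
  -- true model small, like the noise compared with the signal; S_k close to R_k/2; N close to n/2;
  -- and the terms C₅ (1 + |k|) negligible against the signal.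
  obtain ⟨δ, ⟨⟨⟨⟨⟨hδ1, hδ2⟩, hδ3⟩, hδ4⟩, hδ5⟩, hδ6⟩, hδ0⟩ :=
    ((((((eventually_mul_le_nhdsGT 1 one_pos).and
      (eventually_mul_le_nhdsGT 1 (by positivity : 0 < (bm / 4) ^ 2))).and
      (eventually_mul_le_nhdsGT v (by positivity : 0 < (bm / 4) ^ 2))).and
      (eventually_mul_le_nhdsGT (v + 2 * r) (by positivity : 0 < v / 50))).and
      (eventually_mul_le_nhdsGT α₁ (by positivity : (0 : ℝ) < 1 / 100))).and
      (eventually_mul_le_nhdsGT C₅ (by positivity : 0 < bm ^ 2 / 8))).and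
      self_mem_nhdsWithin |>.exists
  have hδ0 : 0 < δ := hδ0
  rw [one_mul] at hδ1 hδ2
  refine ⟨√2 / κ * Real.exp C₆ * (lc⁻¹) ^ T, Du * Real.exp C₆, bm ^ 2 / (16 * C₇), δ,
    by positivity, by positivity, by positivity, hδ0, ?_⟩
  intro n p q X A ε h t x e hn hA hε0 hε1 htT hTq hdes hx0 hxb hxB hh0 hδ hE1 hE2 hE3
  have hn0 : (0 : ℝ) < n := by exact_mod_cast hn
  set y := X *ᵥ x + e with hy
  set ev := WithLp.toLp 2 e with hev
  set μ := WithLp.toLp 2 (X *ᵥ x) with hμ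
  have hyev : WithLp.toLp 2 y = μ + ev := by rw [hy, WithLp.toLp_add]
  have hq0 : (0 : ℝ) ≤ q := Nat.cast_nonneg q
  have hnε0 : 0 < n * ε := by positivity
  have hnεn : n * ε ≤ n := mul_le_of_le_one_right hn0.le hε1.le
  have hnε1 : 1 ≤ n * ε :=
    le_trans (by linarith) (mul_le_of_le_one_left hnε0.le hδ1)
  have hδn : h + q + 1 ≤ δ * n := hδ.trans (by gcongr)
  have hε' : 1 ≤ ε⁻¹ := (one_le_inv₀ hε0).2 hε1.le
  have hdest : DesignBound X ε t := hdes t (by omega)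
  have hμt : μ ∈ colSpace X t := toLp_mulVec_mem_colSpace hx0
  -- size of the data vector
  have hynorm : ‖WithLp.toLp 2 y‖ ^ 2 ≤ n * ε⁻¹ * M := by
    have h1 : ‖μ‖ ^ 2 ≤ n * ε⁻¹ * B := by
      have h2 := (hdest (fun i : t => x i)).2
      rw [designSub_mulVec_restrict hx0, dotProduct_self_eq_norm_sq (X *ᵥ x)] at h2
      refine h2.trans ?_
      gcongr
      rw [← extendZero_dotProduct_self, extendZero_restrict hx0]
      exact hxB
    have h3 : ‖μ + ev‖ ^ 2 ≤ 2 * ‖μ‖ ^ 2 + 2 * ‖ev‖ ^ 2 := norm_add_sq_le μ ev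
    have h5 : 8 * n * v ≤ n * ε⁻¹ * (8 * v) := by
      have : n * v ≤ n * ε⁻¹ * v := by
        rw [mul_assoc, mul_comm ε⁻¹ v]
        gcongr
        exact le_mul_of_one_le_right hv.le hε'
      linarith
    rw [hyev]
    calc _ ≤ _ := h3
      _ ≤ 2 * (n * ε⁻¹ * B) + 2 * (4 * n * v) := by gcongr
      _ ≤ n * ε⁻¹ * M := by rw [hM]; linarith
  -- residual sums of squares
  set R := fun k => rss X k (WithLp.toLp 2 y) with hR
  have hRlow : ∀ k : Finset (Fin p), k.card ≤ q → 9 / 10 * n * v - v * h ≤ R k := by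
    intro k hk
    have h1 : R (k ∪ t) ≤ R k := rss_anti Finset.subset_union_left _
    have h2 : R (k ∪ t) = ‖ev‖ ^ 2 - ‖(colSpace X (k ∪ t)).starProjection ev‖ ^ 2 := by
      rw [hR]; simp only; rw [hyev]
      exact rss_eq_sub (colSpace_mono Finset.subset_union_right hμt) ev
    have h3 := hE3 k hk
    linarith
  set S := fun k : Finset (Fin p) => R k / 2 + α₂ - r * k.card with hS
  -- 0.44 is half of 0.9 minus 1/100, where 1/100 pays for the projected errors and for r|k|.
  have hSlow : ∀ k : Finset (Fin p), k.card ≤ q → 44 / 100 * n * v ≤ S k := by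
    intro k hk
    have h1 := hRlow k hk
    have h2 : (k.card : ℝ) ≤ q := by exact_mod_cast hk
    have h3 : v * h + 2 * r * k.card ≤ v / 50 * n := by
      calc v * h + 2 * r * k.card ≤ (v + 2 * r) * (h + q + 1) := by
            have h4 : (0 : ℝ) ≤ r := Nat.cast_nonneg r
            have h5 : (r : ℝ) * k.card ≤ r * q := mul_le_mul_of_nonneg_left h2 h4
            linarith [mul_nonneg hv.le hq0, mul_nonneg h4 hh0]
        _ ≤ (v + 2 * r) * (δ * n) := by gcongr
        _ = (v + 2 * r) * δ * n := by ring
        _ ≤ _ := by gcongr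
    simp only [hS]
    linarith
  have hSpos : ∀ k : Finset (Fin p), k.card ≤ q → 0 < S k := fun k hk =>
    lt_of_lt_of_le (by positivity) (hSlow k hk)
  have htq : t.card ≤ q := by omega
  set H := (R t + t.card + a₂ * (9 / 4 * B)) / 2 + α₂ with hH
  have hRt0 : 0 ≤ R t := rss_nonneg _ _
  have hH0 : 0 < H := by positivity
  have hRt : R t = ‖ev‖ ^ 2 - ‖(colSpace X t).starProjection ev‖ ^ 2 := by
    rw [hR]; simp only; rw [hyev]; exact rss_eq_sub hμt ev
  have hHh : H ≤ hc * n := by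
    have h1 : R t ≤ 4 * n * v := by
      rw [hRt]; linarith [sq_nonneg ‖(colSpace X t).starProjection ev‖]
    have h2 : (1 : ℝ) ≤ n := by exact_mod_cast hn
    have h3 : t.card + a₂ * (9 / 4 * B) + 2 * α₂ ≤ (t.card + a₂ * (9 / 4 * B) + 2 * α₂) * n :=
      le_mul_of_one_le_right (by positivity) h2
    rw [hH, hhc, ← htT]
    linarith
  set N : ℝ := n / 2 + α₁ with hN
  have hN0 : 0 < N := by positivity
  -- lower bound for the true model
  have hlow : ENNReal.ofReal (commonFactor n α₁ α₂ * κ * (lc * √ε / n ^ (r + 1)) ^ T *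
      H ^ (-N)) ≤ marginal r α₁ α₂ X A t y := by
    have hbox : √(v * h / (n * ε)) + √(ε / n) ≤ bm / 2 := by
      have h1 : √(v * h / (n * ε)) ≤ bm / 4 := by
        refine Real.sqrt_le_iff.2 ⟨by positivity, ?_⟩
        rw [div_le_iff₀ hnε0]
        calc v * h ≤ v * (δ * (n * ε)) := by gcongr; linarith
          _ = v * δ * (n * ε) := by ring
          _ ≤ _ := by gcongr
      have h2 : √(ε / n) ≤ bm / 4 := by
        refine Real.sqrt_le_iff.2 ⟨by positivity, ?_⟩
        rw [div_le_iff₀ hn0]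
        calc ε ≤ 1 := hε1.le
          _ ≤ δ * n := by linarith
          _ ≤ _ := by gcongr
      linarith
    have hg : ‖(colSpace X t).starProjection ev‖ ^ 2 ≤ v * h := by
      have := hE3 ∅ (by simp)
      rwa [Finset.empty_union] at this
    have := le_marginal_rss hn hr hα₁ hα₂ ha₁ ha₂ hA hε0 hdest hx0 hbm hxb hxB hg hbox hH hHh
    rwa [htT, ← hκ, ← hlc] at this
  have hcf := commonFactor_pos n hα₁ hα₂
  have hLpos : 0 < commonFactor n α₁ α₂ * κ * (lc * √ε / n ^ (r + 1)) ^ T * H ^ (-N) := by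
    have := Real.sqrt_pos.2 hε0
    positivity
  have hup : ∀ k : Finset (Fin p), k.card ≤ q → marginal r α₁ α₂ X A k y ≤
      ENNReal.ofReal (commonFactor n α₁ α₂ * √2 *
      (Du * (k.card : ℝ) ^ (r + 1 / 2 : ℝ) * (ε⁻¹) ^ (2 * r + 1) / n ^ (r + 1)) ^ k.card *
      S k ^ (-N)) := fun k hk => by
    rw [hDu]
    exact marginal_le_rss hn hr hα₁ hα₂ ha₁ ha₂ hA hε0 hε1 hnε1 (hdes k (by omega)) hM0.le hynorm (hSpos k hk)
  have key : ∀ k : Finset (Fin p), k.card ≤ q → ∀ F : ℝ, 0 ≤ F →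
      (H / S k) ^ N ≤ Real.exp (C₆ * (1 + k.card)) * F →
      marginal r α₁ α₂ X A k y ≤ ENNReal.ofReal (ratioWeight r (√2 / κ * Real.exp C₆ * (lc⁻¹) ^ T)
        (Du * Real.exp C₆) T n ε k.card * F) * marginal r α₁ α₂ X A t y := by
    intro k hk F hF hHS
    refine (hup k hk).trans (le_trans ?_ (mul_le_mul_right hlow _))
    have hSk := hSpos k hk
    have hw : 0 ≤ ratioWeight r (√2 / κ * Real.exp C₆ * (lc⁻¹) ^ T)
        (Du * Real.exp C₆) T n ε k.card :=
      ratioWeight_nonneg (by positivity) (by positivity) hε0.le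
    rw [← ENNReal.ofReal_mul (mul_nonneg hw hF)]
    refine ENNReal.ofReal_le_ofReal ?_
    exact upper_le_ratioWeight_mul_lower hn0 hε0 hε1 hcf.le hκ0 hlc0 hDu0.le hH0 hSk hF hHS
  have hHS : ∀ k : Finset (Fin p), H - S k ≤ (R t - R k) / 2 + C₅ * (1 + k.card) := by
    intro k
    simp only [hS, hH, hC₅, htT]
    have : (0 : ℝ) ≤ k.card := Nat.cast_nonneg _
    have h1 : 0 ≤ ((T : ℝ) + a₂ * (9 / 4 * B)) / 2 * k.card := by positivity
    have h2 : (0 : ℝ) ≤ r := Nat.cast_nonneg r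
    linarith
  -- N ≤ 0.51 n and S_k ≥ 0.44 n v, and 0.51/0.44 < 7/6. That 7/6 is below 4/3 is what later leaves
  -- a finite exponential moment for the power 3/4.
  have hNS : ∀ k : Finset (Fin p), k.card ≤ q → N / S k ≤ 7 / 6 / v := by
    intro k hk
    rw [div_div, div_le_div_iff₀ (hSpos k hk) (by positivity)]
    have h1 : α₁ ≤ 1 / 100 * n := by
      calc α₁ ≤ α₁ * (δ * n) := le_mul_of_one_le_right hα₁.le (by linarith)
        _ = α₁ * δ * n := by ring
        _ ≤ _ := by gcongr
    have h2 := hSlow k hk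
    have h3 : N * (6 * v) ≤ (51 / 100 * n) * (6 * v) := by
      gcongr
      rw [hN]; linarith
    linarith [mul_pos hn0 hv]
  refine ⟨lt_of_lt_of_le (ENNReal.ofReal_pos.2 hLpos) hlow,
    lt_of_le_of_lt (hup t htq) ENNReal.ofReal_lt_top, fun k hk => ⟨fun htk => ?_, fun htk => ?_⟩⟩
  · refine key k hk _ (Real.exp_pos _).le ?_
    refine (div_rpow_le_exp hH0.le (hSpos k hk) hN0.le).trans ?_
    rw [← Real.exp_add]
    refine Real.exp_le_exp.2 ?_
    have hRk : R k = ‖ev‖ ^ 2 - ‖(colSpace X k).starProjection ev‖ ^ 2 := by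
      rw [hR]; simp only; rw [hyev]; exact rss_eq_sub (colSpace_mono htk hμt) ev
    have h1 := norm_starProjection_sub_eq (X := X) htk ev
    have h2 : R t - R k = ‖(extraSpace X t k).starProjection ev‖ ^ 2 := by
      rw [hRt, hRk, ← h1]; ring
    have h3 := hHS k
    rw [h2] at h3
    calc N / S k * (H - S k) ≤ N / S k * (‖(extraSpace X t k).starProjection ev‖ ^ 2 / 2 +
          C₅ * (1 + k.card)) := by
          have := (hSpos k hk).le
          gcongr
      _ ≤ 7 / 6 / v * (‖(extraSpace X t k).starProjection ev‖ ^ 2 / 2 + C₅ * (1 + k.card)) := by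
          exact mul_le_mul_of_nonneg_right (hNS k hk) (by positivity)
      _ = _ := by rw [hC₆]; field_simp; ring
  · refine key k hk _ (Real.exp_pos _).le ?_
    refine (div_rpow_le_exp hH0.le (hSpos k hk) hN0.le).trans ?_
    rw [← Real.exp_add]
    refine Real.exp_le_exp.2 ?_
    obtain ⟨j, hjt, hjk⟩ := Finset.not_subset.1 htk
    have hcard : (k ∪ t).card ≤ q + T := (Finset.card_union_le _ _).trans (by omega)
    set D := √(n * ε) * bm with hD
    have hD2 : D ^ 2 = n * ε * bm ^ 2 := by rw [hD, mul_pow, Real.sq_sqrt hnε0.le]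
    have hD0 : 0 ≤ D := by positivity
    have hvh : √(v * h) ≤ D / 4 := by
      refine Real.sqrt_le_iff.2 ⟨by positivity, ?_⟩
      rw [div_pow, hD2]
      calc v * h ≤ v * (δ * (n * ε)) := by gcongr; linarith
        _ = v * δ * (n * ε) := by ring
        _ ≤ (bm / 4) ^ 2 * (n * ε) := by gcongr
        _ = _ := by ring
    have h1 := rss_sub_rss_le (X := X) hx0 (h := √(v * h)) (D := D) (e := ev) (k := k)
      (fun b => (hdes (k ∪ t) hcard b).1) hnε0.le hjt hjk
      (by
        rw [hD2, ← sq_abs (x j)]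
        have := hxb j hjt
        gcongr)
      (by linarith) hD0
      (by
        have := hE3 k hk
        exact Real.le_sqrt_of_sq_le this)
    rw [← hμ, ← hyev] at h1
    have h2 : R t - R k ≤ -(n * ε * bm ^ 2) / 2 := by
      have h3 : 0 ≤ √(v * h) := Real.sqrt_nonneg _
      have h4 : (√(v * h)) ^ 2 ≤ (D / 4) ^ 2 := pow_le_pow_left₀ h3 hvh 2
      have h5 : (3 * D / 4) ^ 2 ≤ (D - √(v * h)) ^ 2 := pow_le_pow_left₀ (by positivity) (by linarith) 2
      have h6 : R t - R k ≤ (√(v * h)) ^ 2 - (D - √(v * h)) ^ 2 := h1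
      rw [← hD2]
      linarith
    have h7 : C₅ * (1 + k.card) ≤ n * ε * bm ^ 2 / 8 := by
      have : (k.card : ℝ) ≤ q := by exact_mod_cast hk
      calc C₅ * (1 + k.card) ≤ C₅ * (δ * (n * ε)) := by gcongr; linarith
        _ = C₅ * δ * (n * ε) := by ring
        _ ≤ bm ^ 2 / 8 * (n * ε) := by gcongr
        _ = _ := by ring
    have h8 : H - S k ≤ -(n * ε * bm ^ 2 / 8) := by linarith [hHS k]
    have hSup : S k ≤ n * ε⁻¹ * C₇ := by
      have h9 : R k ≤ n * ε⁻¹ * M := (rss_le_norm_sq _ _).trans hynorm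
      have h10 : 1 ≤ n * ε⁻¹ := by
        have : (1 : ℝ) ≤ n := by exact_mod_cast hn
        exact one_le_mul_of_one_le_of_one_le this hε'
      have h11 : α₂ ≤ n * ε⁻¹ * α₂ := le_mul_of_one_le_left hα₂.le h10
      have h12 : (0 : ℝ) ≤ r * k.card := by positivity
      simp only [hS, hC₇]
      linarith
    -- Now H - S_k is negative, so N/S_k is needed from below. As S_k may be of order n/ε, this
    -- costs the second factor ε in the exponent n ε².
    have hNS' : ε / (2 * C₇) ≤ N / S k := by
      rw [div_le_div_iff₀ (by positivity) (hSpos k hk)]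
      calc ε * S k ≤ ε * (n * ε⁻¹ * C₇) := by gcongr
        _ = n * C₇ := by field_simp
        _ ≤ N * (2 * C₇) := by rw [hN]; linarith [mul_pos hα₁ hC₇0]
    have h13 : 0 ≤ C₆ * (1 + k.card) := by positivity
    calc N / S k * (H - S k) ≤ N / S k * (-(n * ε * bm ^ 2 / 8)) := by
          have := (hSpos k hk).le
          gcongr
      _ = -(N / S k * (n * ε * bm ^ 2 / 8)) := by ring
      _ ≤ -(ε / (2 * C₇) * (n * ε * bm ^ 2 / 8)) := by gcongr
      _ = -(bm ^ 2 / (16 * C₇) * (n * ε ^ 2)) := by field_simp; ring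
      _ ≤ _ := by linarith

/-! ### Sums over models -/

theorem sum_pow_card (p : ℕ) (θ : ℝ) : ∑ k : Finset (Fin p), θ ^ k.card = (1 + θ) ^ p := by
  have := Fintype.sum_pow_mul_eq_add_pow (Fin p) θ 1
  simp only [one_pow, mul_one, Fintype.card_fin] at this
  rw [this, add_comm]

theorem one_add_pow_le_exp {θ : ℝ} (hθ : 0 ≤ θ) (p : ℕ) : (1 + θ) ^ p ≤ Real.exp (p * θ) := by
  rw [Real.exp_nat_mul]
  gcongr
  linarith [Real.add_one_le_exp θ]

/-- Give each model the weight (p+1)^(-|k|), which is at least (p+1)^(-q) for the models counted;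
the total weight is (1 + 1/(p+1))^p ≤ e. -/
theorem card_models_le (p q : ℕ) :
    ((Finset.univ.filter fun k : Finset (Fin p) => k.card ≤ q).card : ℝ) ≤
      Real.exp 1 * (p + 1) ^ q := by
  set θ : ℝ := 1 / (p + 1) with hθ
  have hθ0 : 0 < θ := by positivity
  have hθ1 : θ ≤ 1 := by rw [hθ, div_le_one (by positivity)]; linarith [Nat.cast_nonneg (α := ℝ) p]
  have h1 : ((Finset.univ.filter fun k : Finset (Fin p) => k.card ≤ q).card : ℝ) * θ ^ q ≤
      Real.exp 1 := by
    calc _ = ∑ k ∈ Finset.univ.filter fun k : Finset (Fin p) => k.card ≤ q, θ ^ q := by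
          rw [Finset.sum_const, nsmul_eq_mul]
      _ ≤ ∑ k ∈ Finset.univ.filter fun k : Finset (Fin p) => k.card ≤ q, θ ^ k.card :=
          Finset.sum_le_sum fun k hk =>
            pow_le_pow_of_le_one hθ0.le hθ1 (Finset.mem_filter.1 hk).2
      _ ≤ ∑ k : Finset (Fin p), θ ^ k.card :=
          Finset.sum_le_sum_of_subset_of_nonneg (Finset.filter_subset _ _)
            fun k _ _ => by positivity
      _ ≤ Real.exp (p * θ) := by rw [sum_pow_card]; exact one_add_pow_le_exp hθ0.le p
      _ ≤ Real.exp 1 := by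
          refine Real.exp_le_exp.2 ?_
          rw [hθ, mul_one_div, div_le_one (by positivity)]; linarith
  rw [hθ, one_div, inv_pow, ← div_eq_mul_inv, div_le_iff₀ (by positivity)] at h1
  exact h1

/-- Removing t maps the strict supersets of t injectively to nonempty sets; the empty set accounts
for the subtracted 1. -/
theorem sum_ssuperset_pow_le {p : ℕ} (t : Finset (Fin p)) {φ : ℝ} (hφ : 0 ≤ φ) :
    ∑ k ∈ Finset.univ.filter fun k : Finset (Fin p) => t ⊂ k, φ ^ (k \ t).card ≤
      Real.exp (p * φ) - 1 := by
  have hinj : Set.InjOn (fun k : Finset (Fin p) => k \ t)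
      (Finset.univ.filter fun k : Finset (Fin p) => t ⊂ k : Finset (Finset (Fin p))) := by
    intro k hk l hl h
    have hk' : t ⊆ k := (Finset.mem_filter.1 hk).2.subset
    have hl' : t ⊆ l := (Finset.mem_filter.1 hl).2.subset
    have h : k \ t = l \ t := h
    rw [← Finset.sdiff_union_of_subset hk', h, Finset.sdiff_union_of_subset hl']
  rw [← Finset.sum_image (f := fun s : Finset (Fin p) => φ ^ s.card) hinj]
  have hsub : (Finset.univ.filter fun k : Finset (Fin p) => t ⊂ k).image (fun k => k \ t) ⊆
      Finset.univ.erase ∅ := by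
    intro s hs
    obtain ⟨k, hk, rfl⟩ := Finset.mem_image.1 hs
    refine Finset.mem_erase.2 ⟨?_, Finset.mem_univ _⟩
    rw [Ne, Finset.sdiff_eq_empty_iff_subset]
    exact ((Finset.mem_filter.1 hk).2).2
  calc _ ≤ ∑ s ∈ Finset.univ.erase ∅, φ ^ s.card :=
        Finset.sum_le_sum_of_subset_of_nonneg hsub fun s _ _ => by positivity
    _ = (1 + φ) ^ p - 1 := by
        rw [← sum_pow_card, ← Finset.add_sum_erase _ _ (Finset.mem_univ (∅ : Finset (Fin p)))]
        simp
    _ ≤ _ := by linarith [one_add_pow_le_exp hφ p]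

/-! ### Posterior probabilities -/

/-- A competitor contributes at most ρ_k / w times what the true model does, hence π(t | y) ≥ 1/(1 +
s/w) ≥ 1 - s/w. -/
theorem dist_posterior_le {n p r : ℕ} {α₁ α₂ : ℝ} {X : Matrix (Fin n) (Fin p) ℝ}
    {A : Matrix (Fin p) (Fin p) ℝ} {prior : PMF (Finset (Fin p))} {t : Finset (Fin p)}
    {y : Fin n → ℝ} {w s : ℝ} (hw : 0 < w)
    (hodds : ∀ k, 0 < prior k → w < (prior t).toReal / (prior k).toReal)
    (hpos : 0 < marginal r α₁ α₂ X A t y) (hfin : marginal r α₁ α₂ X A t y < ∞)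
    {ρ : Finset (Fin p) → ℝ} (hρ0 : ∀ k, 0 ≤ ρ k)
    (hρ : ∀ k, k ≠ t → 0 < prior k →
      marginal r α₁ α₂ X A k y ≤ ENNReal.ofReal (ρ k) * marginal r α₁ α₂ X A t y)
    (hs : ∑ k ∈ Finset.univ.filter (fun k => k ≠ t ∧ 0 < prior k), ρ k ≤ s) :
    dist (posterior r α₁ α₂ X A prior t y) 1 ≤ s / w := by
  classical
  set m := fun k => marginal r α₁ α₂ X A k y with hm
  have hs0 : 0 ≤ s := le_trans (Finset.sum_nonneg fun k _ => hρ0 k) hs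
  have hptop : ∀ k, prior k ≠ ∞ := fun k => prior.apply_ne_top k
  -- Some model has positive prior mass, and its odds against `t` exclude prior mass 0 for `t`.
  obtain ⟨k₀, hk₀⟩ : ∃ k, 0 < prior k := by
    by_contra hcon
    push Not at hcon
    have : ∑' k, prior k = 0 := by
      rw [ENNReal.tsum_eq_zero]; exact fun k => le_antisymm (hcon k) zero_le
    rw [prior.tsum_coe] at this
    exact one_ne_zero this
  have hpt : 0 < prior t := by
    by_contra hcon
    have h0 : prior t = 0 := le_antisymm (not_lt.1 hcon) zero_le
    have := hodds k₀ hk₀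
    rw [h0] at this
    simp at this
    linarith
  set a := prior t * m t with ha
  have ha0 : a ≠ 0 := mul_ne_zero hpt.ne' hpos.ne'
  have hatop : a ≠ ∞ := ENNReal.mul_ne_top (hptop t) hfin.ne
  have hterm : ∀ k, k ≠ t → 0 < prior k → prior k * m k ≤ ENNReal.ofReal (ρ k / w) * a := by
    intro k hkt hk
    have h1 := hodds k hk
    have hk' : 0 < (prior k).toReal := ENNReal.toReal_pos hk.ne' (hptop k)
    rw [lt_div_iff₀ hk'] at h1
    have h2 : prior k ≤ ENNReal.ofReal w⁻¹ * prior t := by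
      rw [← ENNReal.ofReal_toReal (hptop k), ← ENNReal.ofReal_toReal (hptop t),
        ← ENNReal.ofReal_mul (by positivity)]
      refine ENNReal.ofReal_le_ofReal ?_
      rw [← div_eq_inv_mul, le_div_iff₀ hw]; linarith
    calc prior k * m k ≤ (ENNReal.ofReal w⁻¹ * prior t) * (ENNReal.ofReal (ρ k) * m t) :=
          mul_le_mul' h2 (hρ k hkt hk)
      _ = _ := by
          rw [div_eq_mul_inv, ENNReal.ofReal_mul (hρ0 k), ha]; ring
  have hsum : ∑ k, prior k * m k ≤ ENNReal.ofReal (1 + s / w) * a := by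
    rw [← Finset.add_sum_erase _ _ (Finset.mem_univ t), ENNReal.ofReal_add zero_le_one
      (by positivity), ENNReal.ofReal_one, add_mul, one_mul]
    gcongr
    -- Models of prior mass 0 drop out even though nothing bounds their marginals, as 0 · ∞ = 0 in
    -- `ℝ≥0∞`.
    have h3 : ∑ k ∈ Finset.univ.erase t, prior k * m k =
        ∑ k ∈ Finset.univ.filter (fun k => k ≠ t ∧ 0 < prior k), prior k * m k := by
      symm
      refine Finset.sum_subset (fun k hk => ?_) (fun k hk hk' => ?_)
      · exact Finset.mem_erase.2 ⟨(Finset.mem_filter.1 hk).2.1, Finset.mem_univ _⟩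
      · have : ¬ 0 < prior k := fun h =>
          hk' (Finset.mem_filter.2 ⟨Finset.mem_univ _, (Finset.mem_erase.1 hk).1, h⟩)
        rw [le_antisymm (not_lt.1 this) zero_le, zero_mul]
    rw [h3]
    calc _ ≤ ∑ k ∈ Finset.univ.filter (fun k => k ≠ t ∧ 0 < prior k),
          ENNReal.ofReal (ρ k / w) * a := Finset.sum_le_sum fun k hk =>
            hterm k (Finset.mem_filter.1 hk).2.1 (Finset.mem_filter.1 hk).2.2
      _ = ENNReal.ofReal (∑ k ∈ Finset.univ.filter (fun k => k ≠ t ∧ 0 < prior k), ρ k / w) *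
          a := by
          rw [← Finset.sum_mul, ENNReal.ofReal_sum_of_nonneg
            fun k _ => div_nonneg (hρ0 k) hw.le]
      _ ≤ _ := by
          rw [← Finset.sum_div]
          gcongr
  have hale : a ≤ ∑ k, prior k * m k :=
    Finset.single_le_sum (f := fun k => prior k * m k) (fun k _ => zero_le) (Finset.mem_univ t)
  have hStop : ∑ k, prior k * m k ≠ ∞ :=
    ne_top_of_le_ne_top (ENNReal.mul_ne_top ENNReal.ofReal_ne_top hatop) hsum
  have hpost : posterior r α₁ α₂ X A prior t y = a.toReal / (∑ k, prior k * m k).toReal := by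
    rw [posterior, ENNReal.toReal_div]
  set Sr := (∑ k, prior k * m k).toReal with hSr
  have har : 0 < a.toReal := ENNReal.toReal_pos ha0 hatop
  have h1 : a.toReal ≤ Sr := ENNReal.toReal_mono hStop hale
  have h2 : Sr ≤ (1 + s / w) * a.toReal := by
    have := ENNReal.toReal_mono (ENNReal.mul_ne_top ENNReal.ofReal_ne_top hatop) hsum
    rwa [ENNReal.toReal_mul, ENNReal.toReal_ofReal (by positivity)] at this
  have hSr0 : 0 < Sr := lt_of_lt_of_le har h1
  have hsw : 0 ≤ s / w := by positivity
  rw [hpost, Real.dist_eq, abs_sub_comm, abs_of_nonneg (by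
    rw [sub_nonneg, div_le_one hSr0]; exact h1), sub_le_comm, le_div_iff₀ hSr0]
  have h3 : s / w * a.toReal ≤ s / w * Sr := by gcongr
  linarith

/-! ### Bounds for the weights -/

/-- The crude form, for models that need not contain t: the factor n^((r+1)T) stays, to be beaten by
an exponential. -/
theorem ratioWeight_le_of_le {r T n K q : ℕ} {C D D' ε : ℝ} (hC : 0 ≤ C) (hD : 0 ≤ D)
    (hDD : D ≤ D') (hε0 : 0 < ε) (hε1 : ε < 1) (hK : K ≤ q) {E : ℕ} (hE : 2 * r + 1 ≤ E) :
    ratioWeight r C D T n ε K ≤ C * (n ^ (r + 1) * ε⁻¹) ^ T *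
      (D' * (ε⁻¹) ^ E * (q : ℝ) ^ (r + 1 / 2 : ℝ) / n ^ (r + 1)) ^ K := by
  have hε' : 1 ≤ ε⁻¹ := (one_le_inv₀ hε0).2 hε1.le
  have hD' : 0 ≤ D' := hD.trans hDD
  unfold ratioWeight
  gcongr ?_ * ?_ ^ K
  rw [mul_right_comm]
  have h1 : (ε⁻¹) ^ (2 * r + 1) ≤ (ε⁻¹) ^ E := pow_le_pow_right₀ hε' hE
  have h2 : (K : ℝ) ^ (r + 1 / 2 : ℝ) ≤ (q : ℝ) ^ (r + 1 / 2 : ℝ) :=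
    Real.rpow_le_rpow (Nat.cast_nonneg _) (by exact_mod_cast hK) (by positivity)
  gcongr

/-- The constant that absorbs the contribution of the variables of the true model. -/
noncomputable def absorbConst (r : ℕ) (C D : ℝ) (T : ℕ) : ℝ :=
  (1 + C) * (1 + D * (T + 1 : ℝ) ^ (r + 1 / 2 : ℝ)) ^ T * (2 ^ (r + 1 / 2 : ℝ)) ^ T * D

theorem le_absorbConst {r : ℕ} {C D : ℝ} (hC : 0 ≤ C) (hD : 0 ≤ D) (T : ℕ) :
    D ≤ absorbConst r C D T := by
  unfold absorbConst
  refine le_mul_of_one_le_left hD ?_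
  have h1 : 1 ≤ (1 + D * (T + 1 : ℝ) ^ (r + 1 / 2 : ℝ)) ^ T :=
    one_le_pow₀ (by linarith [show 0 ≤ D * (T + 1 : ℝ) ^ (r + 1 / 2 : ℝ) by positivity])
  have h2 : (1 : ℝ) ≤ (2 ^ (r + 1 / 2 : ℝ)) ^ T :=
    one_le_pow₀ (Real.one_le_rpow (by norm_num) (by positivity))
  exact one_le_mul_of_one_le_of_one_le
    (one_le_mul_of_one_le_of_one_le (by linarith) h1) h2

/-- For a model with T + m variables, T of the factors n^(-(r+1)) cancel the one inherited from the
true model. What they leave behind is absorbed into the m-th power, which is possible because m ≥ 1.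
-/
theorem ratioWeight_le_pow {r T n m q : ℕ} {C D ε : ℝ} (hn : 1 ≤ n) (hC : 0 ≤ C) (hD : 0 ≤ D)
    (hε0 : 0 < ε) (hε1 : ε < 1) (hm : 1 ≤ m) (hK : T + m ≤ q) :
    ratioWeight r C D T n ε (T + m) ≤
      (absorbConst r C D T * (ε⁻¹) ^ ((2 * r + 2) * T + (2 * r + 1)) *
        (q : ℝ) ^ (r + 1 / 2 : ℝ) / n ^ (r + 1)) ^ m := by
  have hn0 : (0 : ℝ) < n := by exact_mod_cast hn
  have hε' : 1 ≤ ε⁻¹ := (one_le_inv₀ hε0).2 hε1.le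
  set x := ε⁻¹ with hx
  have hx0 : 0 < x := by linarith
  set κ : ℝ := ((T + m : ℕ) : ℝ) ^ (r + 1 / 2 : ℝ) with hκ
  have hκ0 : 0 ≤ κ := by positivity
  have hκq : κ ≤ (q : ℝ) ^ (r + 1 / 2 : ℝ) :=
    Real.rpow_le_rpow (Nat.cast_nonneg _) (by exact_mod_cast hK) (by positivity)
  set L : ℝ := (T + 1 : ℝ) ^ (r + 1 / 2 : ℝ) with hL
  set Q : ℝ := 2 ^ (r + 1 / 2 : ℝ) with hQ
  have hQ0 : 0 < Q := by positivity
  have hL0 : 0 < L := by positivity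
  -- T + m ≤ (T + 1) m ≤ (T + 1) 2^m: the dependence of κ on m is at most geometric.
  have hκ2 : κ ≤ L * Q ^ m := by
    rw [hQ, ← Real.rpow_mul_natCast (by norm_num), mul_comm _ (m : ℝ), Real.rpow_natCast_mul
      (by norm_num), hL, ← Real.mul_rpow (by positivity) (by positivity)]
    refine Real.rpow_le_rpow (Nat.cast_nonneg _) ?_ (by positivity)
    have h1 : (m : ℝ) ≤ 2 ^ m := by exact_mod_cast (Nat.lt_two_pow_self).le
    have h2 : (1 : ℝ) ≤ m := by exact_mod_cast hm
    push_cast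
    have hT : (0 : ℝ) ≤ T := Nat.cast_nonneg T
    calc (T + m : ℝ) ≤ (T + 1) * m := by nlinarith
      _ ≤ _ := by gcongr
  have e1 : ratioWeight r C D T n ε (T + m) =
      C * (D * κ * x ^ (2 * r + 2)) ^ T * (D * κ * x ^ (2 * r + 1) / n ^ (r + 1)) ^ m := by
    unfold ratioWeight
    rw [pow_add _ T m, ← mul_assoc, mul_assoc C, ← mul_pow]
    congr 3
    rw [← hκ, ← hx, show 2 * r + 2 = 2 * r + 1 + 1 from rfl, pow_succ x (2 * r + 1)]
    field_simp
  set G : ℝ := (1 + C) * (1 + D * L) ^ T * x ^ ((2 * r + 2) * T) with hG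
  have hDL : 0 ≤ D * L := by positivity
  have hG1 : 1 ≤ G :=
    one_le_mul_of_one_le_of_one_le (one_le_mul_of_one_le_of_one_le (by linarith)
      (one_le_pow₀ (by linarith))) (one_le_pow₀ hε')
  have hGm : G ≤ G ^ m := le_self_pow₀ hG1 (by omega)
  rw [e1]
  calc C * (D * κ * x ^ (2 * r + 2)) ^ T * (D * κ * x ^ (2 * r + 1) / n ^ (r + 1)) ^ m
      ≤ (1 + C) * ((1 + D * L) * Q ^ m * x ^ (2 * r + 2)) ^ T *
        (D * (q : ℝ) ^ (r + 1 / 2 : ℝ) * x ^ (2 * r + 1) / n ^ (r + 1)) ^ m := by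
        have h1 : D * κ ≤ (1 + D * L) * Q ^ m := by
          calc D * κ ≤ D * (L * Q ^ m) := by gcongr
            _ = D * L * Q ^ m := by ring
            _ ≤ _ := by gcongr; linarith
        gcongr
        linarith
    _ = G * ((Q ^ T) ^ m *
        (D * (q : ℝ) ^ (r + 1 / 2 : ℝ) * x ^ (2 * r + 1) / n ^ (r + 1)) ^ m) := by
        rw [hG, mul_pow, mul_pow, ← pow_mul, ← pow_mul, ← pow_mul, mul_comm m T]; ring
    _ ≤ G ^ m * ((Q ^ T) ^ m *
        (D * (q : ℝ) ^ (r + 1 / 2 : ℝ) * x ^ (2 * r + 1) / n ^ (r + 1)) ^ m) := by gcongr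
    _ = _ := by
        rw [← mul_pow, ← mul_pow, hG, absorbConst, pow_add x]
        congr 1; ring

/-! ### Probabilities of atypical errors -/

section Probability

variable {Ω : Type*} [MeasurableSpace Ω] {P : Measure Ω} [IsProbabilityMeasure P]
  {n p : ℕ} {v : ℝ≥0} {E : Fin n → Ω → ℝ} {X : Matrix (Fin n) (Fin p) ℝ}

theorem measure_exists_projection_le (hv : v ≠ 0)
    (hlaw : ∀ i, HasLaw (E i) (gaussianReal 0 v) P) (hind : iIndepFun E P)
    (t : Finset (Fin p)) (q : ℕ) (h : ℝ) :
    P {ω | ∃ k : Finset (Fin p), k.card ≤ q ∧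
        v * h ≤ ‖(colSpace X (k ∪ t)).starProjection (WithLp.toLp 2 fun i => E i ω)‖ ^ 2} ≤
      ENNReal.ofReal (Real.exp 1 * (p + 1) ^ q * (Real.exp (-h / 4) * √2 ^ (q + t.card))) := by
  set F := Finset.univ.filter fun k : Finset (Fin p) => k.card ≤ q with hF
  have hsub : {ω | ∃ k : Finset (Fin p), k.card ≤ q ∧
        v * h ≤ ‖(colSpace X (k ∪ t)).starProjection (WithLp.toLp 2 fun i => E i ω)‖ ^ 2} ⊆
      ⋃ k ∈ F, {ω | v * h ≤
        ‖(colSpace X (k ∪ t)).starProjection (WithLp.toLp 2 fun i => E i ω)‖ ^ 2} := by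
    rintro ω ⟨k, hk, hω⟩
    exact Set.mem_biUnion (Finset.mem_filter.2 ⟨Finset.mem_univ k, hk⟩) hω
  have h2 : (1 : ℝ) ≤ √2 := Real.one_le_sqrt.2 (by norm_num)
  calc _ ≤ P (⋃ k ∈ F, {ω | v * h ≤
        ‖(colSpace X (k ∪ t)).starProjection (WithLp.toLp 2 fun i => E i ω)‖ ^ 2}) :=
        measure_mono hsub
    _ ≤ ∑ k ∈ F, P {ω | v * h ≤
        ‖(colSpace X (k ∪ t)).starProjection (WithLp.toLp 2 fun i => E i ω)‖ ^ 2} :=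
        measure_biUnion_finset_le _ _
    _ ≤ ∑ k ∈ F, ENNReal.ofReal (Real.exp (-h / 4) * √2 ^ (q + t.card)) := by
        refine Finset.sum_le_sum fun k hk => ?_
        refine (measure_le_norm_sq_starProjection hv hlaw hind _ h).trans
          (ENNReal.ofReal_le_ofReal ?_)
        gcongr
        · exact (finrank_colSpace_le _).trans ((Finset.card_union_le _ _).trans
            (Nat.add_le_add_right (Finset.mem_filter.1 hk).2 _))
    _ = ENNReal.ofReal (F.card * (Real.exp (-h / 4) * √2 ^ (q + t.card))) := by
        rw [Finset.sum_const, nsmul_eq_mul, ENNReal.ofReal_mul (Nat.cast_nonneg _),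
          ENNReal.ofReal_natCast]
    _ ≤ _ := by
        refine ENNReal.ofReal_le_ofReal ?_
        gcongr
        exact card_models_le p q

theorem measure_le_norm_sq (hv : v ≠ 0)
    (hlaw : ∀ i, HasLaw (E i) (gaussianReal 0 v) P) (hind : iIndepFun E P) :
    P {ω | 4 * n * v ≤ ‖WithLp.toLp 2 fun i => E i ω‖ ^ 2} ≤
      ENNReal.ofReal ((Real.exp (-1) * √2) ^ n) := by
  have h := measure_le_norm_sq_starProjection hv hlaw hind (⊤ : Submodule ℝ _) (4 * n)
  rw [finrank_top, finrank_euclideanSpace_fin] at h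
  have e1 : Real.exp (-(4 * n) / 4) * √2 ^ n = (Real.exp (-1) * √2) ^ n := by
    rw [mul_pow, ← Real.exp_nat_mul]; congr 2; ring
  rw [e1] at h
  refine le_trans (measure_mono fun ω hω => ?_) h
  have hω : 4 * n * (v : ℝ) ≤ _ := hω
  simp only [Set.mem_ofPred_eq, Submodule.starProjection_top, ContinuousLinearMap.id_apply]
  linarith

/-- The sum of the (discounted) bounds for the models that contain the true one is small. -/
theorem measure_le_sum_ssuperset (hv : v ≠ 0)
    (hlaw : ∀ i, HasLaw (E i) (gaussianReal 0 v) P) (hind : iIndepFun E P)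
    {t : Finset (Fin p)} {W : Finset (Fin p) → ℝ} {θ : ℝ}
    (F : Finset (Finset (Fin p))) (hF : ∀ k ∈ F, t ⊂ k)
    (hW0 : ∀ k ∈ F, 0 ≤ W k) (hθ : 0 ≤ θ) (hW : ∀ k ∈ F, W k ≤ θ ^ (k \ t).card)
    {s : ℝ} (hs : 0 < s) :
    P {ω | s ≤ ∑ k ∈ F, (W k * Real.exp (7 / (12 * v) *
      ‖(extraSpace X t k).starProjection (WithLp.toLp 2 fun i => E i ω)‖ ^ 2)) ^ (3 / 4 : ℝ)} ≤
      ENNReal.ofReal ((Real.exp (p * (θ ^ (3 / 4 : ℝ) * √8)) - 1) / s) := by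
  have hv' : (0 : ℝ) < v := by positivity
  set ev : Ω → EuclideanSpace ℝ (Fin n) := fun ω => WithLp.toLp 2 fun i => E i ω with hev
  -- The power 3/4 brings 7/12 down to 7/16 = (7/8)/2, so the exponential moment is the one with c =
  -- 7/8, namely √8 per dimension.
  set Y : Finset (Fin p) → Ω → ℝ := fun k ω => Real.exp (7 / 8 / (2 * v) *
    ‖(extraSpace X t k).starProjection (ev ω)‖ ^ 2) with hY
  have hpow : ∀ k ∈ F, ∀ ω, (W k * Real.exp (7 / (12 * v) *
      ‖(extraSpace X t k).starProjection (ev ω)‖ ^ 2)) ^ (3 / 4 : ℝ) =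
      W k ^ (3 / 4 : ℝ) * Y k ω := by
    intro k hk ω
    rw [Real.mul_rpow (hW0 k hk) (Real.exp_pos _).le, ← Real.exp_mul, hY]
    congr 2; field_simp; ring
  have hE : ∀ i, AEMeasurable (E i) P := fun i => (hlaw i).aemeasurable
  have hevm : AEMeasurable ev P :=
    (PiLp.continuous_toLp 2 _).measurable.comp_aemeasurable (aemeasurable_pi_lambda _ hE)
  have hYm : ∀ k, AEMeasurable (fun ω => ENNReal.ofReal (W k ^ (3 / 4 : ℝ) * Y k ω)) P := by
    intro k
    have hcont : Continuous fun z : EuclideanSpace ℝ (Fin n) => ENNReal.ofReal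
        (W k ^ (3 / 4 : ℝ) * Real.exp (7 / 8 / (2 * v) *
          ‖(extraSpace X t k).starProjection z‖ ^ 2)) :=
      ENNReal.continuous_ofReal.comp (by fun_prop)
    exact hcont.measurable.comp_aemeasurable hevm
  have hintegrable : ∀ k ∈ F, ∫⁻ ω, ENNReal.ofReal (W k ^ (3 / 4 : ℝ) * Y k ω) ∂P ≤
      ENNReal.ofReal ((θ ^ (3 / 4 : ℝ) * √8) ^ (k \ t).card) := by
    intro k hk
    have h1 := lintegral_exp_norm_sq_starProjection hv hlaw hind (extraSpace X t k) (c := 7 / 8)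
      (by norm_num) (by norm_num)
    have e8 : (√(1 - 7 / 8 : ℝ))⁻¹ = √8 := by rw [← Real.sqrt_inv]; norm_num
    rw [e8] at h1
    have h8 : (1 : ℝ) ≤ √8 := Real.one_le_sqrt.2 (by norm_num)
    have hWk := hW0 k hk
    calc _ = ENNReal.ofReal (W k ^ (3 / 4 : ℝ)) * ∫⁻ ω, ENNReal.ofReal (Y k ω) ∂P := by
          rw [← lintegral_const_mul' _ _ ENNReal.ofReal_ne_top]
          exact lintegral_congr fun ω => ENNReal.ofReal_mul (by positivity)
      _ = ENNReal.ofReal (W k ^ (3 / 4 : ℝ) * √8 ^ Module.finrank ℝ (extraSpace X t k)) := by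
          rw [ENNReal.ofReal_mul (by positivity), ← h1]
      _ ≤ _ := by
          refine ENNReal.ofReal_le_ofReal ?_
          rw [mul_pow, ← Real.rpow_mul_natCast hθ, mul_comm (3 / 4 : ℝ), Real.rpow_mul hθ,
            Real.rpow_natCast]
          gcongr
          · exact hW k hk
          · exact finrank_extraSpace_le (hF k hk).subset
  have hmk := mul_meas_ge_le_lintegral₀ (μ := P)
    (f := fun ω => ∑ k ∈ F, ENNReal.ofReal (W k ^ (3 / 4 : ℝ) * Y k ω))
    (Finset.aemeasurable_fun_sum _ fun k _ => hYm k) (ENNReal.ofReal s)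
  rw [lintegral_finsetSum' _ fun k _ => hYm k] at hmk
  have hφ : 0 ≤ θ ^ (3 / 4 : ℝ) * √8 := by positivity
  have hle : ∑ k ∈ F, ∫⁻ ω, ENNReal.ofReal (W k ^ (3 / 4 : ℝ) * Y k ω) ∂P ≤
      ENNReal.ofReal (Real.exp (p * (θ ^ (3 / 4 : ℝ) * √8)) - 1) := by
    calc _ ≤ ∑ k ∈ F, ENNReal.ofReal ((θ ^ (3 / 4 : ℝ) * √8) ^ (k \ t).card) :=
          Finset.sum_le_sum hintegrable
      _ = ENNReal.ofReal (∑ k ∈ F, (θ ^ (3 / 4 : ℝ) * √8) ^ (k \ t).card) := by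
          rw [ENNReal.ofReal_sum_of_nonneg fun k _ => by positivity]
      _ ≤ _ := by
          refine ENNReal.ofReal_le_ofReal (le_trans ?_ (sum_ssuperset_pow_le t hφ))
          refine Finset.sum_le_sum_of_subset_of_nonneg (fun k hk => ?_) fun k _ _ => by positivity
          exact Finset.mem_filter.2 ⟨Finset.mem_univ _, hF k hk⟩
  have hsub : {ω | s ≤ ∑ k ∈ F, (W k * Real.exp (7 / (12 * v) *
      ‖(extraSpace X t k).starProjection (ev ω)‖ ^ 2)) ^ (3 / 4 : ℝ)} ⊆
      {ω | ENNReal.ofReal s ≤ ∑ k ∈ F, ENNReal.ofReal (W k ^ (3 / 4 : ℝ) * Y k ω)} := by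
    intro ω hω
    have hω : s ≤ _ := hω
    rw [Finset.sum_congr rfl fun k hk => hpow k hk ω] at hω
    simp only [Set.mem_ofPred_eq]
    rw [← ENNReal.ofReal_sum_of_nonneg fun k hk => ?_]
    · exact ENNReal.ofReal_le_ofReal hω
    · have := hW0 k hk
      positivity
  rw [ENNReal.ofReal_div_of_pos hs, ENNReal.le_div_iff_mul_le
    (Or.inl (by simpa using hs)) (Or.inl ENNReal.ofReal_ne_top), mul_comm]
  exact (mul_le_mul_right (measure_mono (μ := P) hsub) _).trans (hmk.trans hle)

end Probability

/-- Each term of the hypothesis is at most 1, hence so is each ρ k, and then ρ k ≤ ρ k ^ (3/4).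
Markov's inequality can thus be applied to the powers, which have finite mean. -/
theorem sum_le_of_sum_rpow_le {ι : Type*} {F : Finset ι} {ρ : ι → ℝ} (h0 : ∀ k ∈ F, 0 ≤ ρ k)
    {s : ℝ} (hs : s ≤ 1) (h : ∑ k ∈ F, ρ k ^ (3 / 4 : ℝ) ≤ s) : ∑ k ∈ F, ρ k ≤ s := by
  refine le_trans (Finset.sum_le_sum fun k hk => ?_) h
  have h1 : ρ k ^ (3 / 4 : ℝ) ≤ 1 :=
    (Finset.single_le_sum (f := fun k => ρ k ^ (3 / 4 : ℝ))
      (fun k hk => Real.rpow_nonneg (h0 k hk) _) hk).trans (h.trans hs)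
  have h2 : ρ k ≤ 1 := by
    by_contra hcon
    have := Real.one_lt_rpow (not_le.1 hcon) (by norm_num : (0 : ℝ) < 3 / 4)
    linarith
  exact Real.self_le_rpow_of_le_one (h0 k hk) h2 (by norm_num)

/-! ### Asymptotics -/

theorem tendsto_natCast_rpow_neg {s : ℝ} (hs : s < 0) :
    Tendsto (fun n : ℕ => (n : ℝ) ^ s) atTop (𝓝 0) := by
  have := (tendsto_rpow_neg_atTop (neg_pos.2 hs)).comp tendsto_natCast_atTop_atTop
  simpa [Function.comp_def] using this

theorem tendsto_natCast_rpow_pos {s : ℝ} (hs : 0 < s) :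
    Tendsto (fun n : ℕ => (n : ℝ) ^ s) atTop atTop :=
  (tendsto_rpow_atTop hs).comp tendsto_natCast_atTop_atTop

theorem eventually_const_mul_rpow_le (C : ℝ) {s c : ℝ} (hs : s < 0) (hc : 0 < c) :
    ∀ᶠ n : ℕ in atTop, C * (n : ℝ) ^ s ≤ c := by
  have h := (tendsto_natCast_rpow_neg hs).const_mul C
  rw [mul_zero] at h
  exact h.eventually_le_const hc

theorem exists_eventually_le_of_isBigO {u : ℕ → ℕ} {s : ℝ}
    (h : (fun n => (u n : ℝ)) =O[atTop] fun n : ℕ => (n : ℝ) ^ s) :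
    ∃ C : ℝ, 0 < C ∧ ∀ᶠ n : ℕ in atTop, (u n : ℝ) ≤ C * (n : ℝ) ^ s := by
  obtain ⟨C, hC, hb⟩ := h.exists_pos
  refine ⟨C, hC, ?_⟩
  filter_upwards [hb.bound] with n hn
  rwa [Real.norm_of_nonneg (Nat.cast_nonneg _), Real.norm_of_nonneg (by positivity)] at hn

/-- All that is needed of the logarithmic bound on 1/ε is that it is below every positive power of
n. -/
theorem eventually_inv_le_rpow {ε : ℕ → ℝ}
    (hε : (fun n => (ε n)⁻¹) =O[atTop] fun n : ℕ => Real.log n ^ (1 / 8 : ℝ)) {η : ℝ}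
    (hη : 0 < η) : ∀ᶠ n : ℕ in atTop, (ε n)⁻¹ ≤ (n : ℝ) ^ η := by
  have h1 : (fun x : ℝ => Real.log x ^ (1 / 8 : ℝ)) =o[atTop] fun x => x ^ η :=
    isLittleO_log_rpow_rpow_atTop _ hη
  have h2 := hε.trans_isLittleO (h1.comp_tendsto tendsto_natCast_atTop_atTop)
  filter_upwards [h2.bound one_pos] with n hn
  simp only [Function.comp_apply, one_mul] at hn
  rw [Real.norm_of_nonneg (by positivity : 0 ≤ (n : ℝ) ^ η)] at hn
  exact (le_abs_self _).trans hn

/-- Counting exponents: the product is of order at most n to the power in `hneg`. It is used with a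
= 1 for models that omit a true variable and with a = 3/4 for strict supersets. -/
theorem tendsto_mul_rpow_zero {p q : ℕ → ℕ} {x : ℕ → ℝ} {γ ξ η a : ℝ} {r E : ℕ} {D : ℝ}
    (hD : 0 ≤ D)
    (hp : (fun n => (p n : ℝ)) =O[atTop] fun n : ℕ => (n : ℝ) ^ γ)
    (hq : (fun n => (q n : ℝ)) =O[atTop] fun n : ℕ => (n : ℝ) ^ ξ)
    (hx : ∀ᶠ n : ℕ in atTop, x n ≤ (n : ℝ) ^ η) (hx0 : ∀ᶠ n : ℕ in atTop, 0 ≤ x n)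
    (ha : 0 < a) (hneg : γ + a * (η * E + ξ * (r + 1 / 2) - (r + 1)) < 0) :
    Tendsto (fun n : ℕ => (p n : ℝ) *
      (D * x n ^ E * (q n : ℝ) ^ (r + 1 / 2 : ℝ) / n ^ (r + 1)) ^ a) atTop (𝓝 0) := by
  obtain ⟨Cp, hCp, hp'⟩ := exists_eventually_le_of_isBigO hp
  obtain ⟨Cq, hCq, hq'⟩ := exists_eventually_le_of_isBigO hq
  have hlim := (tendsto_natCast_rpow_neg hneg).const_mul
    (Cp * (D * Cq ^ (r + 1 / 2 : ℝ)) ^ a)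
  rw [mul_zero] at hlim
  refine tendsto_of_tendsto_of_tendsto_of_le_of_le' tendsto_const_nhds hlim ?_ ?_
  · filter_upwards [hx0] with n hx0
    positivity
  · filter_upwards [hp', hq', hx, hx0, eventually_gt_atTop 0] with n hpn hqn hxn hx0 hn
    have hn0 : (0 : ℝ) < n := by exact_mod_cast hn
    have h1 : D * x n ^ E * (q n : ℝ) ^ (r + 1 / 2 : ℝ) / n ^ (r + 1) ≤
        (D * Cq ^ (r + 1 / 2 : ℝ)) * (n : ℝ) ^ (η * E + ξ * (r + 1 / 2) - (r + 1)) := by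
      have e1 : (n : ℝ) ^ (η * E + ξ * (r + 1 / 2) - (r + 1)) =
          ((n : ℝ) ^ η) ^ E * ((n : ℝ) ^ ξ) ^ (r + 1 / 2 : ℝ) / n ^ (r + 1) := by
        rw [Real.rpow_sub hn0, Real.rpow_add hn0, Real.rpow_mul_natCast hn0.le,
          Real.rpow_mul hn0.le, ← Real.rpow_natCast _ (r + 1)]
        push_cast; rfl
      rw [e1]
      calc _ ≤ D * ((n : ℝ) ^ η) ^ E * (Cq * (n : ℝ) ^ ξ) ^ (r + 1 / 2 : ℝ) / n ^ (r + 1) := by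
            gcongr
        _ = _ := by rw [Real.mul_rpow hCq.le (by positivity)]; ring
    calc _ ≤ (Cp * (n : ℝ) ^ γ) * ((D * Cq ^ (r + 1 / 2 : ℝ)) *
          (n : ℝ) ^ (η * E + ξ * (r + 1 / 2) - (r + 1))) ^ a := by gcongr
      _ = _ := by
          rw [Real.mul_rpow (by positivity) (by positivity), ← Real.rpow_mul hn0.le,
            Real.rpow_add hn0, mul_comm a]
          ring

/-- 1/ε ≤ n^(1/4) gives n ε² ≥ n^(1/2), and exp(-c n^(1/2)) beats every power of n. -/
theorem tendsto_pow_mul_exp_neg {ε : ℕ → ℝ} (hε0 : ∀ n, 1 ≤ n → 0 < ε n)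
    (hx : ∀ᶠ n : ℕ in atTop, (ε n)⁻¹ ≤ (n : ℝ) ^ (1 / 4 : ℝ)) (r T : ℕ) {C c : ℝ} (hC : 0 ≤ C)
    (hc : 0 < c) :
    Tendsto (fun n : ℕ => C * (n ^ (r + 1) * (ε n)⁻¹) ^ T * Real.exp (-(c * (n * ε n ^ 2))))
      atTop (𝓝 0) := by
  have h1 := (tendsto_rpow_mul_exp_neg_mul_atTop_nhds_zero (2 * ((r + 2 : ℕ) * T : ℕ) : ℝ) c hc).comp
    (tendsto_natCast_rpow_pos (s := 1 / 2) (by norm_num))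
  have hlim := h1.const_mul C
  rw [mul_zero] at hlim
  refine tendsto_of_tendsto_of_tendsto_of_le_of_le' tendsto_const_nhds hlim ?_ ?_
  · filter_upwards [eventually_ge_atTop 1] with n hn
    have := hε0 n hn
    positivity
  · filter_upwards [hx, eventually_ge_atTop 1] with n hxn hn
    have hn1 : (1 : ℝ) ≤ n := by exact_mod_cast hn
    have hn0 : (0 : ℝ) < n := by linarith
    have hε := hε0 n hn
    simp only [Function.comp_apply]
    rw [← Real.rpow_mul hn0.le, mul_assoc]
    have h2 : (ε n)⁻¹ ≤ n := by
      refine hxn.trans ?_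
      calc (n : ℝ) ^ (1 / 4 : ℝ) ≤ (n : ℝ) ^ (1 : ℝ) :=
            Real.rpow_le_rpow_of_exponent_le hn1 (by norm_num)
        _ = n := Real.rpow_one _
    have e1 : (n : ℝ) ^ (1 / 2 * (2 * ((r + 2 : ℕ) * T : ℕ) : ℝ)) = ((n : ℝ) ^ (r + 1) * n) ^ T := by
      rw [← pow_succ, ← pow_mul, ← Real.rpow_natCast]
      congr 1; push_cast; ring
    rw [e1]
    have h3 : (n : ℝ) ^ (1 / 2 : ℝ) ≤ n * ε n ^ 2 := by
      have h4 : (ε n)⁻¹ ^ 2 ≤ (n : ℝ) ^ (1 / 2 : ℝ) := by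
        calc (ε n)⁻¹ ^ 2 ≤ ((n : ℝ) ^ (1 / 4 : ℝ)) ^ 2 := by gcongr
          _ = _ := by rw [← Real.rpow_mul_natCast hn0.le]; norm_num
      have h5 : (n : ℝ) ^ (1 / 2 : ℝ) * (n : ℝ) ^ (1 / 2 : ℝ) = n := by
        rw [← Real.rpow_add hn0]; norm_num
      rw [inv_pow, inv_le_iff_one_le_mul₀ (by positivity)] at h4
      calc (n : ℝ) ^ (1 / 2 : ℝ) ≤ (n : ℝ) ^ (1 / 2 : ℝ) * ((n : ℝ) ^ (1 / 2 : ℝ) * ε n ^ 2) :=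
            le_mul_of_one_le_right (by positivity) h4
        _ = _ := by rw [← mul_assoc, h5]
    gcongr
    linarith [mul_le_mul_of_nonneg_left h3 hc.le]

/-- The left side is O(n^ζ), whereas nε ≥ n^((1+ζ)/2), which is of larger order as ζ < 1. -/
theorem eventually_size_le {q : ℕ → ℕ} {ε : ℕ → ℝ} {ξ ζ : ℝ} (hε0 : ∀ n, 1 ≤ n → 0 < ε n)
    (hq : (fun n => (q n : ℝ)) =O[atTop] fun n : ℕ => (n : ℝ) ^ ξ) (hξζ : ξ ≤ ζ) (hζ0 : 0 ≤ ζ)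
    (hζ1 : ζ < 1) (hx : ∀ᶠ n : ℕ in atTop, (ε n)⁻¹ ≤ (n : ℝ) ^ ((1 - ζ) / 2)) {δ : ℝ}
    (hδ : 0 < δ) : ∀ᶠ n : ℕ in atTop, (n : ℝ) ^ ζ + q n + 1 ≤ δ * (n * ε n) := by
  obtain ⟨Cq, hCq, hq'⟩ := exists_eventually_le_of_isBigO hq
  have h1 := eventually_const_mul_rpow_le (2 + Cq) (s := -((1 - ζ) / 2)) (by linarith) hδ
  filter_upwards [hq', hx, h1, eventually_ge_atTop 1] with n hqn hxn h1 hn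
  have hn1 : (1 : ℝ) ≤ n := by exact_mod_cast hn
  have hn0 : (0 : ℝ) < n := by linarith
  have hε := hε0 n hn
  have h2 : (n : ℝ) ^ ξ ≤ (n : ℝ) ^ ζ := Real.rpow_le_rpow_of_exponent_le hn1 hξζ
  have h3 : 1 ≤ (n : ℝ) ^ ζ := Real.one_le_rpow hn1 hζ0
  have h4 : (n : ℝ) ^ ζ + q n + 1 ≤ (2 + Cq) * (n : ℝ) ^ ζ := by
    have := mul_le_mul_of_nonneg_left h2 hCq.le
    linarith
  have h5 : (n : ℝ) ^ ζ = (n : ℝ) ^ (-((1 - ζ) / 2)) * (n * (n : ℝ) ^ (-((1 - ζ) / 2))) := by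
    rw [mul_left_comm, ← Real.rpow_add hn0]
    nth_rewrite 2 [← Real.rpow_one (n : ℝ)]
    rw [← Real.rpow_add hn0]; congr 1; ring
  have h6 : (n : ℝ) ^ (-((1 - ζ) / 2)) ≤ ε n := by
    rw [Real.rpow_neg hn0.le]
    exact inv_le_of_inv_le₀ hε hxn
  calc _ ≤ _ := h4
    _ = ((2 + Cq) * (n : ℝ) ^ (-((1 - ζ) / 2))) * (n * (n : ℝ) ^ (-((1 - ζ) / 2))) := by
        rw [h5]; ring
    _ ≤ δ * (n * ε n) := by gcongr

/-- The logarithm of the number of models is of order at most q log(p + 1), that is n^ξ' log n with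
ξ' = max(ξ, 0) < ζ, so exp(-n^ζ/4) prevails. -/
theorem tendsto_union_bound {p q : ℕ → ℕ} {γ ξ ζ : ℝ} (T : ℕ)
    (hp : (fun n => (p n : ℝ)) =O[atTop] fun n : ℕ => (n : ℝ) ^ γ)
    (hq : (fun n => (q n : ℝ)) =O[atTop] fun n : ℕ => (n : ℝ) ^ ξ) (hξζ : ξ < ζ) (hζ0 : 0 < ζ) :
    Tendsto (fun n : ℕ => Real.exp 1 * (p n + 1 : ℝ) ^ q n *
      (Real.exp (-(n : ℝ) ^ ζ / 4) * √2 ^ (q n + T))) atTop (𝓝 0) := by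
  obtain ⟨Cp, hCp, hp'⟩ := exists_eventually_le_of_isBigO hp
  obtain ⟨Cq, hCq, hq'⟩ := exists_eventually_le_of_isBigO hq
  -- ξ may be negative; with ξ' ≥ 0 the constant T too is bounded by a multiple of n^ξ'.
  set ξ' := max ξ 0 with hξ'
  have hξ'ζ : ξ' < ζ := max_lt hξζ hζ0
  set η := (ζ - ξ') / 2 with hη
  have hη0 : 0 < η := by rw [hη]; linarith
  set g := |γ| + 1 with hg
  have hg0 : 0 < g := by positivity
  have hlog : ∀ᶠ n : ℕ in atTop, Real.log n ≤ (n : ℝ) ^ η := by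
    have := ((isLittleO_log_rpow_atTop hη0).comp_tendsto tendsto_natCast_atTop_atTop).bound one_pos
    filter_upwards [this] with n hn
    simp only [Function.comp_apply, one_mul] at hn
    rw [Real.norm_of_nonneg (by positivity : 0 ≤ (n : ℝ) ^ η)] at hn
    exact (le_abs_self _).trans hn
  have hpow : ∀ᶠ n : ℕ in atTop, (p n + 1 : ℝ) ≤ (n : ℝ) ^ g := by
    filter_upwards [hp', eventually_ge_atTop (⌈Cp + 1⌉₊ + 1)] with n hpn hn
    have hn1 : (1 : ℝ) ≤ n := by exact_mod_cast (by omega : 1 ≤ n)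
    have hn0 : (0 : ℝ) < n := by linarith
    have h1 : Cp + 1 ≤ n := (Nat.le_ceil _).trans (by exact_mod_cast (by omega : ⌈Cp + 1⌉₊ ≤ n))
    have h2 : (n : ℝ) ^ γ ≤ (n : ℝ) ^ |γ| := Real.rpow_le_rpow_of_exponent_le hn1 (le_abs_self γ)
    have h3 : 1 ≤ (n : ℝ) ^ |γ| := Real.one_le_rpow hn1 (abs_nonneg _)
    calc (p n + 1 : ℝ) ≤ Cp * (n : ℝ) ^ |γ| + (n : ℝ) ^ |γ| := by
          linarith [mul_le_mul_of_nonneg_left h2 hCp.le]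
      _ = (Cp + 1) * (n : ℝ) ^ |γ| := by ring
      _ ≤ n * (n : ℝ) ^ |γ| := by gcongr
      _ = _ := by rw [hg, Real.rpow_add hn0, Real.rpow_one, mul_comm]
  have hsmall := eventually_const_mul_rpow_le (Cq * g + Cq + T) (s := -η) (by linarith)
    (by norm_num : (0 : ℝ) < 1 / 8)
  have hlim : Tendsto (fun n : ℕ => Real.exp 1 * Real.exp (-((n : ℝ) ^ ζ / 8))) atTop (𝓝 0) := by
    have h1 : Tendsto (fun n : ℕ => (n : ℝ) ^ ζ / 8) atTop atTop :=
      (tendsto_natCast_rpow_pos hζ0).atTop_div_const (by norm_num)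
    have := (Real.tendsto_exp_neg_atTop_nhds_zero.comp h1).const_mul (Real.exp 1)
    simpa using this
  refine tendsto_of_tendsto_of_tendsto_of_le_of_le' tendsto_const_nhds hlim ?_ ?_
  · exact Eventually.of_forall fun n => by positivity
  · filter_upwards [hq', hlog, hpow, hsmall, eventually_ge_atTop 1] with n hqn hlog hpow hsmall hn
    have hn1 : (1 : ℝ) ≤ n := by exact_mod_cast hn
    have hn0 : (0 : ℝ) < n := by linarith
    have hq1 : (q n : ℝ) ≤ Cq * (n : ℝ) ^ ξ' :=
      hqn.trans (by gcongr; exact le_max_left _ _)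
    have h1 : Real.log (p n + 1) ≤ g * (n : ℝ) ^ η := by
      calc Real.log (p n + 1) ≤ Real.log ((n : ℝ) ^ g) := Real.log_le_log (by positivity) hpow
        _ = g * Real.log n := Real.log_rpow hn0 g
        _ ≤ _ := by gcongr
    have e1 : (p n + 1 : ℝ) ^ q n = Real.exp (q n * Real.log (p n + 1)) := by
      rw [Real.exp_nat_mul, Real.exp_log (by positivity)]
    have h2 : √2 ^ (q n + T) ≤ Real.exp (q n + T) := by
      have : √2 ≤ Real.exp 1 := by
        have := Real.add_one_le_exp (1 : ℝ)
        have h22 : √2 ≤ 2 := Real.sqrt_le_iff.2 ⟨by norm_num, by norm_num⟩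
        linarith
      calc √2 ^ (q n + T) ≤ (Real.exp 1) ^ (q n + T) := by gcongr
        _ = _ := by rw [← Real.exp_nat_mul]; push_cast; rw [mul_one]
    have h3 : 1 ≤ (n : ℝ) ^ ξ' := Real.one_le_rpow hn1 (le_max_right _ _)
    have h4 : 1 ≤ (n : ℝ) ^ η := Real.one_le_rpow hn1 hη0.le
    have h5 : q n * Real.log (p n + 1) + (q n + T) ≤
        (Cq * g + Cq + T) * ((n : ℝ) ^ ξ' * (n : ℝ) ^ η) := by
      have i1 : q n * Real.log (p n + 1) ≤ Cq * (n : ℝ) ^ ξ' * (g * (n : ℝ) ^ η) := by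
        refine mul_le_mul hq1 h1 (Real.log_nonneg ?_) (by positivity)
        linarith [Nat.cast_nonneg (α := ℝ) (p n)]
      have i2 : (q n : ℝ) ≤ Cq * ((n : ℝ) ^ ξ' * (n : ℝ) ^ η) :=
        hq1.trans (by gcongr; exact le_mul_of_one_le_right (by positivity) h4)
      have i3 : (T : ℝ) ≤ T * ((n : ℝ) ^ ξ' * (n : ℝ) ^ η) :=
        le_mul_of_one_le_right (Nat.cast_nonneg _) (one_le_mul_of_one_le_of_one_le h3 h4)
      linarith
    have e2 : (n : ℝ) ^ ξ' * (n : ℝ) ^ η = (n : ℝ) ^ (-η) * (n : ℝ) ^ ζ := by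
      rw [← Real.rpow_add hn0, ← Real.rpow_add hn0]; congr 1; rw [hη]; ring
    have h6 : q n * Real.log (p n + 1) + (q n + T) ≤ (n : ℝ) ^ ζ / 8 := by
      refine h5.trans ?_
      rw [e2, ← mul_assoc]
      calc _ ≤ 1 / 8 * (n : ℝ) ^ ζ := by gcongr
        _ = _ := by ring
    calc _ ≤ Real.exp 1 * Real.exp (q n * Real.log (p n + 1)) *
          (Real.exp (-(n : ℝ) ^ ζ / 4) * Real.exp (q n + T)) := by rw [e1]; gcongr
      _ = Real.exp 1 * Real.exp (q n * Real.log (p n + 1) + (q n + T) - (n : ℝ) ^ ζ / 4) := by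
          rw [mul_assoc, ← Real.exp_add, ← Real.exp_add]; congr 2; ring
      _ ≤ _ := by
          gcongr
          linarith

theorem exp_neg_one_mul_sqrt_two_lt_one : Real.exp (-1) * √2 < 1 := by
  have h1 : √2 < Real.exp 1 := by
    have := Real.add_one_lt_exp (one_ne_zero : (1 : ℝ) ≠ 0)
    have h22 : √2 ≤ 2 := Real.sqrt_le_iff.2 ⟨by norm_num, by norm_num⟩
    linarith
  rw [Real.exp_neg, inv_mul_lt_iff₀ (Real.exp_pos _)]
  linarith

theorem exp_div_sqrt_lt_one : Real.exp (9 / 200) / √(11 / 10) < 1 := by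
  rw [div_lt_one (Real.sqrt_pos.2 (by norm_num)), Real.lt_sqrt (Real.exp_pos _).le,
    ← Real.exp_nat_mul, ← Real.lt_log_iff_exp_lt (by norm_num)]
  -- The bound 2x/(x + 2) ≤ log(1 + x) gives log 1.1 ≥ 2/21 > 9/100.
  have h := Real.le_log_one_add_of_nonneg (x := 1 / 10) (by norm_num)
  norm_num at h ⊢
  linarith

/-! ### Selection consistency -/

/-- A bound on the ratio of two consecutive terms when marginal densities of models of size at most
`q` are compared with that of the true model. -/
noncomputable def growthFactor (r : ℕ) (C D : ℝ) (T n : ℕ) (ε : ℝ) (q : ℕ) : ℝ :=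
  absorbConst r C D T * (ε⁻¹) ^ ((2 * r + 2) * T + (2 * r + 1)) *
    (q : ℝ) ^ (r + 1 / 2 : ℝ) / n ^ (r + 1)

theorem growthFactor_nonneg {r T n q : ℕ} {C D ε : ℝ} (hC : 0 ≤ C) (hD : 0 ≤ D) (hε : 0 ≤ ε) :
    0 ≤ growthFactor r C D T n ε q := by
  have := hD.trans (le_absorbConst (r := r) hC hD T)
  unfold growthFactor
  positivity

/-- The models of size at most `q` that strictly contain `t`. -/
def properSupermodels {p : ℕ} (t : Finset (Fin p)) (q : ℕ) : Finset (Finset (Fin p)) :=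
  Finset.univ.filter fun k => t ⊂ k ∧ k.card ≤ q

/-- The deterministic step. Strict supersets of t are controlled by the sum of powers 3/4, all other
models by the exponentially small factor together with the sum of θ^|k| over all models, which is (1
+ θ)^p ≤ exp(pθ). -/
theorem dist_posterior_le_of_ratio_le {n p q r T : ℕ} {α₁ α₂ v w s C D c ε : ℝ}
    {X : Matrix (Fin n) (Fin p) ℝ} {A : Matrix (Fin p) (Fin p) ℝ}
    {prior : PMF (Finset (Fin p))} {t : Finset (Fin p)} {y e : Fin n → ℝ}
    (hw : 0 < w) (hC : 0 ≤ C) (hD : 0 ≤ D) (hε0 : 0 < ε) (hε1 : ε < 1)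
    (hodds : ∀ k, 0 < prior k → w < (prior t).toReal / (prior k).toReal)
    (hprior : ∀ k, q < k.card → prior k = 0)
    (hpos : 0 < marginal r α₁ α₂ X A t y) (hfin : marginal r α₁ α₂ X A t y < ∞)
    (hratio : ∀ k : Finset (Fin p), k.card ≤ q →
      (t ⊆ k → marginal r α₁ α₂ X A k y ≤
        ENNReal.ofReal (ratioWeight r C D T n ε k.card * Real.exp (7 / (12 * v) *
          ‖(extraSpace X t k).starProjection (WithLp.toLp 2 e)‖ ^ 2)) *
          marginal r α₁ α₂ X A t y) ∧
      (¬ t ⊆ k → marginal r α₁ α₂ X A k y ≤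
        ENNReal.ofReal (ratioWeight r C D T n ε k.card * Real.exp (-(c * (n * ε ^ 2)))) *
          marginal r α₁ α₂ X A t y))
    (hs1 : s ≤ 1)
    (hs : ∑ k ∈ properSupermodels t q, (ratioWeight r C D T n ε k.card * Real.exp (7 / (12 * v) *
      ‖(extraSpace X t k).starProjection (WithLp.toLp 2 e)‖ ^ 2)) ^ (3 / 4 : ℝ) ≤ s) :
    dist (posterior r α₁ α₂ X A prior t y) 1 ≤
      (s + C * (n ^ (r + 1) * ε⁻¹) ^ T * Real.exp (-(c * (n * ε ^ 2))) *
        Real.exp (p * growthFactor r C D T n ε q)) / w := by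
  classical
  set f : Finset (Fin p) → ℝ := fun k => ratioWeight r C D T n ε k.card *
    Real.exp (7 / (12 * v) * ‖(extraSpace X t k).starProjection (WithLp.toLp 2 e)‖ ^ 2) with hf
  set g : Finset (Fin p) → ℝ := fun k =>
    ratioWeight r C D T n ε k.card * Real.exp (-(c * (n * ε ^ 2))) with hg
  set θ := growthFactor r C D T n ε q with hθ
  have hθ0 : 0 ≤ θ := growthFactor_nonneg hC hD hε0.le
  have hf0 : ∀ k, 0 ≤ f k := fun k =>
    mul_nonneg (ratioWeight_nonneg hC hD hε0.le) (Real.exp_pos _).le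
  have hg0 : ∀ k, 0 ≤ g k := fun k =>
    mul_nonneg (ratioWeight_nonneg hC hD hε0.le) (Real.exp_pos _).le
  have hsize : ∀ k, 0 < prior k → k.card ≤ q := fun k hk => by
    by_contra h
    exact hk.ne' (hprior k (not_le.1 h))
  refine dist_posterior_le hw hodds hpos hfin (ρ := fun k => if t ⊆ k then f k else g k)
    (fun k => by split_ifs; exacts [hf0 k, hg0 k]) (fun k _ hk => ?_) ?_
  · split_ifs with h
    exacts [(hratio k (hsize k hk)).1 h, (hratio k (hsize k hk)).2 h]
  · rw [Finset.sum_ite]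
    refine add_le_add ?_ ?_
    · refine le_trans (Finset.sum_le_sum_of_subset_of_nonneg (fun k hk => ?_)
        fun k _ _ => hf0 k) (sum_le_of_sum_rpow_le (fun k _ => hf0 k) hs1 hs)
      simp only [Finset.mem_filter, Finset.mem_univ, true_and] at hk
      exact Finset.mem_filter.2 ⟨Finset.mem_univ _,
        Finset.ssubset_iff_subset_ne.2 ⟨hk.2, hk.1.1.symm⟩, hsize k hk.1.2⟩
    · set M := C * (n ^ (r + 1) * ε⁻¹) ^ T with hM
      have hM0 : 0 ≤ M := by positivity
      calc _ ≤ ∑ k ∈ Finset.univ.filter (fun k : Finset (Fin p) => k.card ≤ q), g k := by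
            refine Finset.sum_le_sum_of_subset_of_nonneg (fun k hk => ?_) fun k _ _ => hg0 k
            simp only [Finset.mem_filter, Finset.mem_univ, true_and] at hk ⊢
            exact hsize k hk.1.2
        _ ≤ ∑ k ∈ Finset.univ.filter (fun k : Finset (Fin p) => k.card ≤ q),
              M * Real.exp (-(c * (n * ε ^ 2))) * θ ^ k.card := by
            refine Finset.sum_le_sum fun k hk => ?_
            have h := ratioWeight_le_of_le (r := r) (T := T) (n := n) hC hD
              (le_absorbConst (r := r) hC hD T) hε0 hε1 (Finset.mem_filter.1 hk).2
              (E := (2 * r + 2) * T + (2 * r + 1)) (by omega)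
            calc g k ≤ M * θ ^ k.card * Real.exp (-(c * (n * ε ^ 2))) :=
                  mul_le_mul_of_nonneg_right h (Real.exp_pos _).le
              _ = _ := by ring
        _ ≤ ∑ k : Finset (Fin p), M * Real.exp (-(c * (n * ε ^ 2))) * θ ^ k.card :=
            Finset.sum_le_sum_of_subset_of_nonneg (Finset.filter_subset _ _)
              fun k _ _ => by positivity
        _ = M * Real.exp (-(c * (n * ε ^ 2))) * (1 + θ) ^ p := by
            rw [← Finset.mul_sum, sum_pow_card]
        _ ≤ _ := by
            gcongr
            exact one_add_pow_le_exp hθ0 p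

theorem card_modelOf {p : ℕ} {t : Finset ℕ} (ht : ∀ j ∈ t, j < p) :
    (modelOf p t).card = t.card := by
  refine Finset.card_bij (fun j _ => (j : ℕ)) (fun j hj => (Finset.mem_filter.1 hj).2)
    (fun i _ j _ h => Fin.ext h) fun j hj => ?_
  exact ⟨⟨j, ht j hj⟩, Finset.mem_filter.2 ⟨Finset.mem_univ _, hj⟩, rfl⟩

theorem dotProduct_self_le_sum_of_support {p : ℕ} {t : Finset ℕ} {β : ℕ → ℝ}
    (hβ : ∀ j ∉ t, β j = 0) :
    (fun j : Fin p => β j) ⬝ᵥ (fun j : Fin p => β j) ≤ ∑ j ∈ t, β j ^ 2 := by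
  have h1 : (fun j : Fin p => β j) ⬝ᵥ (fun j : Fin p => β j) = ∑ j ∈ Finset.range p, β j ^ 2 := by
    rw [Finset.sum_range]
    exact Finset.sum_congr rfl fun j _ => (sq _).symm
  rw [h1]
  calc ∑ j ∈ Finset.range p, β j ^ 2 = ∑ j ∈ (Finset.range p).filter (· ∈ t), β j ^ 2 := by
        refine (Finset.sum_filter_of_ne fun j _ h => ?_).symm
        by_contra hj
        exact h (by rw [hβ j hj]; ring)
    _ ≤ _ := Finset.sum_le_sum_of_subset_of_nonneg
        (fun j hj => (Finset.mem_filter.1 hj).2) fun _ _ _ => sq_nonneg _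

theorem exists_pos_le_abs {t : Finset ℕ} {β : ℕ → ℝ} (hβ : ∀ j ∈ t, β j ≠ 0) :
    ∃ b : ℝ, 0 < b ∧ ∀ j ∈ t, b ≤ |β j| := by
  rcases t.eq_empty_or_nonempty with rfl | h
  · exact ⟨1, one_pos, by simp⟩
  · obtain ⟨i, hi, hmin⟩ := t.exists_min_image (fun j => |β j|) h
    exact ⟨|β i|, abs_pos.2 (hβ i hi), hmin⟩

/-- If t were larger than q it would have prior mass 0, and its odds against a model in the support
would be 0. -/
theorem card_le_of_odds {p q : ℕ} {prior : PMF (Finset (Fin p))} {t : Finset (Fin p)} {w : ℝ}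
    (hw : 0 < w) (hodds : ∀ k, 0 < prior k → w < (prior t).toReal / (prior k).toReal)
    (hprior : ∀ k, q < k.card → prior k = 0) : t.card ≤ q := by
  by_contra h
  obtain ⟨k, hk⟩ := prior.support_nonempty
  have := hodds k (pos_iff_ne_zero.2 ((PMF.mem_support_iff _ _).1 hk))
  rw [hprior t (not_le.1 h)] at this
  simp at this
  linarith

/-- The maximum with 1 keeps the upper constant positive: for an empty matrix there are no
eigenvalues to force a₂ > 0. -/
theorem quadBound_of_eigenvalues {p : ℕ} {A : Matrix (Fin p) (Fin p) ℝ} {a₁ a₂ : ℝ}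
    (hA : ∃ h : A.IsHermitian, ∀ i, a₁ < h.eigenvalues i ∧ h.eigenvalues i < a₂) :
    QuadBound A a₁ (max a₂ 1) := by
  obtain ⟨h, hi⟩ := hA
  exact ⟨h, fun x => ⟨le_quadForm h (fun i => (hi i).1.le) x,
    quadForm_le h (fun i => (hi i).2.le.trans (le_max_left _ _)) x⟩⟩

/-- The hypothesis says γ < (3/4) r (1 - ξ), and u = ξ(r + 1/2) - (r + 1) is below -r (1 - ξ)
because ξ < 1. So γ + (3/4)u < 0 and a fortiori γ + u < 0, with room for a small power n^(ηE) that
covers the powers of 1/ε. -/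
theorem exists_exponent {r : ℕ} {γ ξ : ℝ} (hr : 1 ≤ r) (hξ : ξ < 1)
    (hξγ : ξ < 1 - 4 * γ / (3 * r)) (E : ℕ) :
    ∃ η : ℝ, 0 < η ∧ γ + 3 / 4 * (η * E + ξ * (r + 1 / 2) - (r + 1)) < 0 ∧
      γ + 1 * (η * E + ξ * (r + 1 / 2) - (r + 1)) < 0 := by
  have hr0 : (1 : ℝ) ≤ r := by exact_mod_cast hr
  have h1 : γ < 3 / 4 * (r * (1 - ξ)) := by
    have h : 4 * γ / (3 * r) < 1 - ξ := by linarith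
    rw [div_lt_iff₀ (by linarith)] at h
    linarith
  set u := ξ * (r + 1 / 2) - (r + 1) with hu
  have hu0 : u < 0 := by nlinarith
  have hu1 : γ + 3 / 4 * u < 0 := by rw [hu]; linarith
  set g := min (-u) (-(γ + 3 / 4 * u)) with hg
  have hg0 : 0 < g := lt_min (by linarith) (by linarith)
  have hgu : g ≤ -u := min_le_left _ _
  have hgv : g ≤ -(γ + 3 / 4 * u) := min_le_right _ _
  have hE : g / (E + 1 : ℝ) * E < g := by
    rw [div_mul_eq_mul_div, div_lt_iff₀ (by positivity)]
    linarith
  refine ⟨g / (E + 1), by positivity, ?_, ?_⟩ <;>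
  · rw [add_sub_assoc]
    linarith

theorem properSupermodels_weight_le {p q r T n : ℕ} {C D ε : ℝ} {t k : Finset (Fin p)}
    (hn : 1 ≤ n) (hC : 0 ≤ C) (hD : 0 ≤ D) (hε0 : 0 < ε) (hε1 : ε < 1) (ht : t.card = T)
    (hk : k ∈ properSupermodels t q) :
    ratioWeight r C D T n ε k.card ≤ growthFactor r C D T n ε q ^ (k \ t).card := by
  obtain ⟨-, htk, hkq⟩ := Finset.mem_filter.1 hk
  have h1 : T + (k \ t).card = k.card := by
    rw [← ht, add_comm]
    exact Finset.card_sdiff_add_card_eq_card htk.subset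
  have h2 : t.card < k.card := Finset.card_lt_card htk
  rw [← h1]
  exact ratioWeight_le_pow hn hC hD hε0 hε1 (by omega) (by omega)

/-- Four exceptional events: errors too long, too short, too large a projection for some model, or
too large a sum over strict supersets. Outside their union the deterministic bounds apply. -/
theorem measure_le_dist_posterior {Ω : Type*} [MeasurableSpace Ω] {P : Measure Ω}
    [IsProbabilityMeasure P] {n p q r T : ℕ} {α₁ α₂ w s C D c δ ε h : ℝ} {v : ℝ≥0} (hv : v ≠ 0)
    {X : Matrix (Fin n) (Fin p) ℝ} {A : Matrix (Fin p) (Fin p) ℝ}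
    {prior : PMF (Finset (Fin p))} {t : Finset (Fin p)} {x : Fin p → ℝ} {E : Fin n → Ω → ℝ}
    (hlaw : ∀ i, HasLaw (E i) (gaussianReal 0 v) P) (hind : iIndepFun E P)
    (hn : 1 ≤ n) (hw : 0 < w) (hC : 0 ≤ C) (hD : 0 ≤ D) (hε0 : 0 < ε) (hε1 : ε < 1)
    (htT : t.card = T)
    (hodds : ∀ k, 0 < prior k → w < (prior t).toReal / (prior k).toReal)
    (hprior : ∀ k, q < k.card → prior k = 0)
    (hbound : ∀ e : Fin n → ℝ,
      ‖WithLp.toLp 2 e‖ ^ 2 ≤ 4 * n * v → 9 / 10 * n * v ≤ ‖WithLp.toLp 2 e‖ ^ 2 →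
      (∀ k : Finset (Fin p), k.card ≤ q →
        ‖(colSpace X (k ∪ t)).starProjection (WithLp.toLp 2 e)‖ ^ 2 ≤ v * h) →
      0 < marginal r α₁ α₂ X A t (X *ᵥ x + e) ∧ marginal r α₁ α₂ X A t (X *ᵥ x + e) < ∞ ∧
      ∀ k : Finset (Fin p), k.card ≤ q →
        (t ⊆ k → marginal r α₁ α₂ X A k (X *ᵥ x + e) ≤
          ENNReal.ofReal (ratioWeight r C D T n ε k.card * Real.exp (7 / (12 * v) *
            ‖(extraSpace X t k).starProjection (WithLp.toLp 2 e)‖ ^ 2)) *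
            marginal r α₁ α₂ X A t (X *ᵥ x + e)) ∧
        (¬ t ⊆ k → marginal r α₁ α₂ X A k (X *ᵥ x + e) ≤
          ENNReal.ofReal (ratioWeight r C D T n ε k.card * Real.exp (-(c * (n * ε ^ 2)))) *
            marginal r α₁ α₂ X A t (X *ᵥ x + e)))
    (hs0 : 0 < s) (hs1 : s ≤ 1)
    (hδ : (s + C * (n ^ (r + 1) * ε⁻¹) ^ T * Real.exp (-(c * (n * ε ^ 2))) *
        Real.exp (p * growthFactor r C D T n ε q)) / w < δ) :
    P {ω | δ ≤ dist (posterior r α₁ α₂ X A prior t (X *ᵥ x + fun i => E i ω)) 1} ≤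
      ENNReal.ofReal ((Real.exp (-1) * √2) ^ n) +
      ENNReal.ofReal ((Real.exp (9 / 200) / √(11 / 10)) ^ n) +
      ENNReal.ofReal (Real.exp 1 * (p + 1) ^ q * (Real.exp (-h / 4) * √2 ^ (q + T))) +
      ENNReal.ofReal
        ((Real.exp (p * (growthFactor r C D T n ε q ^ (3 / 4 : ℝ) * √8)) - 1) / s) := by
  have h1 := measure_le_norm_sq (P := P) hv hlaw hind
  have h2 := measure_norm_sq_le (P := P) hv hlaw hind
  have h3 := measure_exists_projection_le (P := P) (X := X) hv hlaw hind t q h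
  have h4 := measure_le_sum_ssuperset (P := P) (X := X) hv hlaw hind
    (W := fun k => ratioWeight r C D T n ε k.card) (θ := growthFactor r C D T n ε q)
    (properSupermodels t q) (fun k hk => (Finset.mem_filter.1 hk).2.1)
    (fun k _ => ratioWeight_nonneg hC hD hε0.le) (growthFactor_nonneg hC hD hε0.le)
    (fun k hk => properSupermodels_weight_le hn hC hD hε0 hε1 htT hk) hs0
  rw [Fintype.card_fin] at h2
  rw [htT] at h3
  refine le_trans (measure_mono (fun ω hω => ?_)) <|
    ((measure_union_le _ _).trans (add_le_add ((measure_union_le _ _).trans (add_le_add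
      ((measure_union_le _ _).trans (add_le_add h1 h2)) h3)) h4))
  by_contra hcon
  simp only [Set.mem_union, Set.mem_ofPred_eq, not_or, not_le, not_exists, not_and] at hcon hω
  obtain ⟨⟨⟨g1, g2⟩, g3⟩, g4⟩ := hcon
  have hnorm : ‖WithLp.toLp 2 fun i => E i ω‖ ^ 2 = ∑ i, E i ω ^ 2 := by
    simp [EuclideanSpace.norm_sq_eq]
  obtain ⟨m0, m1, m2⟩ := hbound (fun i => E i ω) g1.le (by rw [hnorm]; exact g2.le)
    fun k hk => (g3 k hk).le
  have := dist_posterior_le_of_ratio_le hw hC hD hε0 hε1 hodds hprior m0 m1 m2 hs1 g4.le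
  linarith

end HyperPMOM

theorem theorem2
    {Ω : Type*} [MeasurableSpace Ω] (P : Measure Ω) [IsProbabilityMeasure P]
    -- order of the pMOM density, and hyperparameters of the prior on `σ²`
    (r : ℕ) (hr : 1 ≤ r) (α₁ α₂ : ℝ) (hα₁ : 0 < α₁) (hα₂ : 0 < α₂)
    -- dimension and design matrix, for each sample size `n`
    (p : ℕ → ℕ) (X : ∀ n, Matrix (Fin n) (Fin (p n)) ℝ)
    -- true model, true coefficients and true error variance, not depending on `n`
    (t : Finset ℕ) (β₀ : ℕ → ℝ) (hβ₀ : ∀ j, β₀ j ≠ 0 ↔ j ∈ t)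
    (ht : ∀ n, 1 ≤ n → ∀ j ∈ t, j < p n)
    (σ₀sq : ℝ≥0) (hσ₀ : 0 < σ₀sq)
    -- for each `n`, errors that are i.i.d. `N(0, σ₀²)`
    (e : ∀ n, Fin n → Ω → ℝ)
    (he_law : ∀ n i, HasLaw (e n i) (gaussianReal 0 σ₀sq) P)
    (he_indep : ∀ n, iIndepFun (e n) P)
    -- scale matrix of the pMOM prior, and prior on the space of models
    (A : ∀ n, Matrix (Fin (p n)) (Fin (p n)) ℝ)
    (prior : ∀ n, PMF (Finset (Fin (p n))))
    (q : ℕ → ℕ) (ξ γ : ℝ)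
    -- eigenvalues of the Gram matrices
    (ε : ℕ → ℝ) (hε_pos : ∀ n, 1 ≤ n → 0 < ε n) (hε_lt : ∀ n, 1 ≤ n → ε n < 1)
    (hε : (fun n => (ε n)⁻¹) =O[atTop] fun n : ℕ => Real.log n ^ (1 / 8 : ℝ))
    (hX : ∀ n, 1 ≤ n → ∀ k : Finset (Fin (p n)), k.card ≤ q n + t.card →
      HyperPMOM.EigenvalueBound (X n) (ε n) k)
    -- growth of the dimension
    (hp : (fun n => (p n : ℝ)) =O[atTop] fun n : ℕ => (n : ℝ) ^ γ) (hγ : γ < r)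
    -- no prior mass on models that are too large
    (hq : (fun n => (q n : ℝ)) =O[atTop] fun n : ℕ => (n : ℝ) ^ ξ) (hξ : ξ < 1)
    (hprior : ∀ n, 1 ≤ n → ∀ k : Finset (Fin (p n)), q n < k.card → prior n k = 0)
    -- prior odds of the true model bounded below
    (w : ℝ) (hw : 0 < w)
    (hodds : ∀ n, 1 ≤ n → ∀ k : Finset (Fin (p n)), 0 < prior n k →
      w < (prior n (HyperPMOM.modelOf (p n) t)).toReal / (prior n k).toReal)
    -- eigenvalues of the scale matrix
    (a₁ a₂ : ℝ) (ha₁ : 0 < a₁)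
    (hA : ∀ n, 1 ≤ n → ∃ h : (A n).IsHermitian, ∀ i, a₁ < h.eigenvalues i ∧ h.eigenvalues i < a₂)
    -- additional restriction on the model size
    (hξγ : ξ < 1 - 4 * γ / (3 * r)) :
    TendstoInMeasure P
      (fun n ω => HyperPMOM.posterior r α₁ α₂ (X n) (A n) (prior n)
        (HyperPMOM.modelOf (p n) t)
        (HyperPMOM.response (X n) β₀ (fun i => e n i ω)))
      atTop (fun _ => 1) := by
  classical
  have hv : σ₀sq ≠ 0 := hσ₀.ne'
  obtain ⟨b, hb, hbt⟩ := HyperPMOM.exists_pos_le_abs fun j hj => (hβ₀ j).2 hj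
  have hβ0 : ∀ j ∉ t, β₀ j = 0 := fun j hj => by
    by_contra h
    exact hj ((hβ₀ j).1 h)
  obtain ⟨C, D, c, δ, hC, hD, hc, hδ, hmain⟩ := HyperPMOM.exists_ratio_bound hr hα₁ hα₂ ha₁
    (lt_max_of_lt_right one_pos : 0 < max a₂ 1) (NNReal.coe_pos.2 hσ₀) hb
    (Finset.sum_nonneg fun j _ => sq_nonneg (β₀ j) : 0 ≤ ∑ j ∈ t, β₀ j ^ 2) t.card
  -- n^ζ is the threshold for the projected errors: large enough for the union bound (ζ > ξ),
  -- negligible against nε (ζ < 1).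
  obtain ⟨ζ, hζ, hζ1⟩ := exists_between (max_lt hξ one_pos)
  obtain ⟨hξζ, hζ0⟩ := max_lt_iff.1 hζ
  obtain ⟨η, hη, hη1, hη2⟩ :=
    HyperPMOM.exists_exponent hr hξ hξγ ((2 * r + 2) * t.card + (2 * r + 1))
  have hx0 : ∀ᶠ n : ℕ in atTop, 0 ≤ (ε n)⁻¹ := by
    filter_upwards [eventually_ge_atTop 1] with n hn
    exact (inv_pos.2 (hε_pos n hn)).le
  have habs : 0 ≤ HyperPMOM.absorbConst r C D t.card :=
    hD.le.trans (HyperPMOM.le_absorbConst hC.le hD.le _)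
  set θ : ℕ → ℝ := fun n => HyperPMOM.growthFactor r C D t.card n (ε n) (q n) with hθ
  have hθ1 : Tendsto (fun n => (p n : ℝ) * θ n) atTop (𝓝 0) := by
    have := HyperPMOM.tendsto_mul_rpow_zero habs hp hq
      (HyperPMOM.eventually_inv_le_rpow hε hη) hx0 one_pos hη2
    simp only [Real.rpow_one] at this
    exact this
  have hθ2 : Tendsto (fun n => (p n : ℝ) * (θ n ^ (3 / 4 : ℝ) * √8)) atTop (𝓝 0) := by
    have := (HyperPMOM.tendsto_mul_rpow_zero habs hp hq
      (HyperPMOM.eventually_inv_le_rpow hε hη) hx0 (by norm_num) hη1).mul_const √8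
    rw [zero_mul] at this
    exact this.congr fun n => mul_assoc _ _ _
  have hdet := (HyperPMOM.tendsto_pow_mul_exp_neg hε_pos
    (HyperPMOM.eventually_inv_le_rpow hε (by norm_num)) r t.card hC.le hc).mul
    (Real.continuous_exp.tendsto 0 |>.comp hθ1)
  rw [zero_mul] at hdet
  rw [tendstoInMeasure_iff_dist]
  intro κ hκ
  -- The two contributions to the distance are at most wκ/4 each before division by w, so the total
  -- is strictly less than κ; the cap 1 is needed to pass from powers 3/4 to the terms themselves.
  set s := min 1 (w * κ / 4) with hs
  have hs0 : 0 < s := lt_min one_pos (by positivity)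
  have hsκ : s ≤ w * κ / 4 := min_le_right _ _
  have hlim : Tendsto (fun n : ℕ => ENNReal.ofReal ((Real.exp (-1) * √2) ^ n) +
      ENNReal.ofReal ((Real.exp (9 / 200) / √(11 / 10)) ^ n) +
      ENNReal.ofReal (Real.exp 1 * (p n + 1) ^ q n *
        (Real.exp (-(n : ℝ) ^ ζ / 4) * √2 ^ (q n + t.card))) +
      ENNReal.ofReal ((Real.exp (p n * (θ n ^ (3 / 4 : ℝ) * √8)) - 1) / s)) atTop (𝓝 0) := by
    have l1 := ENNReal.tendsto_ofReal (tendsto_pow_atTop_nhds_zero_of_lt_one (by positivity)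
      HyperPMOM.exp_neg_one_mul_sqrt_two_lt_one)
    have l2 := ENNReal.tendsto_ofReal (tendsto_pow_atTop_nhds_zero_of_lt_one (by positivity)
      HyperPMOM.exp_div_sqrt_lt_one)
    have l3 := ENNReal.tendsto_ofReal (HyperPMOM.tendsto_union_bound t.card hp hq hξζ hζ0)
    have l4 := ENNReal.tendsto_ofReal
      ((((Real.continuous_exp.tendsto 0).comp hθ2).sub_const 1).div_const s)
    simpa using ((l1.add l2).add l3).add l4
  refine tendsto_of_tendsto_of_tendsto_of_le_of_le' tendsto_const_nhds hlim
    (Eventually.of_forall fun _ => zero_le) ?_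
  filter_upwards [eventually_ge_atTop 1,
    HyperPMOM.eventually_size_le hε_pos hq hξζ.le hζ0.le hζ1
      (HyperPMOM.eventually_inv_le_rpow hε (by linarith)) hδ,
    -- This second use, with 1/2, gives 2q ≤ n. Since |t| ≤ q, all models of size at most q + |t|
    -- then have at most n columns, as `EigenvalueBound.designBound` requires.
    HyperPMOM.eventually_size_le hε_pos hq hξζ.le hζ0.le hζ1
      (HyperPMOM.eventually_inv_le_rpow hε (by linarith)) (by norm_num : (0 : ℝ) < 1 / 2),
    hdet.eventually_le_const (by positivity : 0 < w * κ / 4)] with n hn hsize hsize' hdet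
  have hT := HyperPMOM.card_modelOf (ht n hn)
  have hTq : t.card ≤ q n := hT ▸ HyperPMOM.card_le_of_odds hw (hodds n hn) (hprior n hn)
  have hqn : q n + t.card ≤ n := by
    have h1 : (n : ℝ) * ε n ≤ n := mul_le_of_le_one_right (Nat.cast_nonneg _) (hε_lt n hn).le
    have h2 : 0 ≤ (n : ℝ) ^ ζ := by positivity
    have h3 : (2 * q n : ℝ) ≤ n := by linarith
    have h4 : 2 * q n ≤ n := by exact_mod_cast h3
    omega
  refine HyperPMOM.measure_le_dist_posterior (c := c) (h := (n : ℝ) ^ ζ) hv (he_law n)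
    (he_indep n) hn hw hC.le hD.le (hε_pos n hn) (hε_lt n hn) hT (hodds n hn) (hprior n hn)
    (fun e' h1 h2 h3 => hmain hn (HyperPMOM.quadBound_of_eigenvalues (hA n hn)) (hε_pos n hn)
      (hε_lt n hn) hT hTq
      (fun k hk => (hX n hn k hk).designBound hn (hk.trans hqn)) (fun j hj => hβ0 j fun h => hj
        (Finset.mem_filter.2 ⟨Finset.mem_univ _, h⟩))
      (fun j hj => hbt j (Finset.mem_filter.1 hj).2)
      (HyperPMOM.dotProduct_self_le_sum_of_support hβ0) (by positivity) hsize h1 h2 h3)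
    hs0 (min_le_left _ _) ?_
  simp only [Function.comp_apply] at hdet
  rw [div_lt_iff₀ hw]
  have := mul_pos hw hκ
  linarith
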